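/- For integers $n\ge 3$ and $1\le k<n/2$ let $G(n,k)$ be the graph with vertices $u_0,\dots,u_{n-1},v_0,\dots,v_{n-1}$ and edges $u_iu_{i+1},\ u_iv_i,\ v_iv_{i+k}$ (indices modulo $n$). A graph is a generalized Petersen graph if it is isomorphic to some $G(n,k)$. Consider the following algorithm. Its input is a cubic graph $G$ on $N=2n$ vertices, given by adjacency lists. Every choice that is not specified ("a member", "a largest component", the first vertex and the direction of a cyclic order) is arbitrary. **Main$(G)$.** (1) For every edge $e$ let $H_e$ be the subgraph formed by the edges at distance at most $4$ from $e$ in the line graph of $G$. Compute the number $\sigma(e)$ of $8$-cycles of $H_e$ that contain $e$, and let $\mathcal P$ be the partition of $E(G)$ into the nonempty sets of edges with equal $\sigma$. (2) Let $U$ be a member of $\mathcal P$ of minimal cardinality. If $|U|\ne n$, return False. (3) If the subgraph formed by $U$ has maximum degree $1$, replace $U$ by the vertex set of a largest component of $G-U$ (edge deletion). (4) If $G[U]$ is $2$-regular, where $G[U]$ is the subgraph formed by $U$ if $U$ is still an edge set and the induced subgraph otherwise, return the value of Extend on $G$ and the vertex set of $G[U]$. Otherwise return False. **Extend$(G,U)$**,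 for a vertex set $U$. (1) If $G[U]$ is not a cycle of length $n$, then return False if $|U|\ne n$ or $G[V(G)\setminus U]$ is not a cycle of length $n$, and otherwise replace $U$ by $V(G)\setminus U$. (2) Label $U=\{u_0,\dots,u_{n-1}\}$ in cyclic order and let $v_i$ be the neighbour of $u_i$ other than $u_{i-1}$ and $u_{i+1}$. If $v_0,\dots,v_{n-1}$ are not pairwise distinct, return False. (3) Let $k$ be the least integer with $0\le k<n/2$ such that $v_k$ is adjacent to $v_0$. If there is none, return False. (4) If $v_iv_{i+k}\in E(G)$ for all $1\le i<n$ (indices modulo $n$), return True. Otherwise return False. There is an implementation of this algorithm and a constant $C$ such that, for every cubic graph $G$ on $N\ge 1$ vertices with $N\notin\{6,8,10,16,20,24,26,48,52\}$, every adjacency-list representation of $G$ and every run of the algorithm (for all the arbitrary choices), the run returns True if and only if $G$ is a generalized Petersen graph, and it makes at most $C\cdot N$ elementary steps of a unit-cost random access machine. -/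

import Mathlib

/-! ## Generalized Petersen graphs -/

/-- The graph `G(n, k)`: the vertices `u i` are `Sum.inl i`, the vertices `v i` are `Sum.inr i`,
with `i` modulo `n`, and the edges are `u i - u (i+1)`, `u i - v i`, `v i - v (i+k)`. -/
def generalizedPetersen (n k : ℕ) : SimpleGraph (ZMod n ⊕ ZMod n) :=
  SimpleGraph.fromRel fun x y =>
    (∃ i : ZMod n, x = Sum.inl i ∧ y = Sum.inl (i + 1)) ∨
    (∃ i : ZMod n, x = Sum.inl i ∧ y = Sum.inr i) ∨
    (∃ i : ZMod n, x = Sum.inr i ∧ y = Sum.inr (i + (k : ZMod n)))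

/-- Membership in the class `GP` of generalized Petersen graphs, up to isomorphism:
`n ≥ 3` and `1 ≤ k < n / 2`. -/
def IsGeneralizedPetersen {V : Type*} (G : SimpleGraph V) : Prop :=
  ∃ n k : ℕ, 3 ≤ n ∧ 1 ≤ k ∧ 2 * k < n ∧ Nonempty (G ≃g generalizedPetersen n k)

/-! ## Nondeterministic programs with a step count

A program returns a value (`ret`), spends one unit of time (`tick`), or branches
nondeterministically (`amb`). Nondeterminism models the arbitrary choices of the algorithm.
Every execution of a program is finite, and there is at least one. -/

inductive Prog (α : Type) : Type where
  | ret (a : α) : Prog α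
  | tick (p : Prog α) : Prog α
  | amb (p q : Prog α) : Prog α

namespace Prog

def bind {α β : Type} : Prog α → (α → Prog β) → Prog β
  | ret a, f => f a
  | tick p, f => tick (bind p f)
  | amb p q, f => amb (bind p f) (bind q f)

instance : Monad Prog where
  pure := ret
  bind := bind

/-- `p.Runs a t`: some execution of `p` returns `a` after exactly `t` steps. -/
def Runs {α : Type} : Prog α → α → ℕ → Prop
  | ret b, a, t => b = a ∧ t = 0
  | tick p, a, t => ∃ s, Runs p a s ∧ t = s + 1
  | amb p q, a, t => Runs p a t ∨ Runs q a t

theorem exists_runs {α : Type} (p : Prog α) : ∃ a t, p.Runs a t := by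
  induction p with
  | ret a => exact ⟨a, 0, rfl, rfl⟩
  | tick p ih =>
    obtain ⟨a, t, h⟩ := ih
    exact ⟨a, t + 1, t, h, rfl⟩
  | amb p q ihp _ =>
    obtain ⟨a, t, h⟩ := ihp
    exact ⟨a, t, Or.inl h⟩

/-- One elementary operation of a random access machine, at unit cost: an arithmetic or Boolean
operation or a comparison of machine words (numbers, vertices, records of at most three of these),
one access to the input, reading `f i` or writing `Function.update f i x` one cell of an array,
putting one cell in front of a linked list. Arrays are modelled by functions. -/
def op {α : Type} (a : α) : Prog α := tick (ret a)

/-- Allocation of an array of `m` cells that all hold `a`: `m` steps. -/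
def alloc {ι α : Type} : ℕ → α → Prog (ι → α)
  | 0, a => op fun _ => a
  | m + 1, a => tick (alloc m a)

/-- `for a in l do s ← f a s`, with one step per iteration besides the cost of the body. -/
def forEach {α σ : Type} : List α → σ → (α → σ → Prog σ) → Prog σ
  | [], s, _ => op s
  | a :: l, s, f => tick do
      let s' ← f a s
      forEach l s' f

/-- An arbitrary member of the list `a :: l`. -/
def pick {α : Type} (a : α) : List α → Prog α
  | [] => op a
  | b :: l => tick (amb (ret a) (pick b l))

/-- Linear search: is `x` a member of the list? -/
def mem {α : Type} [DecidableEq α] (x : α) : List α → Prog Bool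
  | [] => op false
  | y :: l => do
      let b ← op (decide (x = y))
      if b then pure true else mem x l

end Prog

/-! ## The recognition algorithm

Input: a cubic graph on the vertices `0, …, N - 1`, given by its adjacency lists: `A x j`, for
`j = 0, 1, 2`, are the three neighbours of `x`. An edge is stored as the pair of its ends, the
smaller one first. -/

namespace Recognition

open Prog

/-- `A` lists the neighbours of every vertex of the (necessarily cubic) graph `G`. -/
def IsAdjacencyList {N : ℕ} (G : SimpleGraph (Fin N)) (A : Fin N → Fin 3 → Fin N) : Prop :=
  ∀ x, Function.Injective (A x) ∧ ∀ y, G.Adj x y ↔ ∃ j, A x j = y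

abbrev Edge (N : ℕ) : Type := Fin N × Fin N

section Local

variable {N : ℕ} (A : Fin N → Fin 3 → Fin N)

/-- The edge with ends `x` and `y`. -/
def mkEdge (x y : Fin N) : Prog (Edge N) := do
  let b ← op (decide (x < y))
  if b then op (x, y) else op (y, x)

/-- Is `x` adjacent to `y`? -/
def adjacent (x y : Fin N) : Prog Bool :=
  forEach [0, 1, 2] false fun j found => do
    let w ← op (A x j)
    let b ← op (decide (w = y))
    op (found || b)

/-- The list of all edges. -/
def allEdges : Prog (List (Edge N)) :=
  forEach (List.finRange N) [] fun x E =>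
    forEach [0, 1, 2] E fun j E => do
      let w ← op (A x j)
      let b ← op (decide (x < w))
      if b then op ((x, w) :: E) else pure E

/-- Adds to a set of edges all the edges that share an end with one of its members. -/
def grow (S : List (Edge N)) : Prog (List (Edge N)) :=
  forEach S S fun e T =>
    forEach [e.1, e.2] T fun x T =>
      forEach [0, 1, 2] T fun j T => do
        let w ← op (A x j)
        let f ← mkEdge x w
        let b ← mem f T
        if b then pure T else op (f :: T)

/-- The edges at distance at most `r` from `e` in the line graph; they form the edge-induced
subgraph `G[N_0(e) ∪ … ∪ N_r(e)]`. -/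
def edgeBall (e : Edge N) : ℕ → Prog (List (Edge N))
  | 0 => op [e]
  | r + 1 => do
      let S ← edgeBall e r
      grow A S

/-- A path is stored as its last vertex together with the list of all its vertices. If `x` is the
last vertex of `p` and `y` is not on `p`, then the extension of `p` by `y` is added to `acc`. -/
def tryStep (x y : Fin N) (p : Fin N × List (Fin N)) (acc : List (Fin N × List (Fin N))) :
    Prog (List (Fin N × List (Fin N))) := do
  let b ← op (decide (x = p.1))
  if b then do
    let c ← mem y p.2
    if c then pure acc else do
      let q ← op (y :: p.2)
      op ((y, q) :: acc)
  else pure acc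

/-- All extensions by one edge of `H` of the paths in `P`. -/
def extendPaths (H : List (Edge N)) (P : List (Fin N × List (Fin N))) :
    Prog (List (Fin N × List (Fin N))) :=
  forEach P [] fun p acc =>
    forEach H acc fun f acc => do
      let acc ← tryStep f.1 f.2 p acc
      tryStep f.2 f.1 p acc

/-- All paths in `H` with `r + 1` edges that begin with `e`, traversed from `e.1` to `e.2`. -/
def pathsFrom (H : List (Edge N)) (e : Edge N) : ℕ → Prog (List (Fin N × List (Fin N)))
  | 0 => op [(e.2, [e.2, e.1])]
  | r + 1 => do
      let P ← pathsFrom H e r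
      extendPaths H P

/-- The number `σ_H(e)` of `8`-cycles of `H` through `e`: each of them is counted once, as a path on
`8` vertices that begins with `e` and whose last vertex is adjacent in `H` to the first one. -/
def sigma (H : List (Edge N)) (e : Edge N) : Prog ℕ := do
  let P ← pathsFrom H e 6
  forEach P 0 fun p c => do
    let f ← mkEdge p.1 e.1
    let b ← mem f H
    if b then op (c + 1) else pure c

end Local

/-! ### The procedure `Extend` -/

section Extend

variable {N : ℕ} (A : Fin N → Fin 3 → Fin N)

/-- The neighbours of `x` in the vertex set `S`. -/
def neighborsIn (S : Fin N → Bool) (x : Fin N) : Prog (List (Fin N)) :=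
  forEach [0, 1, 2] [] fun j l => do
    let w ← op (A x j)
    let b ← op (S w)
    if b then op (w :: l) else pure l

/-- The number of members of a list. -/
def count {α : Type} (l : List α) : Prog ℕ :=
  forEach l 0 fun _ c => op (c + 1)

/-- The members of a vertex set. -/
def members (S : Fin N → Bool) : Prog (List (Fin N)) :=
  forEach (List.finRange N) [] fun x l => do
    let b ← op (S x)
    if b then op (x :: l) else pure l

/-- The complement of a vertex set. -/
def complement (S : Fin N → Bool) : Prog (Fin N → Bool) := do
  let T ← alloc N false
  forEach (List.finRange N) T fun x T => do
    let b ← op (S x)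
    op (Function.update T x (!b))

/-- Has every vertex of `S` exactly two neighbours in `S`? -/
def isTwoRegular (S : Fin N → Bool) : Prog Bool := do
  let l ← members S
  forEach l true fun x ok => do
    let nb ← neighborsIn A S x
    let d ← count nb
    let b ← op (decide (d = 2))
    op (ok && b)

/-- Goes on along the `2`-regular graph `G[S]`, from `prev` to `cur` and so forth, until `s` is
reached, and puts the vertices that it meets in front of `acc`. -/
def walk (S : Fin N → Bool) (s : Fin N) :
    (fuel : ℕ) → (prev cur : Fin N) → (acc : List (Fin N)) → Prog (List (Fin N))
  | 0, _, _, acc => op acc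
  | fuel + 1, prev, cur, acc => do
      let done ← op (decide (cur = s))
      if done then pure acc else do
        let acc ← op (cur :: acc)
        let nb ← neighborsIn A S cur
        let next ← forEach nb prev fun w best => do
          let b ← op (decide (w = prev))
          if b then pure best else op w
        walk S s fuel cur next acc

/-- If `G[S]` is a cycle of length `n`, a listing of `S` in cyclic order, with an arbitrary first
vertex and an arbitrary direction; `none` if `G[S]` is not a cycle of length `n`. -/
def cyclicOrder (S : Fin N → Bool) (n : ℕ) : Prog (Option (List (Fin N))) := do
  let l ← members S
  let c ← count l
  let b ← op (decide (c = n))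
  let r ← isTwoRegular A S
  if b && r then
    match l with
    | [] => op none
    | x :: l => do
        let s ← pick x l
        let nb ← neighborsIn A S s
        match nb with
        | [] => op none
        | y :: nb => do
            let t ← pick y nb
            let o ← walk A S s n s t [s]
            let c ← count o
            let b ← op (decide (c = n))
            if b then op (some o) else op none
  else op none

/-- `(i + j) mod n` -/
def addMod (n i j : ℕ) : Prog ℕ := do
  let a ← op (i + j)
  op (a % n)

/-- The array with the entries of the list. -/
def toArray (n : ℕ) (x : Fin N) (l : List (Fin N)) : Prog (ℕ → Fin N) := do
  let a ← alloc n x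
  let r ← forEach l (a, 0) fun y s => do
    let a ← op (Function.update s.1 s.2 y)
    let i ← op (s.2 + 1)
    pure (a, i)
  pure r.1

/-- The array of the vertices `v i`: `v i` is the neighbour of `u i` other than `u (i + 1)` and
`u (i - 1)`. -/
def spokeEnds (n : ℕ) (x : Fin N) (u : ℕ → Fin N) : Prog (ℕ → Fin N) := do
  let v ← alloc n x
  forEach (List.range n) v fun i v => do
    let i₁ ← addMod n i 1
    let i₂ ← addMod n i (n - 1)
    let c ← op (u i)
    let c₁ ← op (u i₁)
    let c₂ ← op (u i₂)
    forEach [0, 1, 2] v fun j v => do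
      let w ← op (A c j)
      let b₁ ← op (decide (w = c₁))
      let b₂ ← op (decide (w = c₂))
      if b₁ || b₂ then pure v else op (Function.update v i w)

/-- Are `v 0, …, v (n - 1)` pairwise distinct? -/
def allDistinct (n : ℕ) (v : ℕ → Fin N) : Prog Bool := do
  let seen ← alloc N false
  let r ← forEach (List.range n) (seen, true) fun i s => do
    let x ← op (v i)
    let b ← op (s.1 x)
    let seen ← op (Function.update s.1 x true)
    let ok ← op (s.2 && !b)
    pure (seen, ok)
  pure r.2

/-- The first `k`, from the given one on, with `k < n / 2` such that `v k` is adjacent to `v 0`. -/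
def findK (n : ℕ) (v : ℕ → Fin N) : (fuel : ℕ) → (k : ℕ) → Prog (Option ℕ)
  | 0, _ => op none
  | fuel + 1, k => do
      let d ← op (k + k)
      let b ← op (decide (d < n))
      if b then do
        let x ← op (v 0)
        let y ← op (v k)
        let found ← adjacent A x y
        if found then op (some k) else do
          let k ← op (k + 1)
          findK n v fuel k
      else op none

/-- Is `v i` adjacent to `v (i + k)` for `1 ≤ i < n`? -/
def checkInner (n k : ℕ) (v : ℕ → Fin N) : Prog Bool :=
  forEach (List.range' 1 (n - 1)) true fun i ok => do
    let i' ← addMod n i k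
    let x ← op (v i)
    let y ← op (v i')
    let b ← adjacent A x y
    op (ok && b)

/-- The procedure `Extend` after the vertices of the outer rim have been put in cyclic order: are
the `v i` pairwise distinct, and is there a `k < n / 2` such that every `v i` is adjacent to
`v (i + k)`? (The `k` that is found makes `v 0` adjacent to `v k`.) -/
def extendRim (n : ℕ) (rim : List (Fin N)) : Prog Bool :=
  match rim with
  | [] => op false
  | x :: _ => do
      let u ← toArray n x rim
      let v ← spokeEnds A n x u
      let d ← allDistinct n v
      if d then do
        let k ← findK A n v n 0
        match k with
        | none => op false
        | some k => checkInner A n k v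
      else op false

/-- The procedure `Extend(G, U)`. -/
def extend (n : ℕ) (U : Fin N → Bool) : Prog Bool := do
  let o ← cyclicOrder A U n
  match o with
  | some rim => extendRim A n rim
  | none => do
      let l ← members U
      let c ← count l
      let b ← op (decide (c = n))
      let W ← complement U
      let o ← cyclicOrder A W n
      match o with
      | some rim => if b then extendRim A n rim else op false
      | none => op false

end Extend

/-! ### The procedure `Main` -/

section Main

variable {N : ℕ} (A : Fin N → Fin 3 → Fin N)

/-- A part of the partition of the edges: the common value of `σ`, the edges, their number. -/
abbrev Part (N : ℕ) : Type := ℕ × List (Edge N) × ℕ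

/-- Puts the edge `e` into the part that belongs to the value `s`. -/
def insertEdge (s : ℕ) (e : Edge N) : List (Part N) → Prog (List (Part N))
  | [] => op [(s, [e], 1)]
  | p :: P => do
      let b ← op (decide (p.1 = s))
      if b then do
        let F ← op (e :: p.2.1)
        let c ← op (p.2.2 + 1)
        op ((s, F, c) :: P)
      else do
        let P ← insertEdge s e P
        op (p :: P)

/-- The partition of the edges according to the values of `σ`, computed in `4`-neighbourhoods.
Only the nonempty parts are listed. -/
def sigmaPartition : Prog (List (Part N)) := do
  let E ← allEdges A
  forEach E [] fun e P => do
    let H ← edgeBall A e 4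
    let s ← sigma H e
    insertEdge s e P

/-- The members of a list for which `f` is minimal. -/
def minimalMembers {α : Type} (f : α → ℕ) (l : List α) : Prog (List α) :=
  match l with
  | [] => op []
  | a :: l => do
      let m ← forEach l (f a) fun x m => do
        let b ← op (decide (f x < m))
        if b then op (f x) else pure m
      forEach (a :: l) [] fun x acc => do
        let b ← op (decide (f x = m))
        if b then op (x :: acc) else pure acc

/-- The members of a list for which `f` is maximal. -/
def maximalMembers {α : Type} (f : α → ℕ) (l : List α) : Prog (List α) :=
  match l with
  | [] => op []
  | a :: l => do
      let m ← forEach l (f a) fun x m => do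
        let b ← op (decide (m < f x))
        if b then op (f x) else pure m
      forEach (a :: l) [] fun x acc => do
        let b ← op (decide (f x = m))
        if b then op (x :: acc) else pure acc

/-- The degrees of the vertices in the subgraph formed by the edges in `U`. -/
def degrees (U : List (Edge N)) : Prog (Fin N → ℕ) := do
  let deg ← alloc N 0
  forEach U deg fun e deg =>
    forEach [e.1, e.2] deg fun x deg => do
      let d ← op (deg x)
      let d ← op (d + 1)
      op (Function.update deg x d)

/-- The array of the partners of the vertices in the matching `U`. -/
def partners (U : List (Edge N)) : Prog (Fin N → Option (Fin N)) := do
  let a ← alloc N none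
  forEach U a fun e a => do
    let a ← op (Function.update a e.1 (some e.2))
    op (Function.update a e.2 (some e.1))

/-- Depth first search in `G - U`, where `U` is the matching given by `mate`: `todo` is the stack,
`comp` and `size` are the vertices found so far and their number. A search pops at most `3 N + 1`
vertices from the stack, so that it never runs out of fuel. -/
def search (mate : Fin N → Option (Fin N)) :
    (fuel : ℕ) → (todo : List (Fin N)) → (seen : Fin N → Bool) → (comp : List (Fin N)) →
      (size : ℕ) → Prog ((Fin N → Bool) × List (Fin N) × ℕ)
  | 0, _, seen, comp, size => op (seen, comp, size)
  | _ + 1, [], seen, comp, size => op (seen, comp, size)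
  | fuel + 1, x :: todo, seen, comp, size => do
      let b ← op (seen x)
      if b then search mate fuel todo seen comp size else do
        let seen ← op (Function.update seen x true)
        let comp ← op (x :: comp)
        let size ← op (size + 1)
        let m ← op (mate x)
        let todo ← forEach [0, 1, 2] todo fun j todo => do
          let w ← op (A x j)
          let b ← op (decide (m = some w))
          if b then pure todo else op (w :: todo)
        search mate fuel todo seen comp size

/-- The components of `G - U`, as lists of vertices, with the numbers of their vertices. -/
def components (mate : Fin N → Option (Fin N)) : Prog (List (List (Fin N) × ℕ)) := do
  let seen ← alloc N false
  let r ← forEach (List.finRange N) (seen, []) fun x s => do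
    let b ← op (s.1 x)
    if b then pure s else do
      let c ← search A mate (3 * N + 1) [x] s.1 [] 0
      let l ← op (c.2 :: s.2)
      pure (c.1, l)
  pure r.2

/-- The vertex set with the given members. -/
def toSet (l : List (Fin N)) : Prog (Fin N → Bool) := do
  let S ← alloc N false
  forEach l S fun x S => op (Function.update S x true)

/-- `Main` when the maximum degree of `G[U]` is `1`: `U` is replaced by a largest component of
`G - U`. -/
def mainMatching (n : ℕ) (U : List (Edge N)) : Prog Bool := do
  let mate ← partners U
  let cs ← components A mate
  let ms ← maximalMembers (fun c => c.2) cs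
  match ms with
  | [] => op false
  | c :: ms => do
      let c ← pick c ms
      let S ← toSet c.1
      let b ← isTwoRegular A S
      if b then extend A n S else op false

/-- `Main` when the maximum degree of `G[U]` is not `1`: it is tested whether the subgraph `G[U]`
formed by the edges in `U` is `2`-regular. -/
def mainRegular (n : ℕ) (deg : Fin N → ℕ) : Prog Bool := do
  let S ← alloc N false
  let r ← forEach (List.finRange N) (S, true) fun x s => do
    let d ← op (deg x)
    let zero ← op (decide (d = 0))
    if zero then pure s else do
      let S ← op (Function.update s.1 x true)
      let b ← op (decide (d = 2))
      let ok ← op (s.2 && b)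
      pure (S, ok)
  if r.2 then extend A n r.1 else op false

/-- The procedure `Main(G)`; the answer `true` means that `G` is a generalized Petersen graph. -/
def mainProcedure : Prog Bool := do
  let n ← op (N / 2)
  let P ← sigmaPartition A
  let ps ← minimalMembers (fun p => p.2.2) P
  match ps with
  | [] => op false
  | p :: ps => do
      let p ← pick p ps
      let b ← op (decide (p.2.2 = n))
      if b then do
        let deg ← degrees p.2.1
        let Δ ← forEach (List.finRange N) 0 fun x m => do
          let d ← op (deg x)
          let b ← op (decide (m < d))
          if b then op d else pure m
        let matching ← op (decide (Δ = 1))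
        if matching then mainMatching A n p.2.1 else mainRegular A n deg
      else op false

end Main

end Recognition

/-!
The algorithm decides correctly because the number of `8`-cycles through an edge separates the edges
of a generalized Petersen graph.

*Octagons.* An `8`-cycle through `e` only uses edges at distance at most `4` from `e`, so that the
value `σ(e)` computed in the ball around `e` is the number `octagonCount` of octagons of the whole
graph through `e` (`octagons_edgeRel`, `sat_sigma_edgeBall`). In `G(n, k)` rotations are
automorphisms; hence `σ` is constant on the outer edges, on the spokes, and on the inner edges.

*The three numbers are not all equal*, except for `n = 3, 4, 5, 8, 10, 12, 13, 24, 26`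
(`octagonCount_not_all_equal`). All the graphs `G(n, k)` are quotients of one infinite graph on two
copies of `ℤ × ℤ`, where `(a, b)` lies over `a + b k`. Octagons are the images of certain paths with
seven edges of this covering graph, and whether such a path lies over an octagon depends on `n` and
`k` only through the short relations, the short vectors `(a, b)` with `a + b k = 0` modulo `n`
(`octagonCount_eq_liftCount`, `liftCount_congr`). If there is no short relation, or if all of them
are multiples of one, then a computation for each of finitely many vectors suffices. Otherwise `n`
divides the nonzero determinant of two short vectors and is at most `40`
(`distinguishes_relation`).

*The chosen part.* Since some family of edges has a value of `σ` of its own, a part of minimal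
cardinality is exactly one of the three families (`IsPartition.exists_family`). If it is a rim, the
algorithm goes on with that rim. If it consists of the spokes, then deleting them leaves the two
rims. The outer one is connected, so that a largest component is a whole rim
(`sat_mainMatching_of_spokes`). In all cases `Extend` is called with one of the rims.

*Extend.* Given the outer rim, or an inner rim that is a cycle of length `n` (in which case the two
rims can be interchanged, `exists_iso_swap`), the labels `v i` are those of `G(n, k)` up to rotation
and reflection, and all tests succeed (`IsLabelling.complete`, `sat_extend_of_rim`). Conversely, for
any cubic graph the answer `true` exhibits an isomorphism (`IsLabelling.isGeneralizedPetersen`,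
`sat_extend`). This gives soundness without any assumption on `N`.

*Time.* `Prog.Sat p Q` says that every execution of `p` ends in a value and a number of steps that
satisfy `Q`. The rules for this notion follow the structure of the programs. Balls of radius `4` in
a cubic graph have bounded size, so that each `σ(e)` takes constant time and there are boundedly
many parts. The other loops run over vertices, over the edges of one part, or over the stack of the
depth first search, on which each vertex puts at most three entries (`sat_search`).
-/

/-! ### Octagons through an edge -/

namespace Octagon

section Paths

variable {V : Type*}

/-- `IsPath R x y r l`: the list `l` holds, last vertex first, the vertices of a path with `r + 1`
edges of the relation `R` whose first two vertices are `x` and `y`. -/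
def IsPath (R : V → V → Prop) (x y : V) : ℕ → List V → Prop
  | 0, l => l = [y, x]
  | r + 1, l => ∃ a b p, l = a :: b :: p ∧ IsPath R x y r (b :: p) ∧ R b a ∧ a ∉ b :: p

/-- The `8`-cycles through the edge from `x` to `y`, each one cut open before `x`: paths on eight
vertices that begin with `x`, `y` and end in a neighbour of `x`. -/
def octagons (R : V → V → Prop) (x y : V) : Set (List V) :=
  {l | IsPath R x y 6 l ∧ ∃ a p, l = a :: p ∧ R a x}

/-- The number of `8`-cycles through the edge from `x` to `y`. -/
noncomputable def octagonCount (R : V → V → Prop) (x y : V) : ℕ := (octagons R x y).ncard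

theorem IsPath.length {R : V → V → Prop} {x y : V} {r : ℕ} {l : List V} (h : IsPath R x y r l) :
    l.length = r + 2 := by
  induction r generalizing l with
  | zero => rw [IsPath] at h; simp [h]
  | succ r ih =>
    obtain ⟨a, b, p, rfl, h, -⟩ := h
    simpa using ih h

theorem IsPath.map {W : Type*} {R : V → V → Prop} {S : W → W → Prop} {x y : V} {f : V → W}
    (hf : Function.Injective f) (hR : ∀ a b, R a b → S (f a) (f b)) {r : ℕ} {l : List V}
    (h : IsPath R x y r l) : IsPath S (f x) (f y) r (l.map f) := by
  induction r generalizing l with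
  | zero => rw [IsPath] at h ⊢; simp [h]
  | succ r ih =>
    obtain ⟨a, b, p, rfl, h, hab, hmem⟩ := h
    refine ⟨f a, f b, p.map f, rfl, ih h, hR _ _ hab, ?_⟩
    simpa [hf.eq_iff] using hmem

theorem isPath_succ_cons_cons {R : V → V → Prop} {x y : V} {r : ℕ} {a b : V} {p : List V} :
    IsPath R x y (r + 1) (a :: b :: p) ↔ IsPath R x y r (b :: p) ∧ R b a ∧ a ∉ b :: p := by
  constructor
  · rintro ⟨_, _, _, h, h'⟩
    simp only [List.cons.injEq] at h
    obtain ⟨rfl, rfl, rfl⟩ := h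
    exact h'
  · intro h
    exact ⟨a, b, p, rfl, h⟩

theorem finite_octagons [Finite V] (R : V → V → Prop) (x y : V) : (octagons R x y).Finite :=
  (List.finite_length_eq V 8).subset fun _ h => h.1.length

theorem octagonCount_le_of_injective {W : Type*} [Finite W] {R : V → V → Prop} {S : W → W → Prop}
    {f : V → W} (hf : Function.Injective f) (hR : ∀ a b, R a b → S (f a) (f b)) (x y : V) :
    octagonCount R x y ≤ octagonCount S (f x) (f y) := by
  refine Set.ncard_le_ncard_of_injOn (List.map f) ?_ (hf.list_map.injOn) (finite_octagons _ _ _)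
  rintro _ ⟨h, a, p, rfl, ha⟩
  exact ⟨h.map hf hR, f a, p.map f, rfl, hR _ _ ha⟩

theorem octagonCount_iso {W : Type*} [Finite V] [Finite W] {G : SimpleGraph V} {H : SimpleGraph W}
    (φ : G ≃g H) (x y : V) :
    octagonCount H.Adj (φ x) (φ y) = octagonCount G.Adj x y := by
  refine le_antisymm ?_ ?_
  · have := octagonCount_le_of_injective (R := H.Adj) (S := G.Adj) φ.symm.injective
      (fun a b h => φ.symm.map_adj_iff.2 h) (φ x) (φ y)
    simpa using this
  · exact octagonCount_le_of_injective φ.injective (fun a b h => φ.map_adj_iff.2 h) x y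

theorem octagonCount_le_swap [Finite V] {R : V → V → Prop} (hR : ∀ a b, R a b → R b a) {x y : V}
    (h : R x y) : octagonCount R x y ≤ octagonCount R y x := by
  -- The octagon `x, y, c₁, …, c₆` in the other direction is `y, x, c₆, …, c₁`; the lists begin with
  -- the last vertex.
  refine Set.ncard_le_ncard_of_injOn (fun l => (l.take 6).reverse ++ [x, y]) ?_ ?_
    (finite_octagons _ _ _)
  · rintro l ⟨hl, hx⟩
    have hlen := hl.length
    match l, hlen with
    | [a, b, c, d, e, f, g, k], _ =>
      simp only [isPath_succ_cons_cons] at hl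
      simp only [IsPath, List.cons.injEq, and_true] at hl
      obtain ⟨⟨⟨⟨⟨⟨⟨rfl, rfl⟩, h₁⟩, h₂⟩, h₃⟩, h₄⟩, h₅⟩, h₆⟩ := hl
      obtain ⟨_, _, h₇, hx⟩ := hx
      simp only [List.cons.injEq] at h₇
      obtain ⟨rfl, -⟩ := h₇
      refine ⟨?_, f, _, rfl, hR _ _ h₁.1⟩
      simp only [List.take, List.reverse_cons, List.reverse_nil, List.nil_append, List.cons_append,
        isPath_succ_cons_cons]
      simp only [IsPath, true_and]
      simp only [List.mem_cons, List.not_mem_nil, not_or, or_false] at *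
      refine ⟨⟨⟨⟨⟨⟨hR _ _ hx, ?_⟩, hR _ _ h₆.1, ?_⟩, hR _ _ h₅.1, ?_⟩, hR _ _ h₄.1, ?_⟩,
        hR _ _ h₃.1, ?_⟩, hR _ _ h₂.1, ?_⟩ <;>
        grind
  · intro l hl l' hl' hll
    have hlen := hl.1.length
    have hlen' := hl'.1.length
    match l, l', hlen, hlen' with
    | [a, b, c, d, e, f, g, k], [a', b', c', d', e', f', g', k'], _, _ =>
      have h₁ := hl.1
      have h₂ := hl'.1
      simp only [isPath_succ_cons_cons] at h₁ h₂
      simp only [IsPath, List.cons.injEq, and_true] at h₁ h₂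
      simp only [List.take, List.reverse_cons, List.reverse_nil, List.nil_append, List.cons_append,
        List.cons.injEq] at hll
      grind

theorem octagonCount_comm [Finite V] {R : V → V → Prop} (hR : ∀ a b, R a b → R b a) {x y : V}
    (h : R x y) : octagonCount R x y = octagonCount R y x :=
  (octagonCount_le_swap hR h).antisymm (octagonCount_le_swap hR (hR _ _ h))

/-- A duplicate-free enumeration of the octagons computes their number. -/
theorem octagonCount_eq_length {R : V → V → Prop} {x y : V} {L : List (List V)} (hL : L.Nodup)
    (h : ∀ l, l ∈ L ↔ l ∈ octagons R x y) : octagonCount R x y = L.length := by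
  classical
  have : octagons R x y = (L.toFinset : Set (List V)) := by
    ext l
    simp [h]
  rw [octagonCount, this, Set.ncard_coe_finset, List.toFinset_card_of_nodup hL]

end Paths

/-! ### Enumeration of octagons in a graph given by neighbour lists -/

section Enumeration

variable {V : Type*} [DecidableEq V]

/-- The extensions of a path (a list with its last vertex first) by one vertex. -/
def extensions (nb : V → List V) : List V → List (List V)
  | [] => []
  | a :: p => ((nb a).filter fun z => decide (z ∉ a :: p)).map (· :: a :: p)

/-- The list of the paths with `r + 1` edges that begin with `x`, `y`. -/
def paths (nb : V → List V) (x y : V) : ℕ → List (List V)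
  | 0 => [[y, x]]
  | r + 1 => (paths nb x y r).flatMap (extensions nb)

theorem mem_paths {R : V → V → Prop} {nb : V → List V} (hnb : ∀ a b, R a b ↔ b ∈ nb a) {x y : V}
    {r : ℕ} {l : List V} : l ∈ paths nb x y r ↔ IsPath R x y r l := by
  induction r generalizing l with
  | zero => simp [paths, IsPath]
  | succ r ih =>
    simp only [paths, List.mem_flatMap, ih, IsPath]
    constructor
    · rintro ⟨q, hq, hl⟩
      match q, hq.length with
      | b :: p, _ =>
        simp only [extensions, List.mem_map, List.mem_filter, decide_eq_true_eq] at hl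
        obtain ⟨a, ⟨ha, hp⟩, rfl⟩ := hl
        exact ⟨a, b, p, rfl, hq, (hnb _ _).2 ha, hp⟩
    · rintro ⟨a, b, p, rfl, hp, hab, ha⟩
      refine ⟨b :: p, hp, ?_⟩
      simp only [extensions, List.mem_map, List.mem_filter, decide_eq_true_eq]
      exact ⟨a, ⟨(hnb _ _).1 hab, ha⟩, rfl⟩

theorem nodup_paths {nb : V → List V} (hnb : ∀ a, (nb a).Nodup) (x y : V) (r : ℕ) :
    (paths nb x y r).Nodup := by
  induction r with
  | zero => simp [paths]
  | succ r ih =>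
    rw [paths, List.nodup_flatMap]
    refine ⟨fun q _ => ?_, ih.imp ?_⟩
    · cases q with
      | nil => simp [extensions]
      | cons a p =>
        exact ((hnb a).filter _).map fun _ _ h => (List.cons.inj h).1
    · intro q q' hq
      simp only [Function.onFun, List.disjoint_left]
      intro l hl hl'
      cases q <;> cases q' <;> simp only [extensions, List.mem_map, List.not_mem_nil] at hl hl'
      obtain ⟨_, -, rfl⟩ := hl
      obtain ⟨_, -, h⟩ := hl'
      exact hq (List.cons.inj h).2.symm

/-- Does the last vertex of the path have a neighbour which satisfies `f`? -/
def closes (nb : V → List V) (f : V → Bool) : List V → Bool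
  | [] => false
  | a :: _ => (nb a).any f

theorem octagonCount_eq_length_filter {R : V → V → Prop} {nb : V → List V}
    (hR : ∀ a b, R a b ↔ b ∈ nb a) (hnb : ∀ a, (nb a).Nodup) (x y : V) :
    octagonCount R x y =
      ((paths nb x y 6).filter (closes nb fun z => decide (z = x))).length := by
  refine octagonCount_eq_length ((nodup_paths hnb x y 6).filter _) fun l => ?_
  rw [List.mem_filter, mem_paths hR, octagons, Set.mem_ofPred_eq]
  refine and_congr_right fun h => ?_
  cases l with
  | nil => simp [closes]
  | cons a p => simp [closes, hR]

end Enumeration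

/-! ### The covering of a generalized Petersen graph -/

/-- A vertex of the infinite graph that covers all graphs `G(n, k)`: `(false, a, b)` lies over
`u (a + b k)` and `(true, a, b)` lies over `v (a + b k)`. -/
abbrev Lift : Type := Bool × ℤ × ℤ

/-- The neighbours of a vertex of the covering graph. -/
def liftNeighbors : Lift → List Lift
  | (false, a, b) => [(false, a + 1, b), (false, a - 1, b), (true, a, b)]
  | (true, a, b) => [(true, a, b + 1), (true, a, b - 1), (false, a, b)]

/-- The paths with eight vertices of the covering graph that begin with `p`, `q`. -/
def liftPaths (p q : Lift) : List (List Lift) := paths liftNeighbors p q 6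

/-- Do the two lifts lie over the same vertex? Here `t a b` tells whether `a + b k` is `0`. -/
def same (t : ℤ → ℤ → Bool) (p q : Lift) : Bool :=
  (p.1 == q.1) && t (p.2.1 - q.2.1) (p.2.2 - q.2.2)

/-- Do the lifts in the list lie over pairwise different vertices? -/
def separated (t : ℤ → ℤ → Bool) : List Lift → Bool
  | [] => true
  | p :: l => l.all (fun q => !same t p q) && separated t l

/-- The number of paths of the covering graph which begin with `p`, `q` and lie over an octagon. -/
def liftCount (t : ℤ → ℤ → Bool) (p q : Lift) : ℕ :=
  ((liftPaths p q).filter fun w => closes liftNeighbors (same t p) w && separated t w).length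

/-- The neighbours of a vertex of `G(n, k)`. -/
def neighbors (n k : ℕ) : ZMod n ⊕ ZMod n → List (ZMod n ⊕ ZMod n)
  | Sum.inl i => [Sum.inl (i + 1), Sum.inl (i - 1), Sum.inr i]
  | Sum.inr i => [Sum.inr (i + k), Sum.inr (i - k), Sum.inl i]

/-- The covering map. -/
def proj (n k : ℕ) : Lift → ZMod n ⊕ ZMod n
  | (false, a, b) => Sum.inl (a + b * k)
  | (true, a, b) => Sum.inr (a + b * k)

/-- The test whether `a + b k` is `0` modulo `n`. -/
def relation (n k : ℕ) (a b : ℤ) : Bool := decide ((n : ℤ) ∣ a + b * k)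

section ZMod

variable {n k : ℕ}

theorem one_ne_zero_zmod (hn : 3 ≤ n) : (1 : ZMod n) ≠ 0 := by
  have : Fact (1 < n) := ⟨by omega⟩
  exact one_ne_zero

theorem two_ne_zero_zmod (hn : 3 ≤ n) : (2 : ZMod n) ≠ 0 := by
  have h : ((2 : ℕ) : ZMod n) ≠ 0 := by
    rw [Ne, ZMod.natCast_eq_zero_iff]
    exact fun h => absurd (Nat.le_of_dvd (by omega) h) (by omega)
  simpa using h

theorem natCast_ne_zero_zmod (hk : 1 ≤ k) (hkn : 2 * k < n) : (k : ZMod n) ≠ 0 := by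
  rw [Ne, ZMod.natCast_eq_zero_iff]
  exact fun h => absurd (Nat.le_of_dvd (by omega) h) (by omega)

theorem two_mul_natCast_ne_zero_zmod (hk : 1 ≤ k) (hkn : 2 * k < n) :
    (k : ZMod n) + k ≠ 0 := by
  have h : ((2 * k : ℕ) : ZMod n) ≠ 0 := by
    rw [Ne, ZMod.natCast_eq_zero_iff]
    exact fun h => absurd (Nat.le_of_dvd (by omega) h) (by omega)
  simpa [two_mul] using h

end ZMod

section Adjacency

variable {n k : ℕ}

theorem adj_inl_inl (hn : 3 ≤ n) {i j : ZMod n} :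
    (generalizedPetersen n k).Adj (Sum.inl i) (Sum.inl j) ↔ j = i + 1 ∨ j = i - 1 := by
  have h1 := one_ne_zero_zmod hn
  simp only [generalizedPetersen, SimpleGraph.fromRel_adj, ne_eq, Sum.inl.injEq, reduceCtorEq,
    and_false, exists_false, or_false]
  constructor
  · rintro ⟨-, ⟨a, rfl, rfl⟩ | ⟨a, rfl, rfl⟩⟩ <;> simp
  · rintro (rfl | rfl)
    · exact ⟨by simpa using h1, Or.inl ⟨i, rfl, rfl⟩⟩
    · exact ⟨fun h => h1 (by linear_combination h), Or.inr ⟨i - 1, rfl, by ring⟩⟩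

theorem adj_inr_inr (hk : 1 ≤ k) (hkn : 2 * k < n) {i j : ZMod n} :
    (generalizedPetersen n k).Adj (Sum.inr i) (Sum.inr j) ↔ j = i + k ∨ j = i - k := by
  have h1 := natCast_ne_zero_zmod hk hkn
  simp only [generalizedPetersen, SimpleGraph.fromRel_adj, ne_eq, Sum.inr.injEq, reduceCtorEq,
    and_false, exists_false, false_and, false_or]
  constructor
  · rintro ⟨-, ⟨a, rfl, rfl⟩ | ⟨a, rfl, rfl⟩⟩ <;> simp
  · rintro (rfl | rfl)
    · exact ⟨by simpa using h1, Or.inl ⟨i, rfl, rfl⟩⟩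
    · exact ⟨fun h => h1 (by linear_combination h), Or.inr ⟨i - k, rfl, by ring⟩⟩

theorem adj_inl_inr {i j : ZMod n} :
    (generalizedPetersen n k).Adj (Sum.inl i) (Sum.inr j) ↔ j = i := by
  simp only [generalizedPetersen, SimpleGraph.fromRel_adj, ne_eq, Sum.inr.injEq, Sum.inl.injEq,
    reduceCtorEq, and_false, exists_false, or_false, false_and, false_or, not_false_eq_true,
    true_and]
  constructor
  · rintro ⟨a, rfl, rfl⟩; rfl
  · rintro rfl; exact ⟨_, rfl, rfl⟩

theorem adj_inr_inl {i j : ZMod n} :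
    (generalizedPetersen n k).Adj (Sum.inr i) (Sum.inl j) ↔ j = i := by
  rw [SimpleGraph.adj_comm, adj_inl_inr, eq_comm]

theorem adj_iff_mem_neighbors (hn : 3 ≤ n) (hk : 1 ≤ k) (hkn : 2 * k < n)
    (x y : ZMod n ⊕ ZMod n) : (generalizedPetersen n k).Adj x y ↔ y ∈ neighbors n k x := by
  rcases x with i | i <;> rcases y with j | j
  · simp [adj_inl_inl hn, neighbors]
  · simp [adj_inl_inr, neighbors]
  · simp [adj_inr_inl, neighbors]
  · simp [adj_inr_inr hk hkn, neighbors]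

theorem nodup_neighbors (hn : 3 ≤ n) (hk : 1 ≤ k) (hkn : 2 * k < n) (x : ZMod n ⊕ ZMod n) :
    (neighbors n k x).Nodup := by
  rcases x with i | i
  · simp only [neighbors, List.nodup_cons, List.mem_cons, Sum.inl.injEq, reduceCtorEq,
      List.not_mem_nil, or_false, not_false_eq_true, List.nodup_nil, and_true]
    intro h
    refine two_ne_zero_zmod hn ?_
    linear_combination h
  · simp only [neighbors, List.nodup_cons, List.mem_cons, Sum.inr.injEq, reduceCtorEq,
      List.not_mem_nil, or_false, not_false_eq_true, List.nodup_nil, and_true]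
    intro h
    refine two_mul_natCast_ne_zero_zmod hk hkn ?_
    linear_combination h

/-- Translation by `c` is an automorphism of `G(n, k)`. -/
def translation (n k : ℕ) (c : ZMod n) : generalizedPetersen n k ≃g generalizedPetersen n k where
  toEquiv := Equiv.sumCongr (Equiv.addLeft c) (Equiv.addLeft c)
  map_rel_iff' := by
    intro x y
    rcases x with i | i <;> rcases y with j | j <;>
      simp [generalizedPetersen, SimpleGraph.fromRel_adj, add_assoc]

end Adjacency

section Cover

variable {n k : ℕ}

theorem map_liftNeighbors (p : Lift) :
    (liftNeighbors p).map (proj n k) = neighbors n k (proj n k p) := by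
  obtain ⟨_ | _, a, b⟩ := p <;> simp [liftNeighbors, proj, neighbors] <;> constructor <;> ring

theorem same_relation (p q : Lift) :
    same (relation n k) p q = decide (proj n k p = proj n k q) := by
  have h : ∀ a b c d : ℤ, (n : ℤ) ∣ a - c + (b - d) * k ↔
      (a + b * k : ZMod n) = c + d * k := by
    intro a b c d
    rw [← ZMod.intCast_zmod_eq_zero_iff_dvd, ← sub_eq_zero (a := (a + b * k : ZMod n))]
    push_cast
    rw [show (a - c + (b - d) * k : ZMod n) = a + b * k - (c + d * k) by ring]
  obtain ⟨_ | _, a, b⟩ := p <;> obtain ⟨_ | _, c, d⟩ := q <;> simp [same, relation, proj, h]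

theorem separated_relation (l : List Lift) :
    separated (relation n k) l = decide (l.map (proj n k)).Nodup := by
  induction l with
  | nil => simp [separated]
  | cons p l ih =>
    rw [separated, ih, List.map_cons, Bool.eq_iff_iff]
    simp [same_relation, @eq_comm _ (proj n k p)]

/-- The paths in a quotient are the images of the lifted paths, as far as these have pairwise
different vertices in the quotient. -/
theorem paths_eq_map_filter {V W : Type*} [DecidableEq V] [DecidableEq W] {nb : V → List V}
    {nb' : W → List W} (f : V → W) (h : ∀ a, (nb a).map f = nb' (f a)) {x y : V} (hxy : f y ≠ f x)
    (r : ℕ) : paths nb' (f x) (f y) r =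
      ((paths nb x y r).filter fun w => decide (w.map f).Nodup).map (List.map f) := by
  induction r with
  | zero =>
    have h' : (List.map f [y, x]).Nodup :=
      List.nodup_cons.2 ⟨fun h => hxy (List.mem_singleton.1 h), List.nodup_singleton _⟩
    simp only [paths, List.filter_cons, h', decide_true, List.filter_nil]
    rfl
  | succ r ih =>
    rw [paths, ih, paths]
    generalize paths nb x y r = L
    induction L with
    | nil => rfl
    | cons w L ihL =>
      rw [List.flatMap_cons, List.filter_append, List.map_append, ← ihL]
      by_cases hw : (w.map f).Nodup
      · rw [List.filter_cons_of_pos (by simpa using hw), List.map_cons, List.flatMap_cons]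
        congr 1
        cases w with
        | nil => rfl
        | cons a p =>
          simp only [List.map_cons, extensions, ← h, List.filter_map, List.map_map,
            List.filter_filter]
          have e : ∀ z ∈ nb a, ((fun z => decide (z ∉ f a :: p.map f)) ∘ f) z =
              (((fun w => decide (w.map f).Nodup) ∘ fun x => x :: a :: p) z &&
                decide (z ∉ a :: p)) := by
            intro z _
            have : z ∈ a :: p → f z ∈ f a :: p.map f := fun hz => by
              simpa using List.mem_map_of_mem (f := f) hz
            have hw' : (f a :: p.map f).Nodup := by simpa using hw
            simp only [Function.comp, List.map_cons, List.nodup_cons (a := f z), hw', and_true]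
            by_cases hz : z ∈ a :: p
            · simp only [this hz, hz, not_true_eq_false, decide_false, Bool.and_self]
            · simp only [hz, not_false_eq_true, decide_true, Bool.and_true]
          rw [List.filter_congr e]
          rfl
      · rw [List.filter_cons_of_neg (by simpa using hw)]
        have e : (extensions nb w).filter (fun w => decide (w.map f).Nodup) = [] := by
          rw [List.filter_eq_nil_iff]
          intro l hl
          cases w with
          | nil => simp [extensions] at hl
          | cons a p =>
            simp only [extensions, List.mem_map] at hl
            obtain ⟨z, -, rfl⟩ := hl
            simp only [List.map_cons, decide_eq_true_eq] at hw ⊢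
            exact fun h => hw (List.nodup_cons.1 h).2
        rw [e]
        rfl

/-- Octagons are counted in the covering graph, where the count depends on `n` and `k` only through
the short vectors `(a, b)` with `a + b k = 0` modulo `n`. -/
theorem octagonCount_eq_liftCount (hn : 3 ≤ n) (hk : 1 ≤ k) (hkn : 2 * k < n) {p q : Lift}
    (hpq : proj n k q ≠ proj n k p) :
    octagonCount (generalizedPetersen n k).Adj (proj n k p) (proj n k q) =
      liftCount (relation n k) p q := by
  rw [octagonCount_eq_length_filter (adj_iff_mem_neighbors hn hk hkn) (nodup_neighbors hn hk hkn),
    paths_eq_map_filter (proj n k) map_liftNeighbors hpq, List.filter_map, List.length_map,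
    List.filter_filter, liftCount, liftPaths]
  congr 1
  refine List.filter_congr fun w _ => ?_
  rw [separated_relation]
  congr 1
  cases w with
  | nil => rfl
  | cons a l =>
    simp only [Function.comp, List.map_cons, closes, ← map_liftNeighbors, List.any_map]
    congr 1
    funext z
    rw [same_relation]
    simp [eq_comm]

end Cover

/-! ### Comparison of the numbers of octagons through the three kinds of edges -/

/-- Are the numbers of octagons through an outer edge, a spoke and an inner edge not all equal, if
`t a b` tells whether `a + b k` vanishes? -/
def distinguishes (t : ℤ → ℤ → Bool) : Bool :=
  (liftCount t (false, 0, 0) (false, 1, 0) != liftCount t (false, 0, 0) (true, 0, 0)) ||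
    (liftCount t (false, 0, 0) (true, 0, 0) != liftCount t (true, 0, 0) (true, 0, 1))

/-- A finite region of `ℤ × ℤ`, closed under negation, that contains the differences of any two
lifts on the same rim that lie on a path with eight edges: if the path uses edges of both rims, then
two of its edges are spokes. -/
def inRange (a b : ℤ) : Bool :=
  decide (a.natAbs + b.natAbs ≤ 6) || (decide (a = 0) && decide (b.natAbs ≤ 8)) ||
    (decide (b = 0) && decide (a.natAbs ≤ 8))

/-- Does the value of `same t p q` only depend on the restriction of `t` to `inRange`? -/
def sameCheck (p q : Lift) : Bool := (p.1 != q.1) || inRange (p.2.1 - q.2.1) (p.2.2 - q.2.2)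

/-- Does the value of `separated t l` only depend on the restriction of `t` to `inRange`? -/
def separatedCheck : List Lift → Bool
  | [] => true
  | q :: l => l.all (sameCheck q) && separatedCheck l

/-- Do the tests `closes` and `separated` of all paths that begin with `p`, `q` only depend on the
restriction of `t` to `inRange`? -/
def pathsCheck (p q : Lift) : Bool :=
  (liftPaths p q).all fun l => separatedCheck l &&
    match l with
    | [] => true
    | r :: _ => (liftNeighbors r).all (sameCheck p)

theorem pathsCheck_outer : pathsCheck (false, 0, 0) (false, 1, 0) = true := by decide +kernel

theorem pathsCheck_spoke : pathsCheck (false, 0, 0) (true, 0, 0) = true := by decide +kernel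

theorem pathsCheck_inner : pathsCheck (true, 0, 0) (true, 0, 1) = true := by decide +kernel

section Congr

variable {t t' : ℤ → ℤ → Bool} (h : ∀ a b, inRange a b = true → t a b = t' a b)
include h

theorem same_congr {p q : Lift} (hpq : sameCheck p q = true) : same t p q = same t' p q := by
  rw [sameCheck, Bool.or_eq_true] at hpq
  rcases hpq with h' | h'
  · have : (p.1 == q.1) = false := by simpa using h'
    simp [same, this]
  · rw [same, same, h _ _ h']

theorem separated_congr {l : List Lift} (hl : separatedCheck l = true) :
    separated t l = separated t' l := by
  induction l with
  | nil => rfl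
  | cons p l ih =>
    rw [separatedCheck, Bool.and_eq_true, List.all_eq_true] at hl
    rw [separated, separated, ih hl.2]
    congr 1
    rw [Bool.eq_iff_iff, List.all_eq_true, List.all_eq_true]
    exact forall₂_congr fun q hq => by rw [same_congr h (hl.1 q hq)]

theorem liftCount_congr {p q : Lift} (hpq : pathsCheck p q = true) :
    liftCount t p q = liftCount t' p q := by
  refine congrArg List.length (List.filter_congr fun l hl => ?_)
  rw [pathsCheck, List.all_eq_true] at hpq
  have hl := hpq l hl
  rw [Bool.and_eq_true] at hl
  rw [separated_congr h hl.1]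
  congr 1
  cases l with
  | nil => rfl
  | cons r l =>
    have hl := List.all_eq_true.1 hl.2
    rw [closes, closes, Bool.eq_iff_iff, List.any_eq_true, List.any_eq_true]
    exact exists_congr fun s => and_congr_right fun hs => by rw [same_congr h (hl s hs)]

theorem distinguishes_congr : distinguishes t = distinguishes t' := by
  rw [distinguishes, distinguishes, liftCount_congr h pathsCheck_outer,
    liftCount_congr h pathsCheck_spoke, liftCount_congr h pathsCheck_inner]

end Congr

/-- The multiples of `(p, q)`, where `q > 0`. -/
def multiples (p q a b : ℤ) : Bool := decide (q ∣ b) && decide (a * q = b * p)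

/-- The members of `inRange` with a positive second entry. -/
def vectors : List (ℤ × ℤ) :=
  (List.range 9).flatMap fun b : ℕ =>
    ((List.range 11).map fun a : ℕ => ((a : ℤ) - 5, (b : ℤ))).filter fun v =>
      decide (0 < v.2) && inRange v.1 v.2

theorem mem_vectors {a b : ℤ} : (a, b) ∈ vectors ↔ 0 < b ∧ inRange a b = true := by
  simp only [vectors, List.mem_flatMap, List.mem_range, List.mem_filter, List.mem_map,
    Bool.and_eq_true, decide_eq_true_eq, Prod.mk.injEq]
  constructor
  · rintro ⟨_, -, -, h⟩
    exact h
  · intro h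
    have h' := h.2
    simp only [inRange, Bool.or_eq_true, Bool.and_eq_true, decide_eq_true_eq] at h'
    exact ⟨b.toNat, by omega, ⟨(a + 5).toNat, by omega, by omega, by omega⟩, h⟩

/-- The vectors of `vectors` with `a + b k = 0` modulo `n`. -/
def relations (n k : ℕ) : List (ℤ × ℤ) := vectors.filter fun v => relation n k v.1 v.2

/-- Are all short relations parallel? -/
def parallel (n k : ℕ) : Bool :=
  (relations n k).all fun v => (relations n k).all fun w => decide (v.1 * w.2 = w.1 * v.2)

/-- Two short vectors have a determinant of absolute value at most `40`. If both are relations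
modulo `n`, then `n` divides the determinant. -/
theorem natAbs_det_vectors_le :
    (vectors.all fun v => vectors.all fun w => decide ((v.1 * w.2 - w.1 * v.2).natAbs ≤ 40)) =
      true := by
  decide +kernel

/-- If there is no short relation, then the three numbers of octagons are those of the covering
graph. -/
theorem distinguishes_no_relation :
    distinguishes (fun a b => decide (a = 0) && decide (b = 0)) = true := by
  decide +kernel

/-- If the relations are the multiples of a single short vector, then the three numbers of octagons
are those of a quotient of the covering graph. The vectors `(0, 1)` and `(0, 2)` need not be
considered, since `n` divides neither `k` nor `2 * k`. -/
theorem distinguishes_multiples :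
    (vectors.all fun v => decide (v = (0, 1)) || decide (v = (0, 2)) ||
      distinguishes (multiples v.1 v.2)) = true := by
  decide +kernel

/-- The graphs with `n ≤ 40` that are not covered by the other two computations, one by one. -/
theorem distinguishes_small :
    ((List.range 41).all fun n => (List.range 20).all fun k =>
      decide (n ∈ [3, 4, 5, 8, 10, 12, 13, 24, 26]) || decide (k = 0) || decide (n ≤ 2 * k) ||
        (decide (8 < n) && parallel n k) || distinguishes (relation n k)) = true := by
  decide +kernel

section Relation

variable {n k : ℕ}

theorem relation_iff {a b : ℤ} : relation n k a b = true ↔ (n : ℤ) ∣ a + b * k := by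
  simp [relation]

theorem relation_neg (a b : ℤ) : relation n k (-a) (-b) = relation n k a b := by
  rw [Bool.eq_iff_iff, relation_iff, relation_iff, ← dvd_neg]
  ring_nf

theorem inRange_neg (a b : ℤ) : inRange (-a) (-b) = inRange a b := by
  simp [inRange]

/-- Two functions on `inRange` that are even, and that vanish in the same way on the first axis, are
equal if they are equal on `vectors`. -/
theorem eq_of_eq_on_vectors {t t' : ℤ → ℤ → Bool} (ht : ∀ a b, t (-a) (-b) = t a b)
    (ht' : ∀ a b, t' (-a) (-b) = t' a b) (h0 : ∀ a, a.natAbs ≤ 8 → t a 0 = t' a 0)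
    (h : ∀ a b, 0 < b → inRange a b = true → t a b = t' a b) (a b : ℤ)
    (hab : inRange a b = true) : t a b = t' a b := by
  rcases lt_trichotomy b 0 with hb | rfl | hb
  · rw [← ht, ← ht']
    exact h _ _ (by omega) (by rwa [inRange_neg])
  · refine h0 a ?_
    simp only [inRange, Bool.or_eq_true, Bool.and_eq_true, decide_eq_true_eq] at hab
    omega
  · exact h a b hb hab

theorem relation_zero_right (hn : 8 < n) {a : ℤ} (ha : a.natAbs ≤ 8) :
    relation n k a 0 = decide (a = 0) := by
  rw [Bool.eq_iff_iff, relation_iff, decide_eq_true_eq, zero_mul, add_zero]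
  exact ⟨fun h => Int.eq_zero_of_dvd_of_natAbs_lt_natAbs h (by simp; omega), by rintro rfl; simp⟩

theorem det_eq_zero_of_lt (hn : 40 < n) {v w : ℤ × ℤ} (hv : v ∈ relations n k)
    (hw : w ∈ relations n k) : v.1 * w.2 = w.1 * v.2 := by
  simp only [relations, List.mem_filter, relation_iff] at hv hw
  have h := natAbs_det_vectors_le
  simp only [List.all_eq_true, decide_eq_true_eq] at h
  have hlt := h v hv.1 w hw.1
  have hdvd : (n : ℤ) ∣ v.1 * w.2 - w.1 * v.2 := by
    rw [show v.1 * w.2 - w.1 * v.2 = (v.1 + v.2 * k) * w.2 - (w.1 + w.2 * k) * v.2 by ring]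
    exact (hv.2.mul_right w.2).sub (hw.2.mul_right v.2)
  have := Int.eq_zero_of_dvd_of_natAbs_lt_natAbs hdvd (by simp; omega)
  omega

/-- If all short relations are parallel, then they are the multiples of one of them. -/
theorem relation_eq_multiples (hn : 8 < n) (hpar : ∀ v ∈ relations n k, ∀ w ∈ relations n k,
    v.1 * w.2 = w.1 * v.2) {p q : ℤ} (hv : (p, q) ∈ relations n k)
    (hmin : ∀ w ∈ relations n k, q ≤ w.2) (a b : ℤ) (hab : inRange a b = true) :
    relation n k a b = multiples p q a b := by
  have hv' := hv
  rw [relations, List.mem_filter, mem_vectors, relation_iff] at hv'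
  obtain ⟨⟨hq, hpq⟩, hdvd⟩ := hv'
  refine eq_of_eq_on_vectors relation_neg ?_ ?_ ?_ a b hab
  · intro a b
    simp [multiples]
  · intro a ha
    rw [relation_zero_right hn ha]
    have : q ≠ 0 := hq.ne'
    simp [multiples, this]
  · clear hab a b
    intro a b hb hab
    rw [Bool.eq_iff_iff, relation_iff, multiples, Bool.and_eq_true, decide_eq_true_eq,
      decide_eq_true_eq]
    constructor
    · intro h
      have hdet : a * q = b * p := by
        have := hpar _ hv (a, b) (by
          rw [relations, List.mem_filter, mem_vectors, relation_iff]; exact ⟨⟨hb, hab⟩, h⟩)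
        simp only at this
        linarith
      refine ⟨?_, hdet⟩
      by_contra hqb
      have hr0 : 0 < b % q := lt_of_le_of_ne (Int.emod_nonneg _ hq.ne')
        (fun h => hqb (Int.dvd_of_emod_eq_zero h.symm))
      have hr1 : b % q < q := Int.emod_lt_of_pos _ hq
      have hbq := Int.emod_add_mul_ediv b q
      -- The remainder of the division of `(a, b)` by `(p, q)` is a shorter relation.
      set a' := a - (b / q) * p with ha'
      have hdet' : a' * q = (b % q) * p := by
        rw [ha']
        linear_combination hdet - p * hbq
      have hle : a'.natAbs ≤ p.natAbs := by
        have h1 : a'.natAbs * q.natAbs = (b % q).natAbs * p.natAbs := by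
          rw [← Int.natAbs_mul, ← Int.natAbs_mul, hdet']
        have h2 : (b % q).natAbs ≤ q.natAbs := by omega
        have h3 : 0 < q.natAbs := by omega
        refine Nat.le_of_mul_le_mul_right ?_ h3
        rw [h1, mul_comm]
        exact Nat.mul_le_mul_left _ h2
      have hmem : (a', b % q) ∈ relations n k := by
        rw [relations, List.mem_filter, mem_vectors, relation_iff]
        refine ⟨⟨hr0, ?_⟩, ?_⟩
        · simp only [inRange, Bool.or_eq_true, Bool.and_eq_true, decide_eq_true_eq] at hpq ⊢
          omega
        · have e : a' + b % q * k = a + b * k - b / q * (p + q * k) := by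
            rw [ha']
            linear_combination (k : ℤ) * hbq
          rw [e]
          exact h.sub (hdvd.mul_left (b / q))
      have := hmin _ hmem
      simp only at this
      omega
    · rintro ⟨⟨c, rfl⟩, h⟩
      have : a = c * p := by
        refine mul_right_cancel₀ hq.ne' ?_
        linear_combination h
      rw [this, show c * p + q * c * k = c * (p + q * k) by ring]
      exact hdvd.mul_left c

/-- Except for nine values of `n`, the three kinds of edges of `G(n, k)` do not all lie on the same
number of octagons. There are three cases: no short relation, parallel short relations (which are
then multiples of one of finitely many), or two independent short relations, whose determinant is a
multiple of `n`, so that `n` is at most `40`. -/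
theorem distinguishes_relation (hn : 3 ≤ n) (hk : 1 ≤ k) (hkn : 2 * k < n)
    (hne : n ∉ [3, 4, 5, 8, 10, 12, 13, 24, 26]) : distinguishes (relation n k) = true := by
  by_cases hsmall : n ≤ 40 ∧ (n ≤ 8 ∨ parallel n k = false)
  · have h := distinguishes_small
    simp only [List.all_eq_true, List.mem_range] at h
    have := h n (by omega) k (by omega)
    simp only [Bool.or_eq_true, Bool.and_eq_true, decide_eq_true_eq] at this
    rcases this with (((h | h) | h) | h) | h
    · exact absurd h hne
    · omega
    · omega
    · rcases hsmall.2 with h' | h'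
      · omega
      · rw [h'] at h; simp at h
    · exact h
  · have hn8 : 8 < n := by
      by_contra h
      exact hsmall ⟨by omega, Or.inl (by omega)⟩
    have hpar : ∀ v ∈ relations n k, ∀ w ∈ relations n k, v.1 * w.2 = w.1 * v.2 := by
      by_cases h40 : n ≤ 40
      · have : parallel n k = true := by
          by_contra h
          exact hsmall ⟨h40, Or.inr (by simpa using h)⟩
        simpa only [parallel, List.all_eq_true, decide_eq_true_eq] using this
      · exact fun v hv w hw => det_eq_zero_of_lt (by omega) hv hw
    by_cases hnil : relations n k = []
    · rw [distinguishes_congr (t' := fun a b => decide (a = 0) && decide (b = 0))]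
      · exact distinguishes_no_relation
      · refine eq_of_eq_on_vectors relation_neg (fun a b => by simp) ?_ ?_
        · intro a ha
          rw [relation_zero_right hn8 ha]
          simp
        · intro a b hb hab
          have h1 : relation n k a b = false := by
            by_contra h
            have : (a, b) ∈ relations n k := by
              rw [relations, List.mem_filter, mem_vectors]
              exact ⟨⟨hb, hab⟩, by simpa using h⟩
            rw [hnil] at this
            simp at this
          simp [h1, hb.ne']
    · obtain ⟨⟨p, q⟩, hv, hmin⟩ := (relations n k).toFinset.exists_min_image (fun v => v.2)
        (by simpa [List.toFinset_nonempty_iff] using hnil)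
      rw [List.mem_toFinset] at hv
      rw [distinguishes_congr (relation_eq_multiples hn8 hpar hv
        fun w hw => hmin w (List.mem_toFinset.2 hw))]
      have h := distinguishes_multiples
      simp only [List.all_eq_true, Bool.or_eq_true, decide_eq_true_eq] at h
      rw [relations, List.mem_filter, relation_iff] at hv
      -- The vector `(0, c)` is not a relation, since `0 < c * k < n`.
      have h0 : ∀ c : ℕ, 0 < c → c ≤ 2 → ¬ (n : ℤ) ∣ 0 + (c : ℤ) * k := by
        intro c hc hc2 h
        rw [zero_add] at h
        have : n ∣ c * k := by exact_mod_cast h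
        have := Nat.le_of_dvd (by positivity) this
        nlinarith
      rcases h _ hv.1 with (h' | h') | h'
      · simp only [Prod.mk.injEq] at h'
        obtain ⟨rfl, rfl⟩ := h'
        exact absurd hv.2 (h0 1 (by norm_num) (by norm_num))
      · simp only [Prod.mk.injEq] at h'
        obtain ⟨rfl, rfl⟩ := h'
        exact absurd hv.2 (h0 2 (by norm_num) (by norm_num))
      · exact h'

theorem octagonCount_outer (c : ZMod n) [NeZero n] :
    octagonCount (generalizedPetersen n k).Adj (Sum.inl c) (Sum.inl (c + 1)) =
      octagonCount (generalizedPetersen n k).Adj (Sum.inl 0) (Sum.inl 1) := by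
  simpa [translation] using octagonCount_iso (translation n k c) (Sum.inl 0) (Sum.inl 1)

theorem octagonCount_spoke (c : ZMod n) [NeZero n] :
    octagonCount (generalizedPetersen n k).Adj (Sum.inl c) (Sum.inr c) =
      octagonCount (generalizedPetersen n k).Adj (Sum.inl 0) (Sum.inr 0) := by
  simpa [translation] using octagonCount_iso (translation n k c) (Sum.inl 0) (Sum.inr 0)

theorem octagonCount_inner (c : ZMod n) [NeZero n] :
    octagonCount (generalizedPetersen n k).Adj (Sum.inr c) (Sum.inr (c + k)) =
      octagonCount (generalizedPetersen n k).Adj (Sum.inr 0) (Sum.inr k) := by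
  simpa [translation] using octagonCount_iso (translation n k c) (Sum.inr 0) (Sum.inr k)

theorem octagonCount_not_all_equal (hn : 3 ≤ n) (hk : 1 ≤ k) (hkn : 2 * k < n)
    (hne : n ∉ [3, 4, 5, 8, 10, 12, 13, 24, 26]) :
    octagonCount (generalizedPetersen n k).Adj (Sum.inl 0) (Sum.inl 1) ≠
        octagonCount (generalizedPetersen n k).Adj (Sum.inl 0) (Sum.inr 0) ∨
      octagonCount (generalizedPetersen n k).Adj (Sum.inl 0) (Sum.inr 0) ≠
        octagonCount (generalizedPetersen n k).Adj (Sum.inr 0) (Sum.inr k) := by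
  have h1 := octagonCount_eq_liftCount (p := (false, 0, 0)) (q := (false, 1, 0)) hn hk hkn
    (by simpa [proj] using one_ne_zero_zmod hn)
  have h2 := octagonCount_eq_liftCount (p := (false, 0, 0)) (q := (true, 0, 0)) hn hk hkn
    (by simp [proj])
  have h3 := octagonCount_eq_liftCount (p := (true, 0, 0)) (q := (true, 0, 1)) hn hk hkn
    (by simpa [proj] using natCast_ne_zero_zmod hk hkn)
  have h := distinguishes_relation hn hk hkn hne
  simp only [distinguishes, ← h1, ← h2, ← h3] at h
  simpa [proj] using h

end Relation

end Octagon

/-! ### Reasoning about programs -/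

namespace Prog

variable {α β σ : Type}

/-- Every execution of `p` that returns `a` after `t` steps satisfies `Q a t`. -/
def Sat (p : Prog α) (Q : α → ℕ → Prop) : Prop := ∀ a t, p.Runs a t → Q a t

theorem Sat.mono {p : Prog α} {Q Q' : α → ℕ → Prop} (h : p.Sat Q) (hQ : ∀ a t, Q a t → Q' a t) :
    p.Sat Q' := fun a t hr => hQ a t (h a t hr)

@[simp] theorem sat_ret {a : α} {Q : α → ℕ → Prop} : (ret a).Sat Q ↔ Q a 0 := by
  simp [Sat, Runs]

@[simp] theorem sat_pure {a : α} {Q : α → ℕ → Prop} : Sat (pure a) Q ↔ Q a 0 := sat_ret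

@[simp] theorem sat_tick {p : Prog α} {Q : α → ℕ → Prop} :
    (tick p).Sat Q ↔ p.Sat fun a t => Q a (t + 1) := by
  constructor
  · intro h a t hr
    exact h a (t + 1) ⟨t, hr, rfl⟩
  · rintro h a _ ⟨t, hr, rfl⟩
    exact h a t hr

@[simp] theorem sat_amb {p q : Prog α} {Q : α → ℕ → Prop} :
    (amb p q).Sat Q ↔ p.Sat Q ∧ q.Sat Q := by
  simp [Sat, Runs, or_imp, forall_and]

@[simp] theorem sat_op {a : α} {Q : α → ℕ → Prop} : (op a).Sat Q ↔ Q a 1 := by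
  simp [op]

theorem sat_bind {p : Prog α} {f : α → Prog β} {Q : β → ℕ → Prop} :
    (p >>= f).Sat Q ↔ p.Sat fun a t => (f a).Sat fun b s => Q b (s + t) := by
  change (p.bind f).Sat Q ↔ _
  induction p generalizing Q with
  | ret a => simp [bind]
  | tick p ih => simp [bind, ih, add_assoc]
  | amb p q ihp ihq => simp [bind, ihp, ihq]

@[simp] theorem sat_ite {c : Prop} [Decidable c] {p q : Prog α} {Q : α → ℕ → Prop} :
    (if c then p else q).Sat Q ↔ (c → p.Sat Q) ∧ (¬ c → q.Sat Q) := by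
  by_cases h : c <;> simp [h]

theorem sat_forEach_nil {f : α → σ → Prog σ} {s : σ} {Q : σ → ℕ → Prop} :
    (forEach [] s f).Sat Q ↔ Q s 1 := by
  rw [forEach, sat_op]

theorem sat_forEach_cons {f : α → σ → Prog σ} {a : α} {l : List α} {s : σ} {Q : σ → ℕ → Prop} :
    (forEach (a :: l) s f).Sat Q ↔
      (f a s).Sat fun s' t => (forEach l s' f).Sat fun s'' t' => Q s'' (t' + t + 1) := by
  rw [forEach, sat_tick, sat_bind]

/-- The rule for sequential composition, with the time of both parts bounded. -/
theorem Sat.bind_le {p : Prog α} {f : α → Prog β} {Q : α → Prop} {R : β → Prop} {T T' : ℕ}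
    (hp : p.Sat fun a t => Q a ∧ t ≤ T) (hf : ∀ a, Q a → (f a).Sat fun b t => R b ∧ t ≤ T') :
    (p >>= f).Sat fun b t => R b ∧ t ≤ T + T' := by
  rw [sat_bind]
  refine hp.mono fun a t ha => (hf a ha.1).mono fun b s hb => ⟨hb.1, ?_⟩
  have := ha.2
  have := hb.2
  omega

/-- The rule for loops: the invariant `I` speaks about the members of the list that have been
processed, the state, and the time that has been spent. -/
theorem sat_forEach_time {f : α → σ → Prog σ} (I : List α → σ → ℕ → Prop) {l : List α} {s : σ}
    {c : ℕ} (h0 : I [] s c)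
    (h : ∀ pre a post, l = pre ++ a :: post → ∀ s t, I pre s t →
      (f a s).Sat fun s' t' => I (pre ++ [a]) s' (t + t' + 1)) :
    (forEach l s f).Sat fun s' t => I l s' (t + c - 1) := by
  suffices H : ∀ post pre s t, l = pre ++ post → I pre s t →
      (forEach post s f).Sat fun s' t' => I l s' (t' + t - 1) from H l [] s c rfl h0
  intro post
  induction post with
  | nil =>
    intro pre s t hl hI
    simp only [List.append_nil] at hl
    subst hl
    simpa [forEach] using hI
  | cons a post ih =>
    intro pre s t hl hI
    rw [forEach, sat_tick, sat_bind]
    refine (h pre a post hl s t hI).mono fun s' t' hI' => ?_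
    refine (ih (pre ++ [a]) s' _ (by simp [hl]) hI').mono fun s'' t'' hI'' => ?_
    convert hI'' using 1
    omega

/-- The rule for loops whose body takes at most `T` steps. -/
theorem sat_forEach {f : α → σ → Prog σ} (I : List α → σ → Prop) (T : ℕ) {l : List α} {s : σ}
    (h0 : I [] s)
    (h : ∀ pre a post, l = pre ++ a :: post → ∀ s, I pre s →
      (f a s).Sat fun s' t => I (pre ++ [a]) s' ∧ t ≤ T) :
    (forEach l s f).Sat fun s' t => I l s' ∧ t ≤ (T + 1) * l.length + 1 := by
  have := sat_forEach_time (f := f) (fun pre s t => I pre s ∧ t ≤ (T + 1) * pre.length + 1)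
    (l := l) (s := s) (c := 1) ⟨h0, by simp⟩ ?_
  · simpa using this
  · rintro pre a post hl s t ⟨hI, ht⟩
    refine (h pre a post hl s hI).mono fun s' t' h' => ⟨h'.1, ?_⟩
    have := h'.2
    rw [List.length_append, List.length_singleton, mul_add]
    omega

/-- A loop whose body computes `g` from the state and the member of the list computes a fold. -/
theorem sat_forEach_foldl {f : α → σ → Prog σ} (g : σ → α → σ) (T : ℕ) {l : List α} {s : σ}
    (h : ∀ a ∈ l, ∀ s, (f a s).Sat fun s' t => s' = g s a ∧ t ≤ T) :
    (forEach l s f).Sat fun s' t => s' = l.foldl g s ∧ t ≤ (T + 1) * l.length + 1 := by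
  refine sat_forEach (fun pre s' => s' = pre.foldl g s) T rfl ?_
  rintro pre a post rfl _ rfl
  simpa using h a (by simp) _

theorem sat_alloc {ι : Type} (m : ℕ) (a : α) :
    (alloc m a : Prog (ι → α)).Sat fun f t => f = (fun _ => a) ∧ t ≤ m + 1 := by
  induction m with
  | zero => simp [alloc]
  | succ m ih =>
    rw [alloc, sat_tick]
    exact ih.mono fun f t h => ⟨h.1, by have := h.2; omega⟩

theorem sat_pick (a : α) (l : List α) :
    (pick a l).Sat fun b t => b ∈ a :: l ∧ t ≤ l.length + 1 := by
  induction l generalizing a with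
  | nil => simp [pick]
  | cons b l ih =>
    rw [pick, sat_tick, sat_amb, sat_ret]
    refine ⟨by simp, (ih b).mono fun c t h => ⟨List.mem_cons_of_mem _ h.1, ?_⟩⟩
    have := h.2
    simp only [List.length_cons]
    omega

theorem sat_mem [DecidableEq α] (x : α) (l : List α) :
    (mem x l).Sat fun b t => b = decide (x ∈ l) ∧ t ≤ l.length + 1 := by
  induction l with
  | nil => simp [mem]
  | cons y l ih =>
    rw [mem, sat_bind, sat_op, sat_ite]
    refine ⟨fun h => ?_, fun h => ?_⟩
    · have h : x = y := by simpa using h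
      simp [h]
    · have h : x ≠ y := by simpa using h
      refine ih.mono fun b t hb => ⟨by simp [hb.1, h], ?_⟩
      have := hb.2
      simp only [List.length_cons]
      omega

end Prog

namespace Recognition

open Prog Octagon

/-! ### The computation of `σ` -/

/-- The stored form of the edge with ends `x` and `y`. -/
def edgeOf {N : ℕ} (x y : Fin N) : Edge N := if x < y then (x, y) else (y, x)

/-- `e` is the stored form of an edge of `G`. -/
def IsEdge {N : ℕ} (G : SimpleGraph (Fin N)) (e : Edge N) : Prop := e.1 < e.2 ∧ G.Adj e.1 e.2

section Edges

variable {N : ℕ} {G : SimpleGraph (Fin N)} {A : Fin N → Fin 3 → Fin N}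

theorem edgeOf_comm (x y : Fin N) : edgeOf x y = edgeOf y x := by
  rcases lt_trichotomy x y with h | rfl | h
  · simp [edgeOf, h, h.le.not_gt]
  · rfl
  · simp [edgeOf, h, h.le.not_gt]

theorem IsEdge.edgeOf_eq {e : Edge N} (h : IsEdge G e) : edgeOf e.1 e.2 = e := by
  simp [edgeOf, h.1]

theorem isEdge_edgeOf {x y : Fin N} (h : G.Adj x y) : IsEdge G (edgeOf x y) := by
  rcases lt_or_gt_of_ne h.ne with h' | h'
  · simpa [edgeOf, h', IsEdge] using h
  · simpa [edgeOf, h', h'.le.not_gt, IsEdge] using h.symm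

theorem edgeOf_eq_iff {e : Edge N} (he : e.1 < e.2) {x y : Fin N} :
    edgeOf x y = e ↔ (e.1 = x ∧ e.2 = y) ∨ (e.1 = y ∧ e.2 = x) := by
  obtain ⟨a, b⟩ := e
  simp only at he
  rw [edgeOf]
  split_ifs with h
  · simp only [Prod.mk.injEq]
    constructor
    · rintro ⟨rfl, rfl⟩; simp
    · rintro (⟨rfl, rfl⟩ | ⟨rfl, rfl⟩)
      · simp
      · exact absurd h he.le.not_gt
  · simp only [Prod.mk.injEq]
    constructor
    · rintro ⟨rfl, rfl⟩; simp
    · rintro (⟨rfl, rfl⟩ | ⟨rfl, rfl⟩)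
      · exact absurd he h
      · simp

theorem adj_of_isEdge_edgeOf {x y : Fin N} (h : IsEdge G (edgeOf x y)) : G.Adj x y := by
  rcases (edgeOf_eq_iff h.1).1 rfl with ⟨h1, h2⟩ | ⟨h1, h2⟩
  · simpa [h1, h2] using h.2
  · simpa [h1, h2] using h.2.symm

theorem sat_mkEdge (x y : Fin N) : (mkEdge x y).Sat fun e t => e = edgeOf x y ∧ t ≤ 2 := by
  by_cases h : x < y <;> simp [mkEdge, sat_bind, edgeOf, h]

theorem sat_adjacent [DecidableRel G.Adj] (hA : IsAdjacencyList G A) (x y : Fin N) :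
    (adjacent A x y).Sat fun b t => b = decide (G.Adj x y) ∧ t ≤ 13 := by
  refine (sat_forEach_foldl (fun found j => found || decide (A x j = y)) 3 ?_).mono ?_
  · intro j _ found
    simp [sat_bind]
  · rintro b t ⟨rfl, ht⟩
    refine ⟨?_, by simpa using ht⟩
    rw [Bool.eq_iff_iff]
    simp [(hA x).2 y, Fin.exists_fin_succ, or_assoc]

theorem sat_allEdges (hA : IsAdjacencyList G A) :
    (allEdges A).Sat fun E t => (E.Nodup ∧ (∀ e, e ∈ E ↔ IsEdge G e) ∧ E.length ≤ 3 * N) ∧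
      t ≤ 14 * N + 1 := by
  refine (sat_forEach (fun pre E => E.Nodup ∧ (∀ e, e ∈ E ↔ e.1 ∈ pre ∧ IsEdge G e) ∧
    E.length ≤ 3 * pre.length) 13 (by simp) ?_).mono ?_
  · rintro pre x post hl E ⟨hE, hmem, hlen⟩
    have hx : x ∉ pre := by
      have := List.nodup_finRange N
      rw [hl, List.nodup_append] at this
      exact fun h => this.2.2 x h x (by simp) rfl
    refine (sat_forEach (fun js E => E.Nodup ∧ (∀ e, e ∈ E ↔ (e.1 ∈ pre ∧ IsEdge G e) ∨
      (e.1 = x ∧ x < e.2 ∧ ∃ j ∈ js, A x j = e.2)) ∧ E.length ≤ 3 * pre.length + js.length) 3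
      ⟨hE, fun e => by rw [hmem]; simp, by simpa using hlen⟩ ?_).mono ?_
    · rintro js j js' hjs E ⟨hE, hmem, hlen⟩
      have hj : j ∉ js := by
        have : ([0, 1, 2] : List (Fin 3)).Nodup := by decide
        rw [hjs, List.nodup_append] at this
        exact fun h => this.2.2 j h j (by simp) rfl
      simp only [sat_bind, sat_op, sat_ite, sat_pure, decide_eq_true_eq, List.nodup_cons,
        List.length_append, List.length_cons, List.length_nil, List.mem_append, List.mem_cons,
        List.not_mem_nil, or_false]
      refine ⟨fun h => ⟨⟨⟨?_, hE⟩, ?_, by omega⟩, by omega⟩,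
        fun h => ⟨⟨hE, ?_, by omega⟩, by omega⟩⟩
      · rw [hmem]
        rintro (h' | ⟨-, -, i, hi, h'⟩)
        · exact hx h'.1
        · exact hj ((hA x).1 h' ▸ hi)
      · rintro ⟨a, b⟩
        rw [hmem]
        simp only [Prod.mk.injEq]
        constructor
        · rintro (⟨rfl, rfl⟩ | h' | ⟨rfl, h1, i, hi, rfl⟩)
          · exact Or.inr ⟨rfl, h, j, Or.inr rfl, rfl⟩
          · exact Or.inl h'
          · exact Or.inr ⟨rfl, h1, i, Or.inl hi, rfl⟩
        · rintro (h' | ⟨rfl, h1, i, hi | rfl, rfl⟩)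
          · exact Or.inr (Or.inl h')
          · exact Or.inr (Or.inr ⟨rfl, h1, i, hi, rfl⟩)
          · exact Or.inl ⟨rfl, rfl⟩
      · rintro ⟨a, b⟩
        rw [hmem]
        dsimp only
        constructor
        · rintro (h' | ⟨rfl, h1, i, hi, rfl⟩)
          · exact Or.inl h'
          · exact Or.inr ⟨rfl, h1, i, Or.inl hi, rfl⟩
        · rintro (h' | ⟨rfl, h1, i, hi | rfl, rfl⟩)
          · exact Or.inl h'
          · exact Or.inr ⟨rfl, h1, i, hi, rfl⟩
          · exact absurd h1 h
    · rintro E t ⟨⟨hE, hmem, hlen⟩, ht⟩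
      refine ⟨⟨hE, ?_, by simpa [mul_add] using hlen⟩, by simpa using ht⟩
      rintro ⟨a, b⟩
      rw [hmem]
      simp only [List.mem_append, List.mem_singleton, IsEdge, (hA _).2]
      constructor
      · rintro (h' | ⟨rfl, h1, i, -, rfl⟩)
        · exact ⟨Or.inl h'.1, h'.2⟩
        · exact ⟨Or.inr rfl, h1, i, rfl⟩
      · rintro ⟨h' | rfl, h1, i, rfl⟩
        · exact Or.inl ⟨h', h1, i, rfl⟩
        · refine Or.inr ⟨rfl, h1, i, ?_, rfl⟩
          fin_cases i <;> simp
  · rintro E t ⟨⟨hE, hmem, hlen⟩, ht⟩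
    simp only [List.mem_finRange, true_and, List.length_finRange] at hmem hlen ht
    exact ⟨⟨hE, hmem, hlen⟩, by omega⟩

/-- A duplicate-free list of edges of `G` with at most `L` members. -/
structure IsEdgeList (G : SimpleGraph (Fin N)) (L : ℕ) (T : List (Edge N)) : Prop where
  nodup : T.Nodup
  isEdge : ∀ e ∈ T, IsEdge G e
  length_le : T.length ≤ L

theorem IsEdgeList.mono {L L' : ℕ} {T : List (Edge N)} (h : IsEdgeList G L T) (hL : L ≤ L') :
    IsEdgeList G L' T := ⟨h.1, h.2, h.3.trans hL⟩

/-- One pass over the edges at a vertex adds at most three edges. -/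
theorem sat_grow_vertex (hA : IsAdjacencyList G A) {L : ℕ} {T : List (Edge N)}
    (hT : IsEdgeList G L T) (x : Fin N) :
    (forEach [0, 1, 2] T fun j T => do
        let w ← op (A x j)
        let f ← mkEdge x w
        let b ← mem f T
        if b then pure T else op (f :: T)).Sat fun T' t =>
      (IsEdgeList G (L + 3) T' ∧ T ⊆ T' ∧ ∀ w, G.Adj x w → edgeOf x w ∈ T') ∧
        t ≤ (L + 9) * 3 + 1 := by
  refine (sat_forEach (fun js T' => IsEdgeList G (L + js.length) T' ∧ T ⊆ T' ∧
    ∀ j ∈ js, edgeOf x (A x j) ∈ T') (L + 8) ⟨by simpa using hT, by simp, by simp⟩ ?_).mono ?_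
  · rintro js j js' hjs T' ⟨hT', hsub, hmem⟩
    have hlen : js.length ≤ 2 := by
      have := congrArg List.length hjs
      simp at this
      omega
    simp only [sat_bind, sat_op]
    refine (sat_mkEdge _ _).mono ?_
    rintro _ s ⟨rfl, hs⟩
    refine (sat_mem _ _).mono ?_
    rintro _ s' ⟨rfl, hs'⟩
    have := hT'.3
    simp only [sat_ite, decide_eq_true_eq, sat_pure, sat_op, List.length_append,
      List.length_singleton]
    refine ⟨fun h => ⟨⟨hT'.mono (by omega), hsub, ?_⟩, by omega⟩,
      fun h => ⟨⟨⟨List.nodup_cons.2 ⟨h, hT'.1⟩, ?_, by simpa using by omega⟩, ?_, ?_⟩, by omega⟩⟩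
    · intro i hi
      rcases List.mem_append.1 hi with hi | hi
      · exact hmem i hi
      · rw [List.mem_singleton.1 hi]; exact h
    · intro e he
      rcases List.mem_cons.1 he with rfl | he
      · exact isEdge_edgeOf (((hA x).2 _).2 ⟨j, rfl⟩)
      · exact hT'.2 e he
    · exact fun e he => List.mem_cons_of_mem _ (hsub he)
    · intro i hi
      rcases List.mem_append.1 hi with hi | hi
      · exact List.mem_cons_of_mem _ (hmem i hi)
      · rw [List.mem_singleton.1 hi]; exact List.mem_cons_self
  · rintro T' t ⟨⟨hT', hsub, hmem⟩, ht⟩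
    refine ⟨⟨hT', hsub, fun w hw => ?_⟩, by simpa using ht⟩
    obtain ⟨j, rfl⟩ := ((hA x).2 w).1 hw
    exact hmem j (by fin_cases j <;> simp)

theorem sat_grow (hA : IsAdjacencyList G A) {L : ℕ} {S : List (Edge N)} (hS : IsEdgeList G L S) :
    (grow A S).Sat fun T t => (IsEdgeList G (7 * L) T ∧ S ⊆ T ∧ ∀ e ∈ S, ∀ w,
      (G.Adj e.1 w → edgeOf e.1 w ∈ T) ∧ (G.Adj e.2 w → edgeOf e.2 w ∈ T)) ∧
        t ≤ (42 * L + 100) * L + 1 := by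
  have hL := hS.3
  refine (sat_forEach (fun pre T => IsEdgeList G (L + 6 * pre.length) T ∧ S ⊆ T ∧
    ∀ e ∈ pre, ∀ w, (G.Adj e.1 w → edgeOf e.1 w ∈ T) ∧ (G.Adj e.2 w → edgeOf e.2 w ∈ T))
    (42 * L + 99) ⟨by simpa using hS, by simp, by simp⟩ ?_).mono ?_
  · rintro pre e post hl T ⟨hT, hsub, hmem⟩
    have hlen : pre.length + 1 ≤ L := by
      have := congrArg List.length hl
      simp at this
      omega
    rw [sat_forEach_cons]
    refine (sat_grow_vertex hA hT e.1).mono ?_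
    rintro T1 t1 ⟨⟨hT1, hsub1, hmem1⟩, ht1⟩
    rw [sat_forEach_cons]
    refine (sat_grow_vertex hA hT1 e.2).mono ?_
    rintro T2 t2 ⟨⟨hT2, hsub2, hmem2⟩, ht2⟩
    rw [sat_forEach_nil]
    refine ⟨⟨hT2.mono (by simp; omega), fun f hf => hsub2 (hsub1 (hsub hf)), ?_⟩, by omega⟩
    intro f hf w
    rcases List.mem_append.1 hf with hf | hf
    · exact ⟨fun h => hsub2 (hsub1 ((hmem f hf w).1 h)), fun h => hsub2 (hsub1 ((hmem f hf w).2 h))⟩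
    · rw [List.mem_singleton.1 hf]
      exact ⟨fun h => hsub2 (hmem1 w h), hmem2 w⟩
  · rintro T t ⟨⟨hT, hsub, hmem⟩, ht⟩
    refine ⟨⟨hT.mono (by omega), hsub, hmem⟩, ht.trans ?_⟩
    gcongr

/-- Some walk with `r` edges leads from an end of `e` to `x`. -/
def Near (G : SimpleGraph (Fin N)) (e : Edge N) : ℕ → Fin N → Prop
  | 0, x => x = e.1 ∨ x = e.2
  | r + 1, x => ∃ y, Near G e r y ∧ G.Adj y x

end Edges

/-- The ball of radius `r` around an edge has bounded size and is computed in bounded time. It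
contains all edges at a vertex that is reached from an end of `e` in fewer than `r` steps. -/
theorem sat_edgeBall (r : ℕ) : ∃ L c : ℕ, ∀ {N : ℕ} {G : SimpleGraph (Fin N)}
    {A : Fin N → Fin 3 → Fin N} (_ : IsAdjacencyList G A) (e : Edge N) (_ : IsEdge G e),
    (edgeBall A e r).Sat fun S t => (IsEdgeList G L S ∧ e ∈ S ∧
      ∀ s < r, ∀ x w, Near G e s x → G.Adj x w → edgeOf x w ∈ S) ∧ t ≤ c := by
  induction r with
  | zero =>
    refine ⟨1, 1, fun hA e he => ?_⟩
    rw [edgeBall, sat_op]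
    exact ⟨⟨⟨by simp, by simpa using he, by simp⟩, by simp, by simp⟩, le_rfl⟩
  | succ r ih =>
    obtain ⟨L, c, ih⟩ := ih
    refine ⟨7 * L, c + ((42 * L + 100) * L + 1), fun {N G A} hA e he => ?_⟩
    rw [edgeBall]
    refine Sat.bind_le (ih hA e he) ?_
    rintro S ⟨hS, heS, hclosed⟩
    refine (sat_grow hA hS).mono ?_
    rintro T t ⟨⟨hT, hsub, hmem⟩, ht⟩
    refine ⟨⟨hT, hsub heS, ?_⟩, ht⟩
    intro s hs x w hx hw
    cases s with
    | zero =>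
      rcases hx with rfl | rfl
      · exact (hmem e heS w).1 hw
      · exact (hmem e heS w).2 hw
    | succ s =>
      obtain ⟨y, hy, hyx⟩ := hx
      have hf := hclosed s (by omega) y x hy hyx
      have hlt := (isEdge_edgeOf hyx).1
      rcases (edgeOf_eq_iff hlt).1 rfl with ⟨-, h2⟩ | ⟨h1, -⟩
      · have := (hmem _ hf w).2
        rw [h2] at this
        exact this hw
      · have := (hmem _ hf w).1
        rw [h1] at this
        exact this hw

/-! ### Counting octagons in a set of edges -/

section Paths

variable {N : ℕ} {G : SimpleGraph (Fin N)} {A : Fin N → Fin 3 → Fin N}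

theorem sat_tryStep (x y : Fin N) (p : Fin N × List (Fin N))
    (acc : List (Fin N × List (Fin N))) :
    (tryStep x y p acc).Sat fun acc' t =>
      acc' = (if x = p.1 ∧ y ∉ p.2 then (y, y :: p.2) :: acc else acc) ∧ t ≤ p.2.length + 4 := by
  simp only [tryStep, sat_bind, sat_op, sat_ite, decide_eq_true_eq, sat_pure]
  refine ⟨fun h => (sat_mem _ _).mono ?_, fun h => by simp [h]⟩
  rintro _ t ⟨rfl, ht⟩
  by_cases hy : y ∈ p.2
  · simp [hy]
    omega
  · simp [hy, h]
    omega

/-- `q` extends the path `p` by an edge `f`; a path is stored with its last vertex. -/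
def Extends (f : Edge N) (p q : Fin N × List (Fin N)) : Prop :=
  q.2 = q.1 :: p.2 ∧ edgeOf p.1 q.1 = f ∧ q.1 ∉ p.2

/-- All extensions of the path `p` by an edge of `H` are added to `acc`, each one once. -/
theorem sat_extendPath {H : List (Edge N)} (hH : H.Nodup) (hlt : ∀ f ∈ H, f.1 < f.2)
    (p : Fin N × List (Fin N)) {acc : List (Fin N × List (Fin N))} (hacc : acc.Nodup)
    (hnew : ∀ q ∈ acc, q.2 ≠ q.1 :: p.2) :
    (forEach H acc fun f acc => do
        let acc ← tryStep f.1 f.2 p acc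
        tryStep f.2 f.1 p acc).Sat fun acc' t =>
      (acc'.Nodup ∧ (∀ q, q ∈ acc' ↔ q ∈ acc ∨ ∃ f ∈ H, Extends f p q) ∧
        acc'.length ≤ acc.length + H.length) ∧ t ≤ (2 * p.2.length + 9) * H.length + 1 := by
  refine (sat_forEach (fun pre (acc' : List (Fin N × List (Fin N))) => acc'.Nodup ∧
    (∀ q, q ∈ acc' ↔ q ∈ acc ∨ ∃ f ∈ pre, Extends f p q) ∧
    acc'.length ≤ acc.length + pre.length) (2 * p.2.length + 8) ⟨hacc, by simp, by simp⟩ ?_)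
  rintro pre f post hl acc' ⟨hnd, hmem, hlen⟩
  have hf : f.1 < f.2 := hlt f (by simp [hl])
  have hfpre : f ∉ pre := by
    rw [hl, List.nodup_append] at hH
    exact fun h => hH.2.2 f h f (by simp) rfl
  -- The edge `f` adds at most one path, since only one of its ends can be the last vertex of `p`.
  have key : ∀ x y, edgeOf x y = f → ((x = p.1 ∧ y ∉ p.2) → ((y, y :: p.2) :: acc').Nodup ∧
      ∀ q, (q ∈ (y, y :: p.2) :: acc' ↔ q ∈ acc ∨ ∃ g ∈ pre ++ [f], Extends g p q)) := by
    rintro x y hxy ⟨rfl, hy⟩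
    refine ⟨List.nodup_cons.2 ⟨?_, hnd⟩, ?_⟩
    · rw [hmem]
      rintro (h | ⟨g, hg, -, h, -⟩)
      · exact hnew _ h rfl
      · simp only at h
        exact hfpre (by rw [← hxy, h]; exact hg)
    · rintro ⟨z, l⟩
      simp only [List.mem_cons, hmem, List.mem_append, List.not_mem_nil, or_false, or_and_right,
        exists_or, exists_eq_left, Prod.mk.injEq]
      have : Extends f p (z, l) ↔ z = y ∧ l = y :: p.2 := by
        simp only [Extends]
        constructor
        · rintro ⟨h1, h2, h3⟩
          have : z = y := by
            rw [edgeOf_eq_iff hf] at hxy h2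
            rcases hxy with h | h <;> rcases h2 with h' | h'
            · rw [← h.2, h'.2]
            · exact absurd (h'.2.trans h.1.symm) hf.ne'
            · exact absurd (h'.1.trans h.2.symm) hf.ne
            · rw [← h.1, h'.1]
          exact ⟨this, this ▸ h1⟩
        · rintro ⟨rfl, rfl⟩
          exact ⟨rfl, hxy, hy⟩
      rw [this, or_comm, or_assoc]
  have hfst : edgeOf f.1 f.2 = f := (edgeOf_eq_iff hf).2 (Or.inl ⟨rfl, rfl⟩)
  have hsnd : edgeOf f.2 f.1 = f := by rw [edgeOf_comm, hfst]
  rw [sat_bind]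
  refine (sat_tryStep _ _ _ _).mono ?_
  rintro _ t ⟨rfl, ht⟩
  refine (sat_tryStep _ _ _ _).mono ?_
  rintro _ s ⟨rfl, hs⟩
  refine ⟨?_, by omega⟩
  by_cases h1 : f.1 = p.1 ∧ f.2 ∉ p.2
  · have h2 : ¬ (f.2 = p.1 ∧ f.1 ∉ p.2) := fun h => hf.ne (h1.1.trans h.1.symm)
    rw [if_pos h1, if_neg h2]
    have := key _ _ hfst h1
    exact ⟨this.1, this.2, by simp; omega⟩
  · rw [if_neg h1]
    by_cases h2 : f.2 = p.1 ∧ f.1 ∉ p.2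
    · rw [if_pos h2]
      have := key _ _ hsnd h2
      exact ⟨this.1, this.2, by simp; omega⟩
    · rw [if_neg h2]
      refine ⟨hnd, fun q => ?_, by simp; omega⟩
      have : ¬ Extends f p q := by
        rintro ⟨-, h, h'⟩
        rw [edgeOf_eq_iff hf] at h
        rcases h with h | h
        · exact h1 ⟨h.1, h.2 ▸ h'⟩
        · exact h2 ⟨h.2, h.1 ▸ h'⟩
      rw [hmem]
      simp only [List.mem_append, List.mem_singleton, or_and_right, exists_or, exists_eq_left, this,
        or_false]

theorem sat_extendPaths {H : List (Edge N)} (hH : H.Nodup) (hlt : ∀ f ∈ H, f.1 < f.2) {L M r : ℕ}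
    (hL : H.length ≤ L) {P : List (Fin N × List (Fin N))} (hP : P.Nodup) (hM : P.length ≤ M)
    (hlast : ∀ p ∈ P, p.2.head? = some p.1) (hlen : ∀ p ∈ P, p.2.length = r) :
    (extendPaths H P).Sat fun P' t =>
      (P'.Nodup ∧ P'.length ≤ L * M ∧ ∀ q, q ∈ P' ↔ ∃ p ∈ P, ∃ f ∈ H, Extends f p q) ∧
        t ≤ ((2 * r + 9) * L + 1 + 1) * M + 1 := by
  refine (sat_forEach (fun pre P' => P'.Nodup ∧ P'.length ≤ L * pre.length ∧
    ∀ q, q ∈ P' ↔ ∃ p ∈ pre, ∃ f ∈ H, Extends f p q) ((2 * r + 9) * L + 1)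
    (by simp) ?_).mono ?_
  · rintro pre p post hl P' ⟨hnd, hlen', hmem⟩
    have hp : p ∉ pre := by
      rw [hl, List.nodup_append] at hP
      exact fun h => hP.2.2 p h p (by simp) rfl
    refine (sat_extendPath hH hlt p hnd ?_).mono ?_
    · intro q hq h
      obtain ⟨p', hp', f, -, h', -⟩ := (hmem q).1 hq
      have h2 : p'.2 = p.2 := by
        rw [h] at h'
        exact (List.cons.inj h').2.symm
      have h1 : p'.1 = p.1 := by
        have e1 := hlast p' (by simp [hl, hp'])
        have e2 := hlast p (by simp [hl])
        rw [h2, e2] at e1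
        exact (Option.some.inj e1).symm
      exact hp (by rwa [← Prod.ext h1 h2])
    · rintro P'' t ⟨⟨hnd', hmem', hlen''⟩, ht⟩
      have := hlen p (by simp [hl])
      refine ⟨⟨hnd', ?_, fun q => ?_⟩, ht.trans ?_⟩
      · rw [List.length_append, List.length_singleton, mul_add]
        omega
      · rw [hmem', hmem]
        simp only [List.mem_append, List.mem_singleton, or_and_right, exists_or, exists_eq_left]
      · rw [this]
        gcongr
  · rintro P' t ⟨⟨hnd, hlen', hmem⟩, ht⟩
    exact ⟨⟨hnd, hlen'.trans (by gcongr), hmem⟩, ht.trans (by gcongr)⟩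

/-- Adjacency in the subgraph formed by the edges in `H`. -/
def EdgeRel (H : List (Edge N)) (x y : Fin N) : Prop := edgeOf x y ∈ H

end Paths

/-- For a fixed bound `L` on the number of edges of `H`, the paths of a fixed length are enumerated
in bounded time, each one once. -/
theorem sat_pathsFrom (L r : ℕ) : ∃ M c : ℕ, ∀ {N : ℕ} {G : SimpleGraph (Fin N)}
    {H : List (Edge N)} (_ : IsEdgeList G L H) (e : Edge N),
    (pathsFrom H e r).Sat fun P t => (P.Nodup ∧ P.length ≤ M ∧
      ∀ q, q ∈ P ↔ IsPath (EdgeRel H) e.1 e.2 r q.2 ∧ q.2.head? = some q.1) ∧ t ≤ c := by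
  induction r with
  | zero =>
    refine ⟨1, 1, fun hH e => ?_⟩
    rw [pathsFrom, sat_op]
    refine ⟨⟨by simp, by simp, ?_⟩, le_rfl⟩
    rintro ⟨z, l⟩
    simp only [List.mem_singleton, Prod.mk.injEq, IsPath]
    constructor
    · rintro ⟨rfl, rfl⟩; simp
    · rintro ⟨rfl, h⟩; simpa [eq_comm] using h
  | succ r ih =>
    obtain ⟨M, c, ih⟩ := ih
    refine ⟨L * M, c + (((2 * (r + 2) + 9) * L + 1 + 1) * M + 1), fun {N G H} hH e => ?_⟩
    rw [pathsFrom]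
    refine Sat.bind_le (ih hH e) ?_
    rintro P ⟨hnd, hlen, hmem⟩
    refine (sat_extendPaths hH.1 (fun f hf => (hH.2 f hf).1) hH.3 hnd hlen
      (fun p hp => ((hmem p).1 hp).2) (fun p hp => ((hmem p).1 hp).1.length)).mono ?_
    rintro P' t ⟨⟨hnd', hlen', hmem'⟩, ht⟩
    refine ⟨⟨hnd', hlen', ?_⟩, ht⟩
    rintro ⟨z, l⟩
    rw [hmem']
    simp only [IsPath, Extends]
    constructor
    · rintro ⟨⟨b, p⟩, hp, f, hf, rfl, rfl, hz⟩
      obtain ⟨hp, hb⟩ := (hmem _).1 hp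
      cases p with
      | nil => simp at hb
      | cons b' p =>
        obtain rfl : b' = b := by simpa using hb
        exact ⟨⟨z, b', p, rfl, hp, hf, hz⟩, rfl⟩
    · rintro ⟨⟨a, b, p, rfl, hp, hab, ha⟩, hz⟩
      obtain rfl : a = z := by simpa using hz
      exact ⟨(b, b :: p), (hmem _).2 ⟨hp, rfl⟩, _, hab, rfl, rfl, ha⟩

section Sigma

variable {N : ℕ} {G : SimpleGraph (Fin N)} {A : Fin N → Fin 3 → Fin N}

/-- All octagons through `e` lie in the ball of radius `4` around `e`. -/
theorem octagons_edgeRel {L : ℕ} {H : List (Edge N)} (hH : IsEdgeList G L H) {e : Edge N}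
    (hball : ∀ s < 4, ∀ x w, Near G e s x → G.Adj x w → edgeOf x w ∈ H) :
    octagons (EdgeRel H) e.1 e.2 = octagons G.Adj e.1 e.2 := by
  ext l
  constructor
  · rintro ⟨h, a, p, rfl, ha⟩
    have hsub : ∀ a b, EdgeRel H a b → G.Adj a b := fun a b h => adj_of_isEdge_edgeOf (hH.2 _ h)
    have := h.map (S := G.Adj) (f := id) Function.injective_id hsub
    rw [List.map_id] at this
    exact ⟨this, a, p, rfl, hsub _ _ ha⟩
  · rintro ⟨h, a', p, hl, ha⟩
    have hlen := h.length
    match l, hlen with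
    | [a, b, c, d, f, g, y, x], _ =>
      obtain ⟨rfl, -⟩ := List.cons.inj hl
      simp only [isPath_succ_cons_cons] at h
      simp only [IsPath, List.cons.injEq, and_true] at h
      obtain ⟨⟨⟨⟨⟨⟨⟨rfl, rfl⟩, h1, m1⟩, h2, m2⟩, h3, m3⟩, h4, m4⟩, h5, m5⟩, h6, m6⟩ := h
      have n1 : Near G e 0 e.1 := Or.inl rfl
      have n2 : Near G e 0 e.2 := Or.inr rfl
      have ng : Near G e 1 g := ⟨_, n2, h1⟩
      have nf : Near G e 2 f := ⟨_, ng, h2⟩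
      have nd : Near G e 3 d := ⟨_, nf, h3⟩
      have na : Near G e 1 a := ⟨_, n1, ha.symm⟩
      have nb : Near G e 2 b := ⟨_, na, h6.symm⟩
      refine ⟨?_, a, _, rfl, ?_⟩
      · simp only [isPath_succ_cons_cons]
        simp only [IsPath, true_and, EdgeRel]
        refine ⟨⟨⟨⟨⟨⟨?_, m1⟩, ?_, m2⟩, ?_, m3⟩, ?_, m4⟩, ?_, m5⟩, ?_, m6⟩
        · exact hball 0 (by norm_num) _ _ n2 h1
        · exact hball 1 (by norm_num) _ _ ng h2
        · exact hball 2 (by norm_num) _ _ nf h3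
        · exact hball 3 (by norm_num) _ _ nd h4
        · rw [edgeOf_comm]
          exact hball 2 (by norm_num) _ _ nb h5.symm
        · rw [edgeOf_comm]
          exact hball 1 (by norm_num) _ _ na h6.symm
      · rw [EdgeRel, edgeOf_comm]
        exact hball 0 (by norm_num) _ _ n1 ha.symm

end Sigma

theorem sat_sigma (L : ℕ) : ∃ M c : ℕ, ∀ {N : ℕ} {G : SimpleGraph (Fin N)}
    {H : List (Edge N)} (_ : IsEdgeList G L H) (e : Edge N),
    (sigma H e).Sat fun s t => (s = octagonCount (EdgeRel H) e.1 e.2 ∧ s ≤ M) ∧ t ≤ c := by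
  obtain ⟨M, c, h⟩ := sat_pathsFrom L 6
  refine ⟨M, c + ((L + 5) * M + 1), fun {N G H} hH e => ?_⟩
  rw [sigma]
  refine Sat.bind_le (h hH e) ?_
  rintro P ⟨hnd, hlen, hmem⟩
  refine (sat_forEach (fun pre s => s = (pre.filter fun p => decide (edgeOf p.1 e.1 ∈ H)).length)
    (L + 4) (by simp) ?_).mono ?_
  · rintro pre p post hl _ rfl
    rw [sat_bind]
    refine (sat_mkEdge _ _).mono ?_
    rintro _ t ⟨rfl, ht⟩
    rw [sat_bind]
    refine (sat_mem _ _).mono ?_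
    rintro _ s ⟨rfl, hs⟩
    have := hH.3
    simp only [sat_ite, sat_op, sat_pure, decide_eq_true_eq]
    exact ⟨fun h => ⟨by simp [h], by omega⟩, fun h => ⟨by simp [h], by omega⟩⟩
  · rintro _ t ⟨rfl, ht⟩
    refine ⟨⟨?_, (List.length_filter_le _ _).trans hlen⟩, ht.trans (by gcongr)⟩
    rw [octagonCount_eq_length
      (L := (P.filter fun p => decide (edgeOf p.1 e.1 ∈ H)).map Prod.snd), List.length_map]
    · refine (hnd.filter _).map_on ?_
      intro p hp q hq hpq
      have hp := ((hmem p).1 (List.mem_filter.1 hp).1).2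
      have hq := ((hmem q).1 (List.mem_filter.1 hq).1).2
      rw [hpq, hq] at hp
      exact Prod.ext (Option.some.inj hp).symm hpq
    · intro l
      simp only [List.mem_map, List.mem_filter, hmem, decide_eq_true_eq]
      constructor
      · rintro ⟨⟨z, l⟩, ⟨⟨hl, hz⟩, hc⟩, rfl⟩
        cases l with
        | nil => simp at hz
        | cons z' p =>
          obtain rfl : z' = z := by simpa using hz
          exact ⟨hl, z', p, rfl, hc⟩
      · rintro ⟨hl, z, p, rfl, hc⟩
        exact ⟨(z, z :: p), ⟨⟨hl, rfl⟩, hc⟩, rfl⟩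

/-- In constant time, `σ` counts the octagons of the whole graph through an edge. -/
theorem sat_sigma_edgeBall : ∃ M c : ℕ, ∀ {N : ℕ} {G : SimpleGraph (Fin N)}
    {A : Fin N → Fin 3 → Fin N} (_ : IsAdjacencyList G A) (e : Edge N) (_ : IsEdge G e),
    (do let H ← edgeBall A e 4; sigma H e : Prog ℕ).Sat fun s t =>
      (s = octagonCount G.Adj e.1 e.2 ∧ s ≤ M) ∧ t ≤ c := by
  obtain ⟨L, c, h⟩ := sat_edgeBall 4
  obtain ⟨M, c', h'⟩ := sat_sigma L
  refine ⟨M, c + c', fun hA e he => Sat.bind_le (h hA e he) ?_⟩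
  rintro H ⟨hH, -, hball⟩
  have := h' hH e
  rwa [octagonCount, octagons_edgeRel hH hball] at this

/-! ### The partition of the edges -/

section Partition

variable {N : ℕ}

/-- The list of parts after the insertion of the edge `e` with `σ(e) = s`. -/
def insertPart (s : ℕ) (e : Edge N) : List (Part N) → List (Part N)
  | [] => [(s, [e], 1)]
  | p :: P => if p.1 = s then (s, e :: p.2.1, p.2.2 + 1) :: P else p :: insertPart s e P

theorem sat_insertEdge (s : ℕ) (e : Edge N) (P : List (Part N)) :
    (insertEdge s e P).Sat fun P' t => P' = insertPart s e P ∧ t ≤ 2 * P.length + 4 := by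
  induction P with
  | nil => simp [insertEdge, insertPart]
  | cons p P ih =>
    rw [insertEdge, sat_bind, sat_op]
    simp only [sat_ite, decide_eq_true_eq, sat_bind, sat_op, insertPart]
    refine ⟨fun h => ⟨by simp [h], by omega⟩, fun h => ih.mono ?_⟩
    rintro _ t ⟨rfl, ht⟩
    simp only [h, if_false, List.length_cons, true_and]
    omega

theorem map_fst_insertPart (s : ℕ) (e : Edge N) (P : List (Part N)) :
    (insertPart s e P).map Prod.fst =
      if s ∈ P.map Prod.fst then P.map Prod.fst else P.map Prod.fst ++ [s] := by
  induction P with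
  | nil => simp [insertPart]
  | cons p P ih =>
    rw [insertPart]
    by_cases h : p.1 = s
    · simp [h]
    · simp only [h, if_false, List.map_cons, ih, List.mem_cons, Ne.symm h, false_or]
      split_ifs <;> rfl

/-- The parts after the insertion of `e`: old parts with another key, the enlarged part, or a new
one. -/
theorem mem_insertPart {s : ℕ} {e : Edge N} {P : List (Part N)} (hP : (P.map Prod.fst).Nodup)
    {p : Part N} (hp : p ∈ insertPart s e P) : (p ∈ P ∧ p.1 ≠ s) ∨
      (∃ F c, (s, F, c) ∈ P ∧ p = (s, e :: F, c + 1)) ∨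
      (p = (s, [e], 1) ∧ s ∉ P.map Prod.fst) := by
  induction P with
  | nil =>
    rw [insertPart, List.mem_singleton] at hp
    exact Or.inr (Or.inr ⟨hp, by simp⟩)
  | cons q P ih =>
    rw [List.map_cons, List.nodup_cons] at hP
    rw [insertPart] at hp
    split_ifs at hp with h
    · rcases List.mem_cons.1 hp with rfl | hp
      · exact Or.inr (Or.inl ⟨q.2.1, q.2.2, by simp [← h], rfl⟩)
      · refine Or.inl ⟨List.mem_cons_of_mem _ hp, fun h' => hP.1 ?_⟩
        rw [h, ← h']
        exact List.mem_map_of_mem hp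
    · rcases List.mem_cons.1 hp with rfl | hp
      · exact Or.inl ⟨List.mem_cons_self, h⟩
      · rcases ih hP.2 hp with h' | ⟨F, c, h', rfl⟩ | ⟨rfl, h'⟩
        · exact Or.inl ⟨List.mem_cons_of_mem _ h'.1, h'.2⟩
        · exact Or.inr (Or.inl ⟨F, c, List.mem_cons_of_mem _ h', rfl⟩)
        · refine Or.inr (Or.inr ⟨rfl, ?_⟩)
          rw [List.map_cons, List.mem_cons, not_or]
          exact ⟨Ne.symm h, h'⟩

/-- `P` lists the classes of the members of `E` with equal values of `f`, with their sizes. -/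
structure IsPartition (f : Edge N → ℕ) (E : List (Edge N)) (P : List (Part N)) : Prop where
  nodup_keys : (P.map Prod.fst).Nodup
  nodup : ∀ p ∈ P, p.2.1.Nodup
  size : ∀ p ∈ P, p.2.2 = p.2.1.length
  mem_iff : ∀ p ∈ P, ∀ e, e ∈ p.2.1 ↔ e ∈ E ∧ f e = p.1
  mem_keys : ∀ s, s ∈ P.map Prod.fst ↔ ∃ e ∈ E, f e = s

theorem IsPartition.insertPart {f : Edge N → ℕ} {E : List (Edge N)} {P : List (Part N)}
    (h : IsPartition f E P) {e : Edge N} (he : e ∉ E) :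
    IsPartition f (E ++ [e]) (insertPart (f e) e P) := by
  have hkeys := map_fst_insertPart (f e) e P
  refine ⟨?_, ?_, ?_, ?_, ?_⟩
  · rw [hkeys]
    split_ifs with hs
    · exact h.1
    · exact List.Nodup.append h.1 (List.nodup_singleton _) (by simpa using hs)
  · intro p hp
    rcases mem_insertPart h.1 hp with h' | ⟨F, c, h', rfl⟩ | ⟨rfl, -⟩
    · exact h.2 p h'.1
    · exact List.nodup_cons.2 ⟨fun h'' => he ((h.4 _ h' e).1 h'').1, h.2 _ h'⟩
    · simp
  · intro p hp
    rcases mem_insertPart h.1 hp with h' | ⟨F, c, h', rfl⟩ | ⟨rfl, -⟩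
    · exact h.3 p h'.1
    · have := h.3 _ h'
      simp only at this
      simp [this]
    · simp
  · intro p hp g
    rw [List.mem_append, List.mem_singleton]
    rcases mem_insertPart h.1 hp with h' | ⟨F, c, h', rfl⟩ | ⟨rfl, h'⟩
    · rw [h.4 p h'.1]
      constructor
      · exact fun h'' => ⟨Or.inl h''.1, h''.2⟩
      · rintro ⟨h'' | rfl, h₃⟩
        · exact ⟨h'', h₃⟩
        · exact absurd h₃.symm h'.2
    · have := h.4 _ h' g
      simp only at this ⊢
      rw [List.mem_cons, this]
      constructor
      · rintro (rfl | h'')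
        · exact ⟨Or.inr rfl, rfl⟩
        · exact ⟨Or.inl h''.1, h''.2⟩
      · rintro ⟨h'' | rfl, h₃⟩
        · exact Or.inr ⟨h'', h₃⟩
        · exact Or.inl rfl
    · rw [h.5] at h'
      simp only [List.mem_singleton]
      constructor
      · rintro rfl
        exact ⟨Or.inr rfl, rfl⟩
      · rintro ⟨h'' | rfl, h₃⟩
        · exact absurd ⟨g, h'', h₃⟩ h'
        · rfl
  · intro s
    have : (∃ g ∈ E ++ [e], f g = s) ↔ (∃ g ∈ E, f g = s) ∨ f e = s := by
      simp only [List.mem_append, List.mem_singleton, or_and_right, exists_or, exists_eq_left]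
    rw [this, ← h.5, hkeys]
    split_ifs with hs
    · exact ⟨Or.inl, fun h' => h'.elim id fun h' => h' ▸ hs⟩
    · rw [List.mem_append, List.mem_singleton, eq_comm (a := s)]

/-- The common part of the searches for the minimal and for the maximal members of a list. -/
theorem sat_extremalMembers {α : Type} (f : α → ℕ) (le : ℕ → ℕ → Prop) (lt : ℕ → ℕ → Bool)
    (le_refl : ∀ x, le x x) (le_trans : ∀ x y z, le x y → le y z → le x z)
    (lt_le : ∀ x y, lt x y = true → le x y) (not_lt_le : ∀ x y, lt x y = false → le y x)
    (a : α) (l : List α) :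
    (do
      let m ← forEach l (f a) fun x m => do
        let b ← op (lt (f x) m)
        if b then op (f x) else pure m
      forEach (a :: l) [] fun x acc => do
        let b ← op (decide (f x = m))
        if b then op (x :: acc) else pure acc : Prog (List α)).Sat fun ms t =>
      ((∀ b ∈ ms, b ∈ a :: l ∧ ∀ c ∈ a :: l, le (f b) (f c)) ∧ ms ≠ [] ∧
        ms.length ≤ (a :: l).length) ∧ t ≤ 3 * l.length + 1 + (3 * (a :: l).length + 1) := by
  refine Sat.bind_le (Q := fun m => ∃ b ∈ a :: l, f b = m ∧ ∀ c ∈ a :: l, le m (f c))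
    (T := 3 * l.length + 1) ?_ ?_
  · refine (sat_forEach (fun pre m => ∃ b ∈ a :: pre, f b = m ∧ ∀ c ∈ a :: pre, le m (f c)) 2
      ⟨a, by simpa using le_refl _⟩ ?_)
    rintro pre x post - _ ⟨b, hb, rfl, hmin⟩
    simp only [sat_bind, sat_op, sat_ite, sat_pure]
    refine ⟨fun h => ⟨⟨x, by simp, rfl, ?_⟩, by omega⟩,
      fun h => ⟨⟨b, ?_, rfl, ?_⟩, by omega⟩⟩
    · intro c hc
      rw [← List.cons_append, List.mem_append, List.mem_singleton] at hc
      rcases hc with hc | rfl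
      · exact le_trans _ _ _ (lt_le _ _ h) (hmin c hc)
      · exact le_refl _
    · rw [← List.cons_append]
      exact List.mem_append_left _ hb
    · intro c hc
      rw [← List.cons_append, List.mem_append, List.mem_singleton] at hc
      rcases hc with hc | rfl
      · exact hmin c hc
      · exact not_lt_le _ _ (by simpa using h)
  · rintro _ ⟨b, hb, rfl, hmin⟩
    refine (sat_forEach (fun pre ms => (∀ x, x ∈ ms ↔ x ∈ pre ∧ f x = f b) ∧
      ms.length ≤ pre.length) 2 (by simp) ?_).mono ?_
    · rintro pre x post - ms ⟨hms, hlen⟩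
      simp only [sat_bind, sat_op, sat_ite, decide_eq_true_eq, sat_pure, List.mem_cons,
        List.mem_append, hms, List.not_mem_nil, or_false, List.length_cons, List.length_append,
        List.length_nil]
      refine ⟨fun h => ⟨⟨fun y => ⟨?_, ?_⟩, by omega⟩, by omega⟩,
        fun h => ⟨⟨fun y => ⟨?_, ?_⟩, by omega⟩, by omega⟩⟩
      · rintro (rfl | h')
        · exact ⟨Or.inr rfl, h⟩
        · exact ⟨Or.inl h'.1, h'.2⟩
      · rintro ⟨h' | rfl, h''⟩
        · exact Or.inr ⟨h', h''⟩
        · exact Or.inl rfl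
      · exact fun h' => ⟨Or.inl h'.1, h'.2⟩
      · rintro ⟨h' | rfl, h''⟩
        · exact ⟨h', h''⟩
        · exact absurd h'' h
    · rintro ms t ⟨⟨hms, hlen⟩, ht⟩
      refine ⟨⟨fun x hx => ?_, ?_, hlen⟩, by simpa using ht⟩
      · obtain ⟨h1, h2⟩ := (hms x).1 hx
        exact ⟨h1, fun c hc => h2 ▸ hmin c hc⟩
      · exact List.ne_nil_of_mem ((hms b).2 ⟨hb, rfl⟩)

theorem sat_minimalMembers {α : Type} (f : α → ℕ) (l : List α) :
    (minimalMembers f l).Sat fun ms t => ((∀ a ∈ ms, a ∈ l ∧ ∀ b ∈ l, f a ≤ f b) ∧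
      (l ≠ [] → ms ≠ []) ∧ ms.length ≤ l.length) ∧ t ≤ 6 * l.length + 2 := by
  cases l with
  | nil => simp [minimalMembers]
  | cons a l =>
    refine (sat_extremalMembers f (fun x y => x ≤ y) (fun x y => decide (x < y)) (fun _ => le_rfl)
      (fun _ _ _ => le_trans) (by simpa using fun _ _ => le_of_lt) (by simp) a l).mono ?_
    rintro ms t ⟨⟨h1, h2, h3⟩, ht⟩
    exact ⟨⟨h1, fun _ => h2, h3⟩, by simp only [List.length_cons] at ht ⊢; omega⟩

theorem sat_maximalMembers {α : Type} (f : α → ℕ) (l : List α) :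
    (maximalMembers f l).Sat fun ms t => ((∀ a ∈ ms, a ∈ l ∧ ∀ b ∈ l, f b ≤ f a) ∧
      (l ≠ [] → ms ≠ []) ∧ ms.length ≤ l.length) ∧ t ≤ 6 * l.length + 2 := by
  cases l with
  | nil => simp [maximalMembers]
  | cons a l =>
    refine (sat_extremalMembers f (fun x y => y ≤ x) (fun x y => decide (y < x)) (fun _ => le_rfl)
      (fun _ _ _ h h' => le_trans h' h) (by simpa using fun _ _ => le_of_lt) (by simp) a l).mono ?_
    rintro ms t ⟨⟨h1, h2, h3⟩, ht⟩
    exact ⟨⟨h1, fun _ => h2, h3⟩, by simp only [List.length_cons] at ht ⊢; omega⟩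

end Partition

/-- The partition of the edges by the number of octagons through them is computed in linear time:
this number is bounded, so that the number of parts is bounded, and each edge takes constant time.
-/
theorem sat_sigmaPartition : ∃ c : ℕ, ∀ {N : ℕ} {G : SimpleGraph (Fin N)}
    {A : Fin N → Fin 3 → Fin N} (_ : IsAdjacencyList G A),
    (sigmaPartition A).Sat fun P t =>
      (∃ E : List (Edge N), (∀ e, e ∈ E ↔ IsEdge G e) ∧
        IsPartition (fun e => octagonCount G.Adj e.1 e.2) E P ∧ P.length ≤ c) ∧
      t ≤ c * (N + 1) := by
  obtain ⟨M, c, h⟩ := sat_sigma_edgeBall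
  set T := c + (2 * (M + 1) + 4) with hT
  refine ⟨14 + 3 * (T + 1) + 2 + (M + 1), fun {N G A} hA => ?_⟩
  rw [sigmaPartition]
  refine (Sat.bind_le (sat_allEdges hA) (R := fun P => ∃ E : List (Edge N),
    (∀ e, e ∈ E ↔ IsEdge G e) ∧
      IsPartition (fun e => octagonCount G.Adj e.1 e.2) E P ∧ P.length ≤ M + 1)
    (T' := (T + 1) * (3 * N) + 1) ?_).mono ?_
  · rintro E ⟨hnd, hE, hlen⟩
    refine (sat_forEach (fun pre P => IsPartition (fun e => octagonCount G.Adj e.1 e.2) pre P ∧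
      ∀ s ∈ P.map Prod.fst, s ≤ M) T ⟨⟨by simp, by simp, by simp, by simp, by simp⟩, by simp⟩
      ?_).mono ?_
    · rintro pre e post rfl P ⟨hP, hM⟩
      have he : e ∉ pre := by
        rw [List.nodup_append] at hnd
        exact fun h => hnd.2.2 e h e (by simp) rfl
      have hlenP : P.length ≤ M + 1 := by
        have : (P.map Prod.fst) ⊆ List.range (M + 1) := fun s hs =>
          List.mem_range.2 (Nat.lt_succ_of_le (hM s hs))
        have := (List.subperm_of_subset hP.1 this).length_le
        simpa using this
      have hsig := h hA e ((hE e).1 (by simp))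
      rw [sat_bind] at hsig ⊢
      refine hsig.mono fun H t' hH => ?_
      rw [sat_bind]
      refine hH.mono ?_
      rintro _ t ⟨⟨rfl, hs⟩, ht⟩
      refine (sat_insertEdge _ _ _).mono ?_
      rintro _ t₂ ⟨rfl, ht₂⟩
      refine ⟨⟨hP.insertPart he, ?_⟩, by omega⟩
      intro s hs'
      rw [map_fst_insertPart] at hs'
      split_ifs at hs' with hs''
      · exact hM s hs'
      · rcases List.mem_append.1 hs' with h' | h'
        · exact hM s h'
        · rwa [List.mem_singleton.1 h']
    · rintro P t ⟨⟨hP, hM⟩, ht⟩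
      refine ⟨⟨E, hE, hP, ?_⟩, ht.trans (by gcongr)⟩
      have : (P.map Prod.fst) ⊆ List.range (M + 1) := fun s hs =>
        List.mem_range.2 (Nat.lt_succ_of_le (hM s hs))
      have := (List.subperm_of_subset hP.1 this).length_le
      simpa using this
  · rintro P t ⟨⟨E, hE, hP, hPlen⟩, ht⟩
    exact ⟨⟨E, hE, hP, by omega⟩, by nlinarith⟩

/-! ### Vertex sets and walks -/

section Sets

variable {N : ℕ} {G : SimpleGraph (Fin N)} {A : Fin N → Fin 3 → Fin N}

theorem sat_neighborsIn (hA : IsAdjacencyList G A) (S : Fin N → Bool) (x : Fin N) :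
    (neighborsIn A S x).Sat fun l t => (l.Nodup ∧ (∀ w, w ∈ l ↔ S w = true ∧ G.Adj x w) ∧
      l.length ≤ 3) ∧ t ≤ 13 := by
  refine (sat_forEach (fun js l => l.Nodup ∧ (∀ w, w ∈ l ↔ S w = true ∧ ∃ j ∈ js, A x j = w) ∧
    l.length ≤ js.length) 3 (by simp) ?_).mono ?_
  · rintro js j js' hjs l ⟨hnd, hmem, hlen⟩
    have hj : j ∉ js := by
      have : ([0, 1, 2] : List (Fin 3)).Nodup := by decide
      rw [hjs, List.nodup_append] at this
      exact fun h => this.2.2 j h j (by simp) rfl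
    have hjs : ∀ w, (∃ i ∈ js ++ [j], A x i = w) ↔ (∃ i ∈ js, A x i = w) ∨ A x j = w := by
      simp [or_and_right, exists_or]
    simp only [sat_bind, sat_op, sat_ite, sat_pure, hjs, List.length_append, List.length_singleton]
    refine ⟨fun h => ⟨⟨List.nodup_cons.2 ⟨?_, hnd⟩, fun w => ?_, by simpa using hlen⟩, by omega⟩,
      fun h => ⟨⟨hnd, fun w => ?_, by omega⟩, by omega⟩⟩
    · rw [hmem]
      rintro ⟨-, i, hi, h'⟩
      exact hj ((hA x).1 h' ▸ hi)
    · rw [List.mem_cons, hmem]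
      constructor
      · rintro (rfl | h')
        · exact ⟨h, Or.inr rfl⟩
        · exact ⟨h'.1, Or.inl h'.2⟩
      · rintro ⟨h1, h2 | rfl⟩
        · exact Or.inr ⟨h1, h2⟩
        · exact Or.inl rfl
    · rw [hmem]
      constructor
      · exact fun h' => ⟨h'.1, Or.inl h'.2⟩
      · rintro ⟨h1, h2 | rfl⟩
        · exact ⟨h1, h2⟩
        · exact absurd h1 h
  · rintro l t ⟨⟨hnd, hmem, hlen⟩, ht⟩
    refine ⟨⟨hnd, fun w => ?_, hlen⟩, by simpa using ht⟩
    rw [hmem, (hA x).2]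
    refine and_congr_right fun _ => exists_congr fun j => ?_
    fin_cases j <;> simp

theorem sat_count {α : Type} (l : List α) :
    (count l).Sat fun c t => c = l.length ∧ t ≤ 2 * l.length + 1 := by
  refine (sat_forEach (fun pre c => c = pre.length) 1 rfl ?_)
  rintro pre a post - _ rfl
  simp

theorem sat_members (S : Fin N → Bool) : (members S).Sat fun l t =>
    (l.Nodup ∧ (∀ x, x ∈ l ↔ S x = true) ∧ l.length ≤ N) ∧ t ≤ 3 * N + 1 := by
  refine (sat_forEach (fun pre l => l = (pre.filter S).reverse) 2 rfl ?_).mono ?_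
  · rintro pre x post - _ rfl
    simp only [sat_bind, sat_op, sat_ite, sat_pure]
    exact ⟨fun h => by simp [h], fun h => by simp [h]⟩
  · rintro _ t ⟨rfl, ht⟩
    refine ⟨⟨?_, by simp, ?_⟩, by simpa using ht⟩
    · exact List.nodup_reverse.2 ((List.nodup_finRange N).filter _)
    · rw [List.length_reverse]
      exact (List.length_filter_le _ _).trans (by simp)

/-- A loop over all vertices that fills an array with the values of `f`. -/
theorem foldl_update_finRange {β : Type} (f : Fin N → β) (g : Fin N → β) :
    (List.finRange N).foldl (fun T x => Function.update T x (f x)) g = f := by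
  have h : ∀ (l : List (Fin N)) (g : Fin N → β) x,
      l.foldl (fun T x => Function.update T x (f x)) g x = if x ∈ l then f x else g x := by
    intro l
    induction l with
    | nil => simp
    | cons a l ih =>
      intro g x
      rw [List.foldl_cons, ih]
      by_cases hx : x ∈ l
      · simp [hx]
      · by_cases hxa : x = a
        · subst hxa; simp [hx]
        · simp [hx, hxa]
  funext x
  rw [h]
  simp

theorem sat_complement (S : Fin N → Bool) :
    (complement S).Sat fun T t => T = (fun x => !S x) ∧ t ≤ 4 * N + 2 := by
  refine (Sat.bind_le (sat_alloc N false) (R := fun T => T = fun x => !S x)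
    (T' := 3 * N + 1) ?_).mono fun T t h => ⟨h.1, by omega⟩
  rintro _ rfl
  refine (sat_forEach_foldl (fun T x => Function.update T x (!S x)) 2 ?_).mono ?_
  · intro x _ T
    simp [sat_bind]
  · rintro _ t ⟨rfl, ht⟩
    exact ⟨foldl_update_finRange _ _, by simpa using ht⟩

/-- The subgraph of `G` induced by `S` is `2`-regular. -/
def TwoRegular (G : SimpleGraph (Fin N)) (S : Fin N → Bool) : Prop :=
  ∀ x, S x = true → ∃ y z, y ≠ z ∧ ∀ w, (S w = true ∧ G.Adj x w) ↔ w = y ∨ w = z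

theorem length_eq_two_iff {l : List (Fin N)} (hl : l.Nodup) {p : Fin N → Prop}
    (hp : ∀ w, w ∈ l ↔ p w) : l.length = 2 ↔ ∃ y z, y ≠ z ∧ ∀ w, p w ↔ w = y ∨ w = z := by
  constructor
  · intro h
    match l, h with
    | [y, z], _ => exact ⟨y, z, by simpa using hl, fun w => by simp [← hp]⟩
  · rintro ⟨y, z, hyz, h⟩
    have h1 : l.toFinset = {y, z} := by
      ext w
      simp [hp, h]
    rw [← List.toFinset_card_of_nodup hl, h1, Finset.card_pair hyz]

theorem sat_isTwoRegular (hA : IsAdjacencyList G A) (S : Fin N → Bool) :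
    (isTwoRegular A S).Sat fun b t => (b = true ↔ TwoRegular G S) ∧ t ≤ 26 * N + 2 := by
  refine (Sat.bind_le (sat_members S) (R := fun b => b = true ↔ TwoRegular G S)
    (T' := 23 * N + 1) ?_).mono fun b t h => ⟨h.1, by omega⟩
  rintro l ⟨-, hmem, hlen⟩
  refine (sat_forEach (fun pre b => b = true ↔ ∀ x ∈ pre, ∃ y z, y ≠ z ∧ ∀ w,
    (S w = true ∧ G.Adj x w) ↔ w = y ∨ w = z) 22 (by simp) ?_).mono ?_
  · rintro pre x post - ok hok
    rw [sat_bind]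
    refine (sat_neighborsIn hA S x).mono ?_
    rintro nb t ⟨⟨hnd, hnb, hlen'⟩, ht⟩
    rw [sat_bind]
    refine (sat_count nb).mono ?_
    rintro _ t' ⟨rfl, ht'⟩
    simp only [sat_bind, sat_op]
    refine ⟨?_, by omega⟩
    rw [Bool.and_eq_true, hok, decide_eq_true_eq, length_eq_two_iff hnd hnb]
    simp only [List.mem_append, List.mem_singleton, or_imp, forall_and, forall_eq]
  · rintro b t ⟨hb, ht⟩
    refine ⟨?_, ht.trans (by gcongr)⟩
    rw [hb]
    exact forall_congr' fun x => by rw [hmem]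

/-- `w` runs along the `2`-regular subgraph induced by `S` without turning back. -/
structure IsRun (G : SimpleGraph (Fin N)) (S : Fin N → Bool) (w : ℕ → Fin N) : Prop where
  mem : ∀ i, S (w i) = true
  adj : ∀ i, G.Adj (w i) (w (i + 1))
  ne : ∀ i, w i ≠ w (i + 2)
  nbr : ∀ i x, S x = true → G.Adj (w (i + 1)) x → x = w i ∨ x = w (i + 2)

/-- In a `2`-regular subgraph every directed edge begins a run. -/
theorem TwoRegular.exists_run {S : Fin N → Bool} (h : TwoRegular G S) {s t : Fin N}
    (hs : S s = true) (ht : S t = true) (hst : G.Adj s t) :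
    ∃ w, IsRun G S w ∧ w 0 = s ∧ w 1 = t := by
  -- The other neighbour in `S` of the second vertex of a pair of adjacent vertices.
  have hnext : ∀ p : Fin N × Fin N, ∃ z, (S p.1 = true ∧ S p.2 = true ∧ G.Adj p.1 p.2) →
      (S z = true ∧ G.Adj p.2 z ∧ p.1 ≠ z ∧
        ∀ x, S x = true → G.Adj p.2 x → x = p.1 ∨ x = z) := by
    rintro ⟨a, b⟩
    by_cases hp : S a = true ∧ S b = true ∧ G.Adj a b
    · obtain ⟨y, z, hyz, hnb⟩ := h b hp.2.1
      have hy := (hnb y).2 (Or.inl rfl)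
      have hz := (hnb z).2 (Or.inr rfl)
      rcases (hnb a).1 ⟨hp.1, hp.2.2.symm⟩ with rfl | rfl
      · exact ⟨z, fun _ => ⟨hz.1, hz.2, hyz, fun x h1 h2 => (hnb x).1 ⟨h1, h2⟩⟩⟩
      · exact ⟨y, fun _ => ⟨hy.1, hy.2, hyz.symm, fun x h1 h2 => ((hnb x).1 ⟨h1, h2⟩).symm⟩⟩
    · exact ⟨a, fun h => absurd h hp⟩
  choose next hnext using hnext
  let q : ℕ → Fin N × Fin N := fun i => (fun p => (p.2, next p))^[i] (s, t)
  have hq : ∀ i, q (i + 1) = ((q i).2, next (q i)) := fun i =>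
    Function.iterate_succ_apply' _ _ _
  have hgood : ∀ i, S (q i).1 = true ∧ S (q i).2 = true ∧ G.Adj (q i).1 (q i).2 := by
    intro i
    induction i with
    | zero => exact ⟨hs, ht, hst⟩
    | succ i ih =>
      rw [hq]
      have := hnext _ ih
      exact ⟨ih.2.1, this.1, this.2.1⟩
  have h1 : ∀ i, (q (i + 1)).1 = (q i).2 := fun i => by rw [hq]
  have h2 : ∀ i, (q (i + 2)).1 = next (q i) := fun i => by rw [h1, hq]
  refine ⟨fun i => (q i).1, ⟨fun i => (hgood i).1, fun i => ?_, fun i => ?_, fun i x hx hadj => ?_⟩,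
    rfl, rfl⟩
  · simpa only [h1] using (hgood i).2.2
  · simpa only [h2] using (hnext _ (hgood i)).2.2.1
  · simp only [h2]
    simp only [h1] at hadj
    exact (hnext _ (hgood i)).2.2.2 x hx hadj

/-- The walk along a run stops when it reaches `s`, or when it runs out of fuel. -/
theorem sat_walk (hA : IsAdjacencyList G A) {S : Fin N → Bool} {w : ℕ → Fin N} (hw : IsRun G S w)
    (s : Fin N) (fuel i : ℕ) (acc : List (Fin N)) :
    (walk A S s fuel (w i) (w (i + 1)) acc).Sat fun o t =>
      (∃ m ≤ fuel, o = ((List.range' (i + 1) m).reverse.map w) ++ acc ∧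
        (∀ j < m, w (i + 1 + j) ≠ s) ∧ (m = fuel ∨ w (i + 1 + m) = s)) ∧ t ≤ 25 * fuel + 1 := by
  induction fuel generalizing i acc with
  | zero =>
    rw [walk, sat_op]
    exact ⟨⟨0, le_rfl, by simp⟩, le_rfl⟩
  | succ fuel ih =>
    rw [walk]
    simp only [sat_bind, sat_op, sat_ite, sat_pure, decide_eq_true_eq]
    refine ⟨fun h => ⟨⟨0, by omega, by simpa using h⟩, by omega⟩, fun h => ?_⟩
    refine (sat_neighborsIn hA S _).mono ?_
    rintro nb t ⟨⟨-, hnb, hlen⟩, ht⟩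
    refine (sat_forEach (fun pre (x : Fin N) => (x = w i ∧ ∀ y ∈ pre, y = w i) ∨ x = w (i + 2)) 2
      (Or.inl ⟨rfl, by simp⟩) ?_).mono ?_
    · rintro pre y post hl x hx
      simp only [sat_bind, sat_op, sat_ite, sat_pure, decide_eq_true_eq]
      refine ⟨?_, fun hy => ⟨Or.inr ?_, by omega⟩⟩
      · rintro rfl
        refine ⟨hx.imp_left fun h => ⟨h.1, ?_⟩, by omega⟩
        intro z hz
        rcases List.mem_append.1 hz with hz | hz
        · exact h.2 z hz
        · exact List.mem_singleton.1 hz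
      · have := (hnb y).1 (by simp [hl])
        exact (hw.nbr i y this.1 this.2).resolve_left hy
    · rintro x t' ⟨hx, ht'⟩
      have hx : x = w (i + 2) := by
        rcases hx with ⟨-, hx⟩ | hx
        · exact absurd (hx (w (i + 2)) ((hnb _).2 ⟨hw.mem _, hw.adj _⟩)).symm (hw.ne i)
        · exact hx
      subst hx
      refine (ih (i + 1) (w (i + 1) :: acc)).mono ?_
      rintro _ t'' ⟨⟨m, hm, rfl, hne, hend⟩, ht''⟩
      refine ⟨⟨m + 1, by omega, ?_, ?_, ?_⟩, by omega⟩
      · rw [List.range'_succ]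
        simp
      · intro j hj
        cases j with
        | zero => exact h
        | succ j =>
          have := hne j (by omega)
          rwa [show i + 1 + (j + 1) = i + 1 + 1 + j by omega]
      · rw [show i + 1 + (m + 1) = i + 1 + 1 + m by omega]
        exact hend.imp_left fun h => by omega

/-- The run `w` returns to its first vertex for the first time after `n` steps. -/
def ReturnsAt (w : ℕ → Fin N) (n : ℕ) : Prop := w n = w 0 ∧ ∀ j, 0 < j → j < n → w j ≠ w 0

/-- If `S` induces a `2`-regular graph on `n` vertices, then `cyclicOrder` follows a run for `n`
steps, and the answer is `none` if and only if the run closes up too early. The list that is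
returned begins with the last vertex of the run. -/
theorem sat_cyclicOrder (hA : IsAdjacencyList G A) (S : Fin N → Bool) {n : ℕ} (hn : n ≤ N) :
    (cyclicOrder A S n).Sat fun o t =>
      ((TwoRegular G S ∧ (Finset.univ.filter fun x => S x = true).card = n ∧ ∃ w, IsRun G S w ∧
        ((o = none ∧ ¬ ReturnsAt w n) ∨
          (o = some ((List.range n).reverse.map w) ∧ ReturnsAt w n))) ∨
      (o = none ∧ ¬ (TwoRegular G S ∧ (Finset.univ.filter fun x => S x = true).card = n ∧ 0 < n))) ∧
      t ≤ 60 * N + 60 := by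
  rw [cyclicOrder, sat_bind]
  refine (sat_members S).mono ?_
  rintro l t ⟨⟨hnd, hmem, hlen⟩, ht⟩
  have hcard : (Finset.univ.filter fun x => S x = true).card = l.length := by
    rw [← List.toFinset_card_of_nodup hnd]
    congr 1
    ext x
    simp [hmem]
  rw [hcard, sat_bind]
  refine (sat_count l).mono ?_
  rintro _ t₁ ⟨rfl, ht₁⟩
  rw [sat_bind, sat_op, sat_bind]
  refine (sat_isTwoRegular hA S).mono ?_
  rintro r t₂ ⟨hr, ht₂⟩
  rw [sat_ite, Bool.and_eq_true, decide_eq_true_eq, hr]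
  refine ⟨fun h => ?_, fun h => ?_⟩
  · obtain ⟨hl, hreg⟩ := h
    match l, hl, hmem, hlen, hnd with
    | [], hl, _, _, _ =>
      rw [sat_op]
      simp only [List.length_nil] at hl ht₁
      exact ⟨Or.inr ⟨rfl, fun h => by omega⟩, by omega⟩
    | x :: l, hl, hmem, hlen, _ =>
      simp only [sat_bind]
      refine (sat_pick x l).mono ?_
      rintro s t₃ ⟨hs, ht₃⟩
      have hs := (hmem s).1 hs
      simp only [List.length_cons] at hl ht₁ hlen
      refine (sat_neighborsIn hA S s).mono ?_
      rintro nb t₄ ⟨⟨-, hnb, hnblen⟩, ht₄⟩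
      match nb, hnb, hnblen with
      | [], hnb, _ =>
        obtain ⟨y, _, -, hy⟩ := hreg s hs
        exact absurd ((hnb y).2 ((hy y).2 (Or.inl rfl))) (by simp)
      | y :: nb, hnb, hnblen =>
        simp only [sat_bind]
        refine (sat_pick y nb).mono ?_
        rintro u t₅ ⟨hu, ht₅⟩
        simp only [List.length_cons] at hnblen
        obtain ⟨hu, hsu⟩ := (hnb u).1 hu
        obtain ⟨w, hw, rfl, rfl⟩ := hreg.exists_run hs hu hsu
        refine (sat_walk hA hw (w 0) n 0 [w 0]).mono ?_
        rintro o t₆ ⟨⟨m, hm, rfl, hne, hend⟩, ht₆⟩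
        refine (sat_count _).mono ?_
        rintro _ t₇ ⟨rfl, ht₇⟩
        have e : (List.range' (0 + 1) m).reverse.map w ++ [w 0] =
            (List.range (m + 1)).reverse.map w := by
          rw [List.range_eq_range' (n := m + 1), List.range'_succ]
          simp
        rw [e] at ht₇ ⊢
        have elen : ((List.range (m + 1)).reverse.map w).length = m + 1 := by simp
        rw [elen] at ht₇ ⊢
        rw [sat_op, sat_ite, decide_eq_true_eq, sat_op, sat_op]
        refine ⟨fun h => ⟨Or.inl ⟨hreg, hl, w, hw, Or.inr ⟨by rw [h], ?_, ?_⟩⟩, by omega⟩,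
          fun h => ⟨Or.inl ⟨hreg, hl, w, hw, Or.inl ⟨rfl, ?_⟩⟩, by omega⟩⟩
        · rcases hend with h' | h'
          · omega
          · rwa [show 0 + 1 + m = n by omega] at h'
        · intro j hj hjn
          have := hne (j - 1) (by omega)
          rwa [show 0 + 1 + (j - 1) = j by omega] at this
        · rintro ⟨h1, h2⟩
          by_cases hmn : m = n
          · exact hne (m - 1) (by omega) (by rwa [show 0 + 1 + (m - 1) = n by omega])
          · exact h2 (0 + 1 + m) (by omega) (by omega) (hend.resolve_left hmn)
  · rw [sat_op]
    exact ⟨Or.inr ⟨rfl, fun h' => h ⟨h'.2.1, h'.1⟩⟩, by omega⟩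

end Sets

/-! ### The search for the inner rim -/

section Rim

variable {N : ℕ} {G : SimpleGraph (Fin N)} {A : Fin N → Fin 3 → Fin N}

theorem sat_toArray (n : ℕ) (x : Fin N) (l : List (Fin N)) :
    (toArray n x l).Sat fun a t => (∀ i < l.length, l[i]? = some (a i)) ∧
      t ≤ n + 3 * l.length + 2 := by
  rw [toArray, sat_bind]
  refine (sat_alloc n x).mono ?_
  rintro _ t ⟨rfl, ht⟩
  rw [sat_bind]
  refine (sat_forEach (fun pre (s : (ℕ → Fin N) × ℕ) => s.2 = pre.length ∧
    ∀ i < pre.length, pre[i]? = some (s.1 i)) 2 ⟨rfl, by simp⟩ ?_).mono ?_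
  · rintro pre y post - ⟨a, i⟩ ⟨hi, ha⟩
    simp only at hi
    subst hi
    simp only [sat_bind, sat_op, sat_pure, List.length_append, List.length_singleton, true_and]
    refine ⟨fun j hj => ?_, by omega⟩
    by_cases hj' : j < pre.length
    · rw [List.getElem?_append_left hj', ha j hj', Function.update_of_ne hj'.ne]
    · obtain rfl : j = pre.length := by omega
      simp
  · rintro ⟨a, i⟩ t' ⟨⟨-, ha⟩, ht'⟩
    rw [sat_pure]
    exact ⟨ha, by omega⟩

theorem sat_spokeEnds (hA : IsAdjacencyList G A) (n : ℕ) (x : Fin N) (u : ℕ → Fin N) :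
    (spokeEnds A n x u).Sat fun v t => (∀ i < n, G.Adj (u i) (v i) ∧ v i ≠ u ((i + 1) % n) ∧
      v i ≠ u ((i + (n - 1)) % n)) ∧ t ≤ 26 * n + 2 := by
  refine (Sat.bind_le (sat_alloc n x) (R := fun v => ∀ i < n, G.Adj (u i) (v i) ∧
    v i ≠ u ((i + 1) % n) ∧ v i ≠ u ((i + (n - 1)) % n)) (T' := 25 * n + 1) ?_).mono
    fun v t h => ⟨h.1, by omega⟩
  rintro _ rfl
  refine (sat_forEach (fun pre v => ∀ i ∈ pre, G.Adj (u i) (v i) ∧ v i ≠ u ((i + 1) % n) ∧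
    v i ≠ u ((i + (n - 1)) % n)) 24 (by simp) ?_).mono ?_
  · rintro pre i post hl v hv
    have hi : i ∉ pre := by
      have := List.nodup_range (n := n)
      rw [hl, List.nodup_append] at this
      exact fun h => this.2.2 i h i (by simp) rfl
    simp only [addMod, sat_bind, sat_op]
    refine (sat_forEach (fun js (v' : ℕ → Fin N) => (∀ i' ≠ i, v' i' = v i') ∧
      ((∀ j ∈ js, A (u i) j = u ((i + 1) % n) ∨ A (u i) j = u ((i + (n - 1)) % n)) ∨
        (G.Adj (u i) (v' i) ∧ v' i ≠ u ((i + 1) % n) ∧ v' i ≠ u ((i + (n - 1)) % n)))) 4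
      (by simp) ?_).mono ?_
    · rintro js j js' - v' ⟨hv', h⟩
      simp only [sat_bind, sat_op, sat_ite, sat_pure, Bool.or_eq_true, decide_eq_true_eq]
      refine ⟨fun hj => ⟨⟨hv', ?_⟩, by omega⟩, fun hj => ⟨⟨fun i' hi' => ?_, Or.inr ?_⟩, by omega⟩⟩
      · refine h.imp_left fun h k hk => ?_
        rcases List.mem_append.1 hk with hk | hk
        · exact h k hk
        · rwa [List.mem_singleton.1 hk]
      · rw [Function.update_of_ne hi', hv' i' hi']
      · rw [Function.update_self]
        exact ⟨((hA _).2 _).2 ⟨j, rfl⟩, fun h => hj (Or.inl h), fun h => hj (Or.inr h)⟩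
    · rintro v' t ⟨⟨hv', h⟩, ht⟩
      refine ⟨?_, by simp at ht; omega⟩
      intro k hk
      rcases List.mem_append.1 hk with hk | hk
      · have : k ≠ i := fun h => hi (h ▸ hk)
        rw [hv' k this]
        exact hv k hk
      · rw [List.mem_singleton.1 hk]
        refine h.resolve_left fun h => ?_
        -- Three different neighbours cannot be equal to one of two vertices.
        have h0 := h 0 (by simp)
        have h1 := h 1 (by simp)
        have h2 := h 2 (by simp)
        have hinj := (hA (u i)).1
        have h01 := hinj.ne (show (0 : Fin 3) ≠ 1 by decide)
        have h02 := hinj.ne (show (0 : Fin 3) ≠ 2 by decide)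
        have h12 := hinj.ne (show (1 : Fin 3) ≠ 2 by decide)
        grind
  · rintro v t ⟨hv, ht⟩
    exact ⟨fun i hi => hv i (List.mem_range.2 hi), by simpa using ht⟩

theorem sat_allDistinct (n : ℕ) (v : ℕ → Fin N) :
    (allDistinct n v).Sat fun b t => (b = true ↔ Set.InjOn v {i | i < n}) ∧ t ≤ N + 5 * n + 2 := by
  rw [allDistinct, sat_bind]
  refine (sat_alloc N false).mono ?_
  rintro _ t ⟨rfl, ht⟩
  rw [sat_bind]
  refine (sat_forEach (fun pre (s : (Fin N → Bool) × Bool) =>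
    (∀ x, s.1 x = true ↔ x ∈ pre.map v) ∧ (s.2 = true ↔ (pre.map v).Nodup)) 4
    (by simp) ?_).mono ?_
  · rintro pre i post - ⟨seen, ok⟩ ⟨hseen, hok⟩
    simp only [sat_bind, sat_op, sat_pure]
    simp only at hseen hok
    refine ⟨⟨fun x => ?_, ?_⟩, by omega⟩
    · rw [List.map_append, List.mem_append, ← hseen]
      by_cases hx : x = v i
      · simp [hx]
      · simp [hx]
    · rw [Bool.and_eq_true, hok, List.map_append, List.nodup_append', List.map_singleton,
        Bool.not_eq_true', ← Bool.not_eq_true, hseen]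
      simp
  · rintro ⟨seen, ok⟩ t' ⟨⟨-, hok⟩, ht'⟩
    rw [sat_pure]
    simp only at hok
    refine ⟨?_, by simp at ht'; omega⟩
    rw [hok]
    constructor
    · intro h i hi j hj hij
      exact List.inj_on_of_nodup_map h (List.mem_range.2 hi) (List.mem_range.2 hj) hij
    · intro h
      exact List.nodup_range.map_on fun i hi j hj hij =>
        h (List.mem_range.1 hi) (List.mem_range.1 hj) hij

theorem sat_findK (hA : IsAdjacencyList G A) (n : ℕ) (v : ℕ → Fin N) (fuel k : ℕ)
    (hfuel : n ≤ fuel + k) (hk : ∀ j < k, ¬ G.Adj (v 0) (v j)) :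
    (findK A n v fuel k).Sat fun o t => (match o with
      | none => ∀ j, 2 * j < n → ¬ G.Adj (v 0) (v j)
      | some k => 2 * k < n ∧ G.Adj (v 0) (v k)) ∧ t ≤ 19 * fuel + 3 := by
  classical
  induction fuel generalizing k with
  | zero =>
    rw [findK, sat_op]
    exact ⟨fun j hj => hk j (by omega), by omega⟩
  | succ fuel ih =>
    rw [findK]
    simp only [sat_bind, sat_op, sat_ite, decide_eq_true_eq]
    refine ⟨fun h => ?_, fun h => ⟨fun j hj => hk j (by omega), by omega⟩⟩
    refine (sat_adjacent hA _ _).mono ?_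
    rintro _ t ⟨rfl, ht⟩
    simp only [decide_eq_true_eq]
    refine ⟨fun h' => ⟨⟨by omega, h'⟩, by omega⟩, fun h' => ?_⟩
    refine (ih (k + 1) (by omega) ?_).mono fun o t' ho => ⟨ho.1, by have := ho.2; omega⟩
    intro j hj
    by_cases hjk : j = k
    · rwa [hjk]
    · exact hk j (by omega)

theorem sat_checkInner (hA : IsAdjacencyList G A) (n k : ℕ) (v : ℕ → Fin N) :
    (checkInner A n k v).Sat fun b t =>
      (b = true ↔ ∀ i, 1 ≤ i → i < n → G.Adj (v i) (v ((i + k) % n))) ∧ t ≤ 20 * n + 1 := by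
  classical
  refine (sat_forEach (fun pre b => b = true ↔ ∀ i ∈ pre, G.Adj (v i) (v ((i + k) % n))) 19
    (by simp) ?_).mono ?_
  · rintro pre i post - ok hok
    simp only [addMod, sat_bind, sat_op]
    refine (sat_adjacent hA _ _).mono ?_
    rintro _ t ⟨rfl, ht⟩
    refine ⟨?_, by omega⟩
    rw [Bool.and_eq_true, hok, decide_eq_true_eq]
    simp [or_imp, forall_and]
  · rintro b t ⟨hb, ht⟩
    refine ⟨?_, ht.trans (by simp only [List.length_range']; omega)⟩
    rw [hb]
    simp only [List.mem_range'_1]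
    exact ⟨fun h i h1 h2 => h i ⟨h1, by omega⟩, fun h i hi => h i hi.1 (by omega)⟩

/-- The labels `u i`, `v i` for `i < n` that `extendRim` assigns for the rim given by `w`; the list
of the rim begins with the last vertex. -/
def IsLabelling (G : SimpleGraph (Fin N)) (n : ℕ) (w u v : ℕ → Fin N) : Prop :=
  (∀ i < n, u i = w (n - 1 - i)) ∧ ∀ i < n, G.Adj (u i) (v i) ∧ v i ≠ u ((i + 1) % n) ∧
    v i ≠ u ((i + (n - 1)) % n)

/-- The labels do not depend on the tests that follow. The answer `true` gives a `k` with all the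
inner edges; conversely the answer is `true` if every admissible `k`, in particular the one that is
found, gives all the inner edges. -/
theorem sat_extendRim (hA : IsAdjacencyList G A) {n : ℕ} (hn0 : 0 < n) (hn : n ≤ N)
    (w : ℕ → Fin N) :
    (extendRim A n ((List.range n).reverse.map w)).Sat fun b t =>
      (∃ u v, IsLabelling G n w u v ∧
        (b = true → Set.InjOn v {i | i < n} ∧ ∃ k, 2 * k < n ∧ G.Adj (v 0) (v k) ∧
          ∀ i, 1 ≤ i → i < n → G.Adj (v i) (v ((i + k) % n))) ∧
        (Set.InjOn v {i | i < n} → (∃ k, 2 * k < n ∧ G.Adj (v 0) (v k)) →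
          (∀ k, 2 * k < n → G.Adj (v 0) (v k) →
            ∀ i, 1 ≤ i → i < n → G.Adj (v i) (v ((i + k) % n))) → b = true)) ∧
        t ≤ 80 * N + 20 := by
  obtain ⟨m, rfl⟩ : ∃ m, n = m + 1 := ⟨n - 1, by omega⟩
  have hlist : (List.range (m + 1)).reverse.map w = w m :: (List.range m).reverse.map w := by
    simp [List.range_succ]
  have hlen : ((List.range (m + 1)).reverse.map w).length = m + 1 := by simp
  unfold extendRim
  simp only [hlist]
  rw [← hlist, sat_bind]
  refine (sat_toArray (m + 1) (w m) _).mono ?_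
  rintro u t ⟨hu, ht⟩
  rw [hlen] at hu ht
  rw [sat_bind]
  refine (sat_spokeEnds hA (m + 1) (w m) u).mono ?_
  rintro v t₁ ⟨hv, ht₁⟩
  have hlab : IsLabelling G (m + 1) w u v := by
    refine ⟨fun i hi => ?_, hv⟩
    have := hu i hi
    rw [List.getElem?_map, List.getElem?_reverse (by simpa using hi), List.length_range,
      List.getElem?_range (by omega)] at this
    exact (Option.some.inj this).symm
  rw [sat_bind]
  refine (sat_allDistinct (m + 1) v).mono ?_
  rintro d t₂ ⟨hd, ht₂⟩
  rw [sat_ite, hd]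
  refine ⟨fun hinj => ?_, fun hinj => ?_⟩
  · rw [sat_bind]
    refine (sat_findK hA (m + 1) v (m + 1) 0 (by omega) (by simp)).mono ?_
    rintro (_ | k) t₃ ⟨hk, ht₃⟩
    · rw [sat_op]
      refine ⟨⟨u, v, hlab, by simp, ?_⟩, by omega⟩
      rintro - ⟨k, hk', hadj⟩
      exact absurd hadj (hk k hk')
    · refine (sat_checkInner hA (m + 1) k v).mono ?_
      rintro b t₄ ⟨hb, ht₄⟩
      refine ⟨⟨u, v, hlab, fun h => ⟨hinj, k, hk.1, hk.2, hb.1 h⟩, ?_⟩, by omega⟩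
      exact fun _ _ h => hb.2 (h k hk.1 hk.2)
  · rw [sat_op]
    exact ⟨⟨u, v, hlab, by simp, fun h => absurd h hinj⟩, by omega⟩

end Rim

/-! ### Soundness of the labelling -/

section Soundness

variable {N : ℕ} {G : SimpleGraph (Fin N)} {A : Fin N → Fin 3 → Fin N}

/-- In a cubic graph, three different neighbours of a vertex are all its neighbours. -/
theorem eq_of_three_neighbors (hA : IsAdjacencyList G A) {x a b c y : Fin N} (ha : G.Adj x a)
    (hb : G.Adj x b) (hc : G.Adj x c) (hab : a ≠ b) (hac : a ≠ c) (hbc : b ≠ c) (hy : G.Adj x y) :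
    y = a ∨ y = b ∨ y = c := by
  obtain ⟨i, rfl⟩ := ((hA x).2 a).1 ha
  obtain ⟨j, rfl⟩ := ((hA x).2 b).1 hb
  obtain ⟨k, rfl⟩ := ((hA x).2 c).1 hc
  obtain ⟨l, rfl⟩ := ((hA x).2 y).1 hy
  have hij : i ≠ j := fun h => hab (by rw [h])
  have hik : i ≠ k := fun h => hac (by rw [h])
  have hjk : j ≠ k := fun h => hbc (by rw [h])
  have : l = i ∨ l = j ∨ l = k := by omega
  rcases this with rfl | rfl | rfl <;> simp

theorem TwoRegular.eq_of_not_mem (hA : IsAdjacencyList G A) {S : Fin N → Bool}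
    (h : TwoRegular G S) {x y y' : Fin N} (hx : S x = true) (hy : G.Adj x y) (hyS : ¬ S y = true)
    (hy' : G.Adj x y') (hyS' : ¬ S y' = true) : y = y' := by
  obtain ⟨a, b, hab, hnb⟩ := h x hx
  have ha := (hnb a).2 (Or.inl rfl)
  have hb := (hnb b).2 (Or.inr rfl)
  rcases eq_of_three_neighbors hA ha.2 hb.2 hy hab (fun h => hyS (h ▸ ha.1))
    (fun h => hyS (h ▸ hb.1)) hy' with rfl | rfl | rfl
  · exact absurd ha.1 hyS'
  · exact absurd hb.1 hyS'
  · rfl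

/-- A cubic graph has an even number of vertices. -/
theorem two_mul_div_two (hA : IsAdjacencyList G A) : 2 * (N / 2) = N := by
  classical
  have hdeg : ∀ x, G.degree x = 3 := by
    intro x
    have : G.neighborFinset x = Finset.univ.image (A x) := by
      ext y
      simp [(hA x).2]
    rw [← SimpleGraph.card_neighborFinset_eq_degree, this,
      Finset.card_image_of_injective _ (hA x).1]
    simp
  have := G.sum_degrees_eq_twice_card_edges
  simp only [hdeg, Finset.sum_const, Finset.card_univ, Fintype.card_fin, smul_eq_mul] at this
  omega

/-- If `f` maps edges of `G(n, k)` to edges of a cubic graph and is bijective, then it is an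
isomorphism. -/
theorem isGeneralizedPetersen_of_bijective (hA : IsAdjacencyList G A) {n k : ℕ} (hn : 3 ≤ n)
    (hk : 1 ≤ k) (hkn : 2 * k < n) (f : ZMod n ⊕ ZMod n → Fin N) (hf : Function.Bijective f)
    (hadj : ∀ x, ∀ y ∈ neighbors n k x, G.Adj (f x) (f y)) : IsGeneralizedPetersen G := by
  refine ⟨n, k, hn, hk, hkn, ⟨SimpleGraph.Iso.symm ⟨Equiv.ofBijective f hf, ?_⟩⟩⟩
  intro x y
  rw [adj_iff_mem_neighbors hn hk hkn]
  refine ⟨fun h => ?_, fun h => hadj x y h⟩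
  have hnd := nodup_neighbors hn hk hkn x
  have hthree : ∃ a b c, neighbors n k x = [a, b, c] := by
    rcases x with i | i <;> exact ⟨_, _, _, rfl⟩
  obtain ⟨a, b, c, habc⟩ := hthree
  rw [habc] at hnd ⊢
  have hadj := hadj x
  rw [habc] at hadj
  simp only [List.nodup_cons, List.mem_cons, List.not_mem_nil, or_false, not_or, not_false_eq_true,
    List.nodup_nil, and_true] at hnd
  have := eq_of_three_neighbors hA (hadj a (by simp)) (hadj b (by simp)) (hadj c (by simp))
    (hf.1.ne hnd.1.1) (hf.1.ne hnd.1.2) (hf.1.ne hnd.2) h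
  simpa [hf.1.eq_iff] using this

/-- The positions of the neighbours of `u i` on the run `w`. -/
theorem IsLabelling.next_prev {n : ℕ} {w u v : ℕ → Fin N} (h : IsLabelling G n w u v)
    (hw : w n = w 0) {i : ℕ} (hi : i < n) :
    u ((i + (n - 1)) % n) = w (n - 1 - i + 1) ∧
      (u ((i + 1) % n) = w (n - 1 - i - 1) ∨ i = n - 1 ∧ u ((i + 1) % n) = w (n - 1)) := by
  constructor
  · rcases Nat.eq_zero_or_pos i with rfl | hi0
    · rw [zero_add, Nat.mod_eq_of_lt (by omega), h.1 _ (by omega), Nat.sub_self, Nat.sub_zero,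
        Nat.sub_add_cancel (by omega), hw]
    · rw [show i + (n - 1) = i - 1 + n by omega, Nat.add_mod_right, Nat.mod_eq_of_lt (by omega),
        h.1 _ (by omega)]
      congr 1
      omega
  · by_cases hi1 : i + 1 < n
    · left
      rw [Nat.mod_eq_of_lt hi1, h.1 _ hi1]
      congr 1
    · right
      refine ⟨by omega, ?_⟩
      rw [show i + 1 = n by omega, Nat.mod_self, h.1 0 (by omega), Nat.sub_zero]

/-- If the tests of `extendRim` succeed, then the labels `u i` and `v i` are an isomorphism. That
the `v i` are pairwise distinct implies that so are the `u i`: a vertex of `S` has only one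
neighbour outside of `S`. -/
theorem IsLabelling.isGeneralizedPetersen (hA : IsAdjacencyList G A) {n : ℕ} (hN : 2 * n = N)
    {S : Fin N → Bool} (hS : TwoRegular G S) {w u v : ℕ → Fin N} (hw : IsRun G S w)
    (hret : w n = w 0) (h : IsLabelling G n w u v) (hinj : Set.InjOn v {i | i < n}) {k : ℕ}
    (hkn : 2 * k < n) (hk0 : G.Adj (v 0) (v k))
    (hk : ∀ i, 1 ≤ i → i < n → G.Adj (v i) (v ((i + k) % n))) : IsGeneralizedPetersen G := by
  have hkpos : 1 ≤ k := by
    rcases Nat.eq_zero_or_pos k with rfl | h'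
    · exact absurd hk0 (G.loopless.irrefl _)
    · exact h'
  have hn : 3 ≤ n := by omega
  have hn0 : NeZero n := ⟨by omega⟩
  have huS : ∀ i < n, S (u i) = true := fun i hi => by rw [h.1 i hi]; exact hw.mem _
  -- `v i` lies outside of `S`. The property `nbr` of a run shows this for all positions but the
  -- first one, so that the last vertex `u (n - 1) = w 0` needs an extra argument.
  have hvS' : ∀ i < n - 1, ¬ S (v i) = true := by
    intro i hi hS'
    obtain ⟨hprev, hnext⟩ := h.next_prev hret (i := i) (by omega)
    obtain ⟨hadj, h1, h2⟩ := h.2 i (by omega)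
    obtain ⟨j, hj⟩ : ∃ j, n - 1 - i = j + 1 := ⟨n - 1 - i - 1, by omega⟩
    rw [h.1 i (by omega), hj] at hadj
    rw [hj] at hprev hnext
    rcases hnext with hnext | hnext
    · rcases hw.nbr j _ hS' hadj with h' | h'
      · exact h1 (h'.trans hnext.symm)
      · exact h2 (h'.trans hprev.symm)
    · omega
  have hu : ∀ i < n, ∀ j < n, i ≠ j → (¬ S (v i) = true) → (¬ S (v j) = true) → u i ≠ u j := by
    intro i hi j hj hij hvi hvj huij
    refine hij (hinj hi hj (hS.eq_of_not_mem hA (huS i hi) (h.2 i hi).1 hvi ?_ hvj))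
    rw [huij]
    exact (h.2 j hj).1
  have hvS : ∀ i < n, ¬ S (v i) = true := by
    intro i hi hS'
    by_cases hi' : i < n - 1
    · exact hvS' i hi' hS'
    · obtain rfl : i = n - 1 := by omega
      obtain ⟨hadj, h1, h2⟩ := h.2 (n - 1) (by omega)
      obtain ⟨hprev, hnext⟩ := h.next_prev hret (i := n - 1) (by omega)
      have e1 : u ((n - 1 + 1) % n) = u 0 := by
        rw [Nat.sub_add_cancel (by omega), Nat.mod_self]
      have e2 : u ((n - 1 + (n - 1)) % n) = u (n - 2) := by
        rw [show n - 1 + (n - 1) = n - 2 + n by omega, Nat.add_mod_right,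
          Nat.mod_eq_of_lt (by omega)]
      rw [e1] at h1
      rw [e2] at h2
      have hne : u 0 ≠ u (n - 2) :=
        hu 0 (by omega) (n - 2) (by omega) (by omega) (hvS' 0 (by omega)) (hvS' _ (by omega))
      have ew : u (n - 1) = w 0 := by rw [h.1 _ (by omega), Nat.sub_self]
      have a1 : G.Adj (u (n - 1)) (u 0) := by
        rw [ew, h.1 0 (by omega), Nat.sub_zero, ← hret]
        have := hw.adj (n - 1)
        rw [Nat.sub_add_cancel (by omega)] at this
        exact this.symm
      have a2 : G.Adj (u (n - 1)) (u (n - 2)) := by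
        rw [ew, h.1 (n - 2) (by omega), show n - 1 - (n - 2) = 1 by omega]
        exact hw.adj 0
      obtain ⟨y, z, -, hyz⟩ := hS _ (huS (n - 1) (by omega))
      have b1 := (hyz (u 0)).1 ⟨huS 0 (by omega), a1⟩
      have b2 := (hyz (u (n - 2))).1 ⟨huS _ (by omega), a2⟩
      have b3 := (hyz (v (n - 1))).1 ⟨hS', hadj⟩
      grind
  have hui : ∀ i < n, ∀ j < n, u i = u j → i = j := fun i hi j hj hij => by
    by_contra hne
    exact hu i hi j hj hne (hvS i hi) (hvS j hj) hij
  have hstep : ∀ i < n, G.Adj (u i) (u ((i + 1) % n)) := by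
    intro i hi
    rw [h.1 i hi]
    rcases (h.next_prev hret hi).2 with h' | ⟨rfl, h'⟩
    · by_cases hi' : i = n - 1
      · subst hi'
        rw [Nat.sub_add_cancel (by omega), Nat.mod_self, h.1 0 (by omega), Nat.sub_self,
          Nat.sub_zero, ← hret]
        have := hw.adj (n - 1)
        rw [Nat.sub_add_cancel (by omega)] at this
        exact this.symm
      · rw [h']
        have := hw.adj (n - 1 - i - 1)
        rw [Nat.sub_add_cancel (by omega)] at this
        exact this.symm
    · rw [h', Nat.sub_self, ← hret]
      have := hw.adj (n - 1)
      rw [Nat.sub_add_cancel (by omega)] at this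
      exact this.symm
  let f : ZMod n ⊕ ZMod n → Fin N := Sum.elim (fun i => u i.val) (fun i => v i.val)
  have hval : ∀ i : ZMod n, i.val < n := fun i => ZMod.val_lt i
  have hfinj : Function.Injective f := by
    rintro (i | i) (j | j) hij
    · exact congrArg _ (ZMod.val_injective n (hui _ (hval i) _ (hval j) hij))
    · exact absurd (huS _ (hval i)) (by rw [show u i.val = v j.val from hij]; exact hvS _ (hval j))
    · exact absurd (huS _ (hval j))
        (by rw [← show v i.val = u j.val from hij]; exact hvS _ (hval i))
    · exact congrArg _ (ZMod.val_injective n (hinj (hval i) (hval j) hij))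
  have hfbij : Function.Bijective f := by
    refine (Fintype.bijective_iff_injective_and_card f).2 ⟨hfinj, ?_⟩
    rw [Fintype.card_sum, ZMod.card, Fintype.card_fin]
    omega
  have hone : (1 : ZMod n).val = 1 := ZMod.val_one'' (by omega)
  have hkval : (k : ZMod n).val = k := ZMod.val_natCast_of_lt (by omega)
  have houter : ∀ i : ZMod n, G.Adj (f (Sum.inl i)) (f (Sum.inl (i + 1))) := by
    intro i
    have := hstep _ (hval i)
    simpa only [f, Sum.elim_inl, ZMod.val_add, hone] using this
  have hinner : ∀ i : ZMod n, G.Adj (f (Sum.inr i)) (f (Sum.inr (i + k))) := by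
    intro i
    simp only [f, Sum.elim_inr, ZMod.val_add, hkval]
    rcases Nat.eq_zero_or_pos i.val with h0 | h0
    · rw [h0, zero_add, Nat.mod_eq_of_lt (by omega)]
      exact hk0
    · exact hk _ h0 (hval i)
  have hspoke : ∀ i : ZMod n, G.Adj (f (Sum.inl i)) (f (Sum.inr i)) := fun i =>
    (h.2 _ (hval i)).1
  refine isGeneralizedPetersen_of_bijective hA hn hkpos hkn f hfbij ?_
  rintro (i | i) y hy
  · simp only [neighbors, List.mem_cons, List.not_mem_nil, or_false] at hy
    rcases hy with rfl | rfl | rfl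
    · exact houter i
    · have := (houter (i - 1)).symm
      rwa [sub_add_cancel] at this
    · exact hspoke i
  · simp only [neighbors, List.mem_cons, List.not_mem_nil, or_false] at hy
    rcases hy with rfl | rfl | rfl
    · exact hinner i
    · have := (hinner (i - k)).symm
      rwa [sub_add_cancel] at this
    · exact (hspoke i).symm

end Soundness

/-! ### Completeness of the labelling -/

section Circulant

variable {N : ℕ} {G : SimpleGraph (Fin N)} {n : ℕ}

/-- The vertex set `S` is indexed by the integers modulo `n` in such a way that the neighbours of
`ψ i` in `S` are `ψ (i + d)` and `ψ (i - d)`. Both rims of `G(n, k)` have this form. -/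
structure IsCirculant (G : SimpleGraph (Fin N)) (S : Fin N → Bool) (ψ : ZMod n → Fin N)
    (d : ZMod n) : Prop where
  injective : Function.Injective ψ
  mem_iff : ∀ x, S x = true ↔ ∃ i, ψ i = x
  adj_iff : ∀ i j, G.Adj (ψ i) (ψ j) ↔ j = i + d ∨ j = i - d
  add_self_ne : d + d ≠ 0

variable {S : Fin N → Bool} {ψ : ZMod n → Fin N} {d : ZMod n}

theorem IsCirculant.twoRegular (h : IsCirculant G S ψ d) : TwoRegular G S := by
  intro x hx
  obtain ⟨i, rfl⟩ := (h.mem_iff x).1 hx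
  refine ⟨ψ (i + d), ψ (i - d), fun h' => h.add_self_ne ?_, fun w => ⟨?_, ?_⟩⟩
  · have := h.injective h'
    linear_combination this
  · rintro ⟨hw, hadj⟩
    obtain ⟨j, rfl⟩ := (h.mem_iff w).1 hw
    simpa [h.injective.eq_iff] using (h.adj_iff i j).1 hadj
  · rintro (rfl | rfl)
    · exact ⟨(h.mem_iff _).2 ⟨_, rfl⟩, (h.adj_iff _ _).2 (Or.inl rfl)⟩
    · exact ⟨(h.mem_iff _).2 ⟨_, rfl⟩, (h.adj_iff _ _).2 (Or.inr rfl)⟩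

theorem IsCirculant.card [NeZero n] (h : IsCirculant G S ψ d) :
    (Finset.univ.filter fun x => S x = true).card = n := by
  have : (Finset.univ.filter fun x => S x = true) = Finset.univ.image ψ := by
    ext x
    simp [h.mem_iff]
  rw [this, Finset.card_image_of_injective _ h.injective, Finset.card_univ, ZMod.card]

/-- A run in a circulant set is an arithmetic progression. -/
theorem IsCirculant.run_eq (h : IsCirculant G S ψ d) {w : ℕ → Fin N} (hw : IsRun G S w) :
    ∃ c e, (e = d ∨ e = -d) ∧ ∀ i : ℕ, w i = ψ (c + i * e) := by
  obtain ⟨c, hc⟩ := (h.mem_iff _).1 (hw.mem 0)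
  obtain ⟨b, hb⟩ := (h.mem_iff _).1 (hw.mem 1)
  have h01 := hw.adj 0
  rw [← hc, ← hb, h.adj_iff] at h01
  refine ⟨c, b - c, ?_, fun i => ?_⟩
  · rcases h01 with rfl | rfl
    · left; ring
    · right; ring
  · have : ∀ i, w i = ψ (c + i * (b - c)) ∧ w (i + 1) = ψ (c + (i + 1 : ℕ) * (b - c)) := by
      intro i
      induction i with
      | zero => exact ⟨by simp [hc], by simp [hb]⟩
      | succ i ih =>
        refine ⟨ih.2, ?_⟩
        obtain ⟨a, ha⟩ := (h.mem_iff _).1 (hw.mem (i + 2))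
        have hadj := hw.adj (i + 1)
        have hne := hw.ne i
        rw [ih.2, ← ha, h.adj_iff] at hadj
        rw [ih.1, ← ha, Ne, h.injective.eq_iff] at hne
        rw [← ha, h.injective.eq_iff]
        push_cast at hadj hne ⊢
        rcases h01 with h01 | h01 <;> rcases hadj with rfl | rfl
        · rw [h01]; ring
        · exact absurd (by rw [h01]; ring) hne
        · exact absurd (by rw [h01]; ring) hne
        · rw [h01]; ring
    exact (this i).1

end Circulant

section Completeness

variable {N : ℕ} {G : SimpleGraph (Fin N)} {n k : ℕ}

theorem isCirculant_outer (hn : 3 ≤ n) (φ : generalizedPetersen n k ≃g G)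
    {S : Fin N → Bool} (hS : ∀ x, S x = true ↔ ∃ i, φ (Sum.inl i) = x) :
    IsCirculant G S (fun i => φ (Sum.inl i)) 1 :=
  ⟨fun i j h => Sum.inl_injective (φ.injective h), hS,
    fun i j => by rw [φ.map_adj_iff, adj_inl_inl hn],
    by rw [one_add_one_eq_two]; exact two_ne_zero_zmod hn⟩

theorem isCirculant_inner (hk : 1 ≤ k) (hkn : 2 * k < n)
    (φ : generalizedPetersen n k ≃g G)
    {S : Fin N → Bool} (hS : ∀ x, S x = true ↔ ∃ i, φ (Sum.inr i) = x) :
    IsCirculant G S (fun i => φ (Sum.inr i)) k :=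
  ⟨fun i j h => Sum.inr_injective (φ.injective h), hS,
    fun i j => by rw [φ.map_adj_iff, adj_inr_inr hk hkn], two_mul_natCast_ne_zero_zmod hk hkn⟩

theorem IsCirculant.returnsAt {S : Fin N → Bool} {ψ : ZMod n → Fin N}
    (h : IsCirculant G S ψ 1) {w : ℕ → Fin N} (hw : IsRun G S w) : ReturnsAt w n := by
  obtain ⟨c, e, he, hw⟩ := h.run_eq hw
  refine ⟨by simp [hw], fun j hj hjn hj0 => ?_⟩
  rw [hw, hw, h.injective.eq_iff] at hj0
  have : ((j : ℕ) : ZMod n) = 0 := by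
    rcases he with rfl | rfl
    · simpa using hj0
    · simpa using hj0
  rw [ZMod.natCast_eq_zero_iff] at this
  exact absurd (Nat.le_of_dvd hj this) (by omega)

/-- If the inner rim of `G(n, k)` is a cycle of length `n`, then the roles of the two rims can be
interchanged. -/
theorem exists_iso_swap [NeZero n] (hn : 3 ≤ n) (hk : 1 ≤ k) (hkn : 2 * k < n)
    (φ : generalizedPetersen n k ≃g G) {S : Fin N → Bool}
    (hS : ∀ x, S x = true ↔ ∃ i, φ (Sum.inr i) = x) {w : ℕ → Fin N} (hw : IsRun G S w)
    (hret : ReturnsAt w n) : ∃ k', 1 ≤ k' ∧ 2 * k' < n ∧ ∃ φ' : generalizedPetersen n k' ≃g G,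
      ∀ x, S x = true ↔ ∃ i, φ' (Sum.inl i) = x := by
  have hcirc := isCirculant_inner hk hkn φ hS
  obtain ⟨c, e, he, hw⟩ := hcirc.run_eq hw
  -- The run comes back to its first vertex after `j` steps if and only if `j k = 0`, so that `k` is
  -- a unit. Its inverse, up to sign, is the new `k`.
  have hmul : ∀ j : ZMod n, j * k = 0 → j = 0 := by
    intro j hj
    by_contra hj0
    refine hret.2 j.val (Nat.pos_of_ne_zero fun h => hj0 ((ZMod.val_eq_zero j).1 h))
      (ZMod.val_lt j) ?_
    rw [hw, hw, ZMod.natCast_val, ZMod.cast_id', id]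
    rcases he with rfl | rfl
    · simp [hj]
    · simp [hj]
  have hinj : Function.Injective fun j : ZMod n => j * (k : ZMod n) := by
    intro i j hij
    have := hmul (i - j) (by simp only at hij; linear_combination hij)
    exact sub_eq_zero.1 this
  obtain ⟨l, hl⟩ := (Finite.injective_iff_surjective.1 hinj) 1
  simp only at hl
  obtain ⟨k', hk', hkn', hkl⟩ : ∃ k' : ℕ, 1 ≤ k' ∧ 2 * k' < n ∧
      ((k' : ZMod n) = l ∨ (k' : ZMod n) = -l) := by
    have hl0 : l.val ≠ 0 := by
      intro h
      rw [(ZMod.val_eq_zero l).1 h, zero_mul] at hl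
      exact one_ne_zero_zmod hn hl.symm
    have hcast : (l.val : ZMod n) = l := by rw [ZMod.natCast_val, ZMod.cast_id', id]
    have hlt := ZMod.val_lt l
    rcases lt_trichotomy (2 * l.val) n with h | h | h
    · exact ⟨l.val, by omega, h, Or.inl hcast⟩
    · have h2 : ((2 * l.val : ℕ) : ZMod n) = 0 := by rw [h, ZMod.natCast_self]
      push_cast at h2
      rw [hcast] at h2
      refine absurd ?_ (two_ne_zero_zmod hn)
      linear_combination k * h2 - 2 * hl
    · refine ⟨n - l.val, by omega, by omega, Or.inr ?_⟩
      rw [Nat.cast_sub hlt.le, hcast, ZMod.natCast_self, zero_sub]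
  have hunit : ∀ i j : ZMod n, i * k = j * k ↔ i = j := fun i j => hinj.eq_iff
  let m : ZMod n ≃ ZMod n := Equiv.ofBijective _ ⟨hinj, Finite.injective_iff_surjective.1 hinj⟩
  have hm : ∀ i, m i = i * k := fun i => rfl
  let θ : generalizedPetersen n k' ≃g generalizedPetersen n k :=
    ⟨(Equiv.sumCongr m m).trans (Equiv.sumComm _ _), by
      rintro (i | i) (j | j)
      · simp only [Equiv.trans_apply, Equiv.sumCongr_apply, Sum.map_inl, Equiv.sumComm_apply,
          Sum.swap_inl, adj_inr_inr hk hkn, adj_inl_inl hn, hm]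
        rw [show i * k + k = (i + 1) * k by ring, show i * k - k = (i - 1) * k by ring, hunit,
          hunit]
      · simp only [Equiv.trans_apply, Equiv.sumCongr_apply, Sum.map_inl, Sum.map_inr,
          Equiv.sumComm_apply, Sum.swap_inl, Sum.swap_inr, adj_inr_inl, adj_inl_inr, hm, hunit]
      · simp only [Equiv.trans_apply, Equiv.sumCongr_apply, Sum.map_inl, Sum.map_inr,
          Equiv.sumComm_apply, Sum.swap_inl, Sum.swap_inr, adj_inr_inl, adj_inl_inr, hm, hunit]
      · simp only [Equiv.trans_apply, Equiv.sumCongr_apply, Sum.map_inr, Equiv.sumComm_apply,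
          Sum.swap_inr, adj_inr_inr hk' hkn', adj_inl_inl hn, hm]
        have e1 : i * k + 1 = (i + l) * k := by linear_combination -hl
        have e2 : i * k - 1 = (i - l) * k := by linear_combination hl
        rw [e1, e2, hunit, hunit]
        rcases hkl with h | h
        · rw [h]
        · rw [h, sub_neg_eq_add, ← sub_eq_add_neg, or_comm]⟩
  have hθ : ∀ i, θ (Sum.inl i) = Sum.inr (m i) := fun i => rfl
  refine ⟨k', hk', hkn', θ.trans φ, fun x => ?_⟩
  rw [hS]
  simp only [RelIso.trans_apply, hθ]
  constructor
  · rintro ⟨i, rfl⟩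
    exact ⟨m.symm i, by rw [Equiv.apply_symm_apply]⟩
  · rintro ⟨i, rfl⟩
    exact ⟨_, rfl⟩

/-- A labelling whose rim is the outer rim of `G(n, k)` agrees with the labels of `G(n, k)`, up to a
rotation and a reflection. -/
theorem IsLabelling.eq_outer [NeZero n] (hn : 3 ≤ n) (φ : generalizedPetersen n k ≃g G)
    {S : Fin N → Bool} (hS : ∀ x, S x = true ↔ ∃ i, φ (Sum.inl i) = x) {w u v : ℕ → Fin N}
    (hw : IsRun G S w) (h : IsLabelling G n w u v) :
    ∃ a e : ZMod n, (e = 1 ∨ e = -1) ∧ ∀ i < n, v i = φ (Sum.inr (a + i * e)) := by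
  obtain ⟨c, e, he, hw⟩ := (isCirculant_outer hn φ hS).run_eq hw
  have hu : ∀ i < n, u i = φ (Sum.inl (c - e + i * -e)) := by
    intro i hi
    rw [h.1 i hi, hw, Nat.sub_sub, Nat.cast_sub (by omega), ZMod.natCast_self]
    congr 2
    push_cast
    ring
  refine ⟨c - e, -e, by rcases he with rfl | rfl <;> simp, fun i hi => ?_⟩
  obtain ⟨hadj, h1, h2⟩ := h.2 i hi
  rw [hu _ (Nat.mod_lt _ (by omega)), ZMod.natCast_mod] at h1 h2
  rw [hu i hi] at hadj
  obtain ⟨y, hy⟩ := φ.surjective (v i)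
  rw [← hy] at hadj h1 h2 ⊢
  rw [φ.map_adj_iff] at hadj
  rw [Ne, φ.injective.eq_iff] at h1 h2
  rw [φ.injective.eq_iff]
  rw [Nat.cast_add, Nat.cast_sub (by omega), ZMod.natCast_self] at h2
  rcases y with j | j
  · rw [adj_inl_inl hn] at hadj
    rw [Sum.inl.injEq] at h1 h2
    push_cast at h1 h2
    refine absurd hadj (not_or.2 ⟨fun h => ?_, fun h => ?_⟩) <;> rcases he with rfl | rfl
    · exact h2 (by rw [h]; ring)
    · exact h1 (by rw [h]; ring)
    · exact h1 (by rw [h]; ring)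
    · exact h2 (by rw [h]; ring)
  · rw [adj_inl_inr] at hadj
    rw [hadj]

/-- On the outer rim of `G(n, k)` all the tests of `extendRim` succeed, and `k` is the only
candidate for the step of the inner rim. -/
theorem IsLabelling.complete [NeZero n] (hn : 3 ≤ n) (hk : 1 ≤ k) (hkn : 2 * k < n)
    (φ : generalizedPetersen n k ≃g G) {S : Fin N → Bool}
    (hS : ∀ x, S x = true ↔ ∃ i, φ (Sum.inl i) = x) {w u v : ℕ → Fin N} (hw : IsRun G S w)
    (h : IsLabelling G n w u v) :
    Set.InjOn v {i | i < n} ∧ (∃ k, 2 * k < n ∧ G.Adj (v 0) (v k)) ∧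
      ∀ k, 2 * k < n → G.Adj (v 0) (v k) →
        ∀ i, 1 ≤ i → i < n → G.Adj (v i) (v ((i + k) % n)) := by
  obtain ⟨a, e, he, hv⟩ := h.eq_outer hn φ hS hw
  have hee : e * e = 1 := by rcases he with rfl | rfl <;> ring
  have hadj : ∀ i < n, ∀ j < n, G.Adj (v i) (v j) ↔
      (j : ZMod n) = i + k ∨ (j : ZMod n) = i - k := by
    intro i hi j hj
    rw [hv i hi, hv j hj, φ.map_adj_iff, adj_inr_inr hk hkn]
    have h1 : ∀ x y : ZMod n, a + x * e = a + y * e + k ↔ x = y + k * e := fun x y =>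
      ⟨fun h => by linear_combination e * h - (x - y) * hee,
        fun h => by linear_combination e * h + k * hee⟩
    have h2 : ∀ x y : ZMod n, a + x * e = a + y * e - k ↔ x = y - k * e := fun x y =>
      ⟨fun h => by linear_combination e * h - (x - y) * hee,
        fun h => by linear_combination e * h - k * hee⟩
    rw [h1, h2]
    rcases he with rfl | rfl
    · simp
    · simp only [mul_neg, mul_one, sub_neg_eq_add, ← sub_eq_add_neg]
      exact or_comm
  refine ⟨?_, ⟨k, hkn, (hadj _ (by omega) _ (by omega)).2 (Or.inl (by simp))⟩, ?_⟩
  · intro i hi j hj hij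
    rw [hv i hi, hv j hj, φ.injective.eq_iff, Sum.inr.injEq] at hij
    have : (i : ZMod n) = j := by linear_combination e * hij - (i - j) * hee
    rw [ZMod.natCast_eq_natCast_iff'] at this
    rwa [Nat.mod_eq_of_lt hi, Nat.mod_eq_of_lt hj] at this
  · intro k' hk' h0 i _ hi
    have hkk : k' = k := by
      rcases (hadj _ (by omega) _ (by omega)).1 h0 with h' | h'
      · rw [Nat.cast_zero, zero_add, ZMod.natCast_eq_natCast_iff'] at h'
        rwa [Nat.mod_eq_of_lt (by omega), Nat.mod_eq_of_lt (by omega)] at h'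
      · have : ((k' + k : ℕ) : ZMod n) = 0 := by
          push_cast
          rw [h']
          simp
        rw [ZMod.natCast_eq_zero_iff] at this
        exact absurd (Nat.le_of_dvd (by omega) this) (by omega)
    subst hkk
    rw [hadj _ hi _ (Nat.mod_lt _ (by omega))]
    left
    rw [ZMod.natCast_mod]
    push_cast
    ring

end Completeness

/-! ### The procedure `Extend` -/

section Extend

variable {N : ℕ} {G : SimpleGraph (Fin N)} {A : Fin N → Fin 3 → Fin N}

/-- The time and the soundness of `Extend`. -/
theorem sat_extend (hA : IsAdjacencyList G A) (hN0 : 0 < N) {n : ℕ} (hN : 2 * n = N)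
    (U : Fin N → Bool) :
    (extend A n U).Sat fun b t => (b = true → IsGeneralizedPetersen G) ∧ t ≤ 300 * N + 300 := by
  have key : ∀ S : Fin N → Bool, ∀ w, TwoRegular G S → IsRun G S w → ReturnsAt w n →
      (extendRim A n ((List.range n).reverse.map w)).Sat fun b t =>
        (b = true → IsGeneralizedPetersen G) ∧ t ≤ 80 * N + 20 := by
    intro S w hS hw hret
    refine (sat_extendRim hA (by omega) (by omega) w).mono ?_
    rintro b t ⟨⟨u, v, hlab, hb, -⟩, ht⟩
    refine ⟨fun h => ?_, ht⟩
    obtain ⟨hinj, k, hk, hk0, hall⟩ := hb h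
    exact hlab.isGeneralizedPetersen hA hN hS hw hret.1 hinj hk hk0 hall
  have hnone : (do
      let l ← members U
      let c ← count l
      let b ← op (decide (c = n))
      let W ← complement U
      let o ← cyclicOrder A W n
      match o with
      | some rim => if b then extendRim A n rim else op false
      | none => op false : Prog Bool).Sat fun b t =>
        (b = true → IsGeneralizedPetersen G) ∧ t ≤ 200 * N + 200 := by
    rw [sat_bind]
    refine (sat_members U).mono ?_
    rintro l t ⟨⟨-, -, hl⟩, ht⟩
    rw [sat_bind]
    refine (sat_count l).mono ?_
    rintro _ t₁ ⟨rfl, ht₁⟩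
    rw [sat_bind, sat_op, sat_bind]
    refine (sat_complement U).mono ?_
    rintro W t₂ ⟨-, ht₂⟩
    rw [sat_bind]
    refine (sat_cyclicOrder hA W (by omega)).mono ?_
    rintro o t₃ ⟨ho, ht₃⟩
    rcases ho with ⟨hS, -, w, hw, ⟨rfl, -⟩ | ⟨rfl, hret⟩⟩ | ⟨rfl, -⟩
    · rw [sat_op]
      exact ⟨by simp, by omega⟩
    · rw [sat_ite, sat_op]
      exact ⟨fun _ => (key W w hS hw hret).mono fun b t h => ⟨h.1, by have := h.2; omega⟩,
        fun _ => ⟨by simp, by omega⟩⟩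
    · rw [sat_op]
      exact ⟨by simp, by omega⟩
  rw [extend, sat_bind]
  refine (sat_cyclicOrder hA U (by omega)).mono ?_
  rintro o t ⟨ho, ht⟩
  rcases ho with ⟨hS, -, w, hw, ⟨rfl, -⟩ | ⟨rfl, hret⟩⟩ | ⟨rfl, -⟩
  · exact hnone.mono fun b t h => ⟨h.1, by have := h.2; omega⟩
  · exact (key U w hS hw hret).mono fun b t h => ⟨h.1, by have := h.2; omega⟩
  · exact hnone.mono fun b t h => ⟨h.1, by have := h.2; omega⟩

/-- The completeness of `Extend`: the answer is `true` for either rim of `G(n, k)`. -/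
theorem sat_extend_of_rim (hA : IsAdjacencyList G A) {n k : ℕ} (hn : 3 ≤ n) (hk : 1 ≤ k)
    (hkn : 2 * k < n) (φ : generalizedPetersen n k ≃g G) (hN : 2 * n = N) (U : Fin N → Bool)
    (hU : (∀ x, U x = true ↔ ∃ i, φ (Sum.inl i) = x) ∨
      (∀ x, U x = true ↔ ∃ i, φ (Sum.inr i) = x)) :
    (extend A n U).Sat fun b _ => b = true := by
  have hn0 : NeZero n := ⟨by omega⟩
  have key : ∀ S : Fin N → Bool, ∀ w, IsRun G S w → ∀ k', 1 ≤ k' → 2 * k' < n →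
      ∀ φ' : generalizedPetersen n k' ≃g G, (∀ x, S x = true ↔ ∃ i, φ' (Sum.inl i) = x) →
      (extendRim A n ((List.range n).reverse.map w)).Sat fun b _ => b = true := by
    intro S w hw k' hk' hkn' φ' hS
    refine (sat_extendRim hA (by omega) (by omega) w).mono ?_
    rintro b t ⟨⟨u, v, hlab, -, hb⟩, -⟩
    obtain ⟨h1, h2, h3⟩ := hlab.complete hn hk' hkn' φ' hS hw
    exact hb h1 h2 h3
  rw [extend, sat_bind]
  refine (sat_cyclicOrder hA U (by omega)).mono ?_
  rintro o t ⟨ho, -⟩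
  rcases hU with hU | hU
  · have hcirc := isCirculant_outer hn φ hU
    rcases ho with ⟨-, -, w, hw, ⟨rfl, hret⟩ | ⟨rfl, -⟩⟩ | ⟨rfl, hcard⟩
    · exact absurd (hcirc.returnsAt hw) hret
    · exact key U w hw k hk hkn φ hU
    · exact absurd ⟨hcirc.twoRegular, hcirc.card, by omega⟩ hcard
  · have hcirc := isCirculant_inner hk hkn φ hU
    rcases ho with ⟨-, -, w, hw, ⟨rfl, -⟩ | ⟨rfl, hret⟩⟩ | ⟨rfl, hcard⟩
    · simp only [sat_bind]
      refine (sat_members U).mono ?_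
      rintro l t ⟨⟨hnd, hl, -⟩, -⟩
      have hlen : l.length = n := by
        rw [← hcirc.card, ← List.toFinset_card_of_nodup hnd]
        congr 1
        ext x
        simp [hl]
      refine (sat_count l).mono ?_
      rintro _ t₁ ⟨rfl, -⟩
      rw [sat_op]
      refine (sat_complement U).mono ?_
      rintro _ t₂ ⟨rfl, -⟩
      -- The complement of the inner rim is the outer rim.
      have hW : ∀ x, (!U x) = true ↔ ∃ i, φ (Sum.inl i) = x := by
        intro x
        rw [Bool.not_eq_true', ← Bool.not_eq_true, hU]
        obtain ⟨y, rfl⟩ := φ.surjective x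
        rcases y with i | i <;> simp
      have hcirc' := isCirculant_outer (S := fun x => !U x) hn φ hW
      refine (sat_cyclicOrder hA (fun x => !U x) (by omega)).mono ?_
      rintro o t₃ ⟨ho, -⟩
      rcases ho with ⟨-, -, w, hw, ⟨rfl, hret⟩ | ⟨rfl, -⟩⟩ | ⟨rfl, hcard⟩
      · exact absurd (hcirc'.returnsAt hw) hret
      · rw [sat_ite]
        exact ⟨fun _ => key _ w hw k hk hkn φ hW, fun h => absurd hlen (by simpa using h)⟩
      · exact absurd ⟨hcirc'.twoRegular, hcirc'.card, by omega⟩ hcard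
    · obtain ⟨k', hk', hkn', φ', hφ'⟩ := exists_iso_swap hn hk hkn φ hU hw hret
      exact key U w hw k' hk' hkn' φ' hφ'
    · exact absurd ⟨hcirc.twoRegular, hcirc.card, by omega⟩ hcard

end Extend

/-! ### Subgraphs formed by sets of edges -/

section Degrees

variable {N : ℕ} {G : SimpleGraph (Fin N)} {A : Fin N → Fin 3 → Fin N}

/-- The degree of `x` is given as the number of the vertices `w` such that `x w` is an edge in `U`.
-/
theorem sat_degrees {U : List (Edge N)} (hU : U.Nodup) (hlt : ∀ e ∈ U, e.1 < e.2) :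
    (degrees U).Sat fun deg t => (∀ x, ∃ l : List (Fin N), l.Nodup ∧
      (∀ w, w ∈ l ↔ edgeOf x w ∈ U) ∧ deg x = l.length) ∧ t ≤ N + 10 * U.length + 2 := by
  refine (Sat.bind_le (sat_alloc N 0) (R := fun deg => ∀ x, ∃ l : List (Fin N), l.Nodup ∧
      (∀ w, w ∈ l ↔ edgeOf x w ∈ U) ∧ deg x = l.length) (T' := 10 * U.length + 1) ?_).mono
    fun _ t h => ⟨h.1, by omega⟩
  rintro _ rfl
  refine sat_forEach (fun pre (deg : Fin N → ℕ) => ∀ x, ∃ l : List (Fin N), l.Nodup ∧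
      (∀ w, w ∈ l ↔ edgeOf x w ∈ pre) ∧ deg x = l.length) 9
    (fun x => ⟨[], by simp⟩) ?_
  rintro pre e post hl deg hdeg
  have he : e.1 < e.2 := hlt e (by simp [hl])
  have hpre : e ∉ pre := by
    rw [hl, List.nodup_append] at hU
    exact fun h => hU.2.2 e h e (by simp) rfl
  simp only [sat_forEach_cons, sat_forEach_nil, sat_bind, sat_op]
  refine ⟨fun x => ?_, by omega⟩
  obtain ⟨l, hnd, hmem, hlen⟩ := hdeg x
  have hext : ∀ w, edgeOf x w ∈ pre ++ [e] ↔ edgeOf x w ∈ pre ∨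
      ((e.1 = x ∧ e.2 = w) ∨ (e.1 = w ∧ e.2 = x)) := fun w => by
    rw [List.mem_append, List.mem_singleton, edgeOf_eq_iff he]
  have hnot : ∀ w, ((e.1 = x ∧ e.2 = w) ∨ (e.1 = w ∧ e.2 = x)) → w ∉ l := by
    intro w h
    rw [hmem, (edgeOf_eq_iff he).2 h]
    exact hpre
  by_cases h1 : x = e.1
  · subst h1
    refine ⟨e.2 :: l, List.nodup_cons.2 ⟨hnot _ (Or.inl ⟨rfl, rfl⟩), hnd⟩, fun w => ?_, ?_⟩
    · rw [hext, List.mem_cons, hmem]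
      have := he.ne'
      grind
    · rw [Function.update_of_ne he.ne, Function.update_self, hlen, List.length_cons]
  · by_cases h2 : x = e.2
    · subst h2
      refine ⟨e.1 :: l, List.nodup_cons.2 ⟨hnot _ (Or.inr ⟨rfl, rfl⟩), hnd⟩, fun w => ?_, ?_⟩
      · rw [hext, List.mem_cons, hmem]
        grind
      · rw [Function.update_self, Function.update_of_ne he.ne', hlen, List.length_cons]
    · refine ⟨l, hnd, fun w => ?_, ?_⟩
      · rw [hext, hmem]
        grind
      · rw [Function.update_of_ne h2, Function.update_of_ne h1, hlen]

/-- If `U` is not a matching, then `mate x` is one of the neighbours of `x` along edges in `U`. -/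
theorem sat_partners {U : List (Edge N)} (hlt : ∀ e ∈ U, e.1 < e.2) :
    (partners U).Sat fun mate t => (∀ x, (∀ w, mate x = some w → edgeOf x w ∈ U) ∧
      (mate x = none → ∀ w, edgeOf x w ∉ U)) ∧ t ≤ N + 3 * U.length + 2 := by
  refine (Sat.bind_le (sat_alloc N none) (R := fun mate : Fin N → Option (Fin N) =>
    ∀ x, (∀ w, mate x = some w → edgeOf x w ∈ U) ∧ (mate x = none → ∀ w, edgeOf x w ∉ U))
    (T' := 3 * U.length + 1) ?_).mono fun _ t h => ⟨h.1, by omega⟩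
  rintro _ rfl
  refine sat_forEach (fun pre (mate : Fin N → Option (Fin N)) =>
    ∀ x, (∀ w, mate x = some w → edgeOf x w ∈ pre) ∧ (mate x = none → ∀ w, edgeOf x w ∉ pre)) 2
    (by simp) ?_
  rintro pre e post hl mate hmate
  have he : e.1 < e.2 := hlt e (by simp [hl])
  have hext : ∀ x w, edgeOf x w ∈ pre ++ [e] ↔ edgeOf x w ∈ pre ∨
      ((e.1 = x ∧ e.2 = w) ∨ (e.1 = w ∧ e.2 = x)) := fun x w => by
    rw [List.mem_append, List.mem_singleton, edgeOf_eq_iff he]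
  simp only [sat_bind, sat_op]
  refine ⟨fun x => ?_, by omega⟩
  by_cases h2 : x = e.2
  · subst h2
    simp only [Function.update_self, Option.some.injEq, reduceCtorEq, false_imp_iff, and_true]
    rintro w rfl
    rw [hext]
    simp
  · rw [Function.update_of_ne h2]
    by_cases h1 : x = e.1
    · subst h1
      simp only [Function.update_self, Option.some.injEq, reduceCtorEq, false_imp_iff, and_true]
      rintro w rfl
      rw [hext]
      simp
    · rw [Function.update_of_ne h1]
      refine ⟨fun w hw => (hext x w).2 (Or.inl ((hmate x).1 w hw)), fun h w => ?_⟩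
      rw [hext, not_or]
      refine ⟨(hmate x).2 h w, ?_⟩
      rintro (h' | h')
      · exact h1 h'.1.symm
      · exact h2 h'.2.symm

theorem sat_toSet (l : List (Fin N)) : (toSet l).Sat fun S t => (∀ x, S x = true ↔ x ∈ l) ∧
    t ≤ N + 2 * l.length + 2 := by
  refine (Sat.bind_le (sat_alloc N false) (R := fun S : Fin N → Bool => ∀ x, S x = true ↔ x ∈ l)
    (T' := 2 * l.length + 1) ?_).mono fun _ t h => ⟨h.1, by omega⟩
  rintro _ rfl
  refine sat_forEach (fun pre (S : Fin N → Bool) => ∀ x, S x = true ↔ x ∈ pre) 1 (by simp) ?_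
  rintro pre y post - S hS
  rw [sat_op]
  refine ⟨fun x => ?_, le_rfl⟩
  by_cases hx : x = y
  · simp [hx]
  · simp [hx, hS]

end Degrees

/-! ### Depth first search -/

section Search

variable {N : ℕ} {G : SimpleGraph (Fin N)} {A : Fin N → Fin 3 → Fin N}

/-- Adjacency in `G` minus the matching given by `mate`. -/
def RestAdj (G : SimpleGraph (Fin N)) (mate : Fin N → Option (Fin N)) (x w : Fin N) : Prop :=
  G.Adj x w ∧ mate x ≠ some w

/-- The number of vertices that have not been seen. -/
def unseen (seen : Fin N → Bool) : ℕ := (Finset.univ.filter fun x => ¬ seen x = true).card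

theorem unseen_update {seen : Fin N → Bool} {x : Fin N} (hx : ¬ seen x = true) :
    unseen (Function.update seen x true) + 1 = unseen seen := by
  have h : (Finset.univ.filter fun y => ¬ Function.update seen x true y = true) =
      (Finset.univ.filter fun y => ¬ seen y = true).erase x := by
    ext y
    by_cases hy : y = x
    · simp [hy]
    · simp [hy]
  rw [unseen, h, Finset.card_erase_add_one (by simpa using hx), unseen]

/-- The effect of a depth first search: `new` is the list of the vertices that are found. The time
is linear in the length of the stack and of `new`, each member of which puts at most three vertices
on the stack. -/
theorem sat_search (hA : IsAdjacencyList G A) (mate : Fin N → Option (Fin N)) (fuel : ℕ)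
    (todo : List (Fin N)) (seen : Fin N → Bool) (comp : List (Fin N)) (size : ℕ)
    (hfuel : todo.length + 3 * unseen seen ≤ fuel) :
    (search A mate fuel todo seen comp size).Sat fun r t => ∃ new : List (Fin N),
      r.2.1 = new ++ comp ∧ r.2.2 = size + new.length ∧ new.Nodup ∧ (∀ x ∈ new, ¬ seen x = true) ∧
      (∀ x, r.1 x = true ↔ seen x = true ∨ x ∈ new) ∧ (∀ x ∈ todo, r.1 x = true) ∧
      (∀ x ∈ new, ∀ w, RestAdj G mate x w → r.1 w = true) ∧
      (∀ x ∈ new, ∃ y ∈ todo, Relation.ReflTransGen (RestAdj G mate) y x) ∧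
      unseen r.1 + new.length = unseen seen ∧ t ≤ todo.length + 21 * new.length + 1 := by
  induction fuel generalizing todo seen comp size with
  | zero =>
    have : todo = [] := List.eq_nil_of_length_eq_zero (by omega)
    subst this
    rw [search, sat_op]
    exact ⟨[], by simp⟩
  | succ fuel ih =>
    cases todo with
    | nil =>
      rw [search, sat_op]
      exact ⟨[], by simp⟩
    | cons x todo =>
      rw [List.length_cons] at hfuel
      rw [search, sat_bind, sat_op, sat_ite]
      refine ⟨fun hx => ?_, fun hx => ?_⟩
      · refine (ih todo seen comp size (by omega)).mono ?_
        rintro ⟨seen', comp', size'⟩ t ⟨new, h1, h2, h3, h4, h5, h6, h7, h8, h9, h10⟩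
        refine ⟨new, h1, h2, h3, h4, h5, ?_, h7, ?_, h9, ?_⟩
        · intro y hy
          rcases List.mem_cons.1 hy with rfl | hy
          · exact (h5 _).2 (Or.inl hx)
          · exact h6 y hy
        · intro y hy
          obtain ⟨z, hz, h⟩ := h8 y hy
          exact ⟨z, List.mem_cons_of_mem _ hz, h⟩
        · rw [List.length_cons]
          omega
      · simp only [sat_bind, sat_op]
        have hun := unseen_update hx
        refine (sat_forEach (fun js (todo' : List (Fin N)) => (∃ l, todo' = l ++ todo ∧
          (∀ w ∈ l, RestAdj G mate x w) ∧ l.length ≤ js.length) ∧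
          ∀ j ∈ js, mate x ≠ some (A x j) → A x j ∈ todo') 3 ⟨⟨[], by simp⟩, by simp⟩ ?_).mono ?_
        · rintro js j js' - _ ⟨⟨l, rfl, hl, hlen⟩, hjs⟩
          simp only [sat_bind, sat_op, sat_ite, sat_pure, decide_eq_true_eq]
          refine ⟨fun h => ⟨⟨⟨l, rfl, hl, by simp; omega⟩, ?_⟩, by omega⟩,
            fun h => ⟨⟨⟨A x j :: l, rfl, ?_, by simpa using hlen⟩, ?_⟩, by omega⟩⟩
          · intro i hi hm
            rcases List.mem_append.1 hi with hi | hi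
            · exact hjs i hi hm
            · rw [List.mem_singleton.1 hi] at hm
              exact absurd h hm
          · intro w hw
            rcases List.mem_cons.1 hw with rfl | hw
            · exact ⟨((hA x).2 _).2 ⟨j, rfl⟩, h⟩
            · exact hl w hw
          · intro i hi hm
            rcases List.mem_append.1 hi with hi | hi
            · exact List.mem_cons_of_mem _ (hjs i hi hm)
            · rw [List.mem_singleton.1 hi]
              exact List.mem_cons_self
        · rintro _ t ⟨⟨⟨l, rfl, hl, hlen⟩, hjs⟩, ht⟩
          simp only [List.length_cons, List.length_nil] at hlen ht
          refine (ih (l ++ todo) _ (x :: comp) (size + 1)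
            (by rw [List.length_append]; omega)).mono ?_
          rintro ⟨seen', comp', size'⟩ t ⟨new, h1, h2, h3, h4, h5, h6, h7, h8, h9, h10⟩
          simp only at h1 h2 h5 h6 h7 h9
          have hxnew : x ∉ new := fun h => h4 x h (by simp)
          have hseen' : ∀ y, seen' y = true ↔ seen y = true ∨ y ∈ new ++ [x] := by
            intro y
            rw [h5]
            by_cases hy : y = x
            · simp [hy]
            · simp [hy]
          refine ⟨new ++ [x], by simp [h1], by simp [h2]; omega, ?_, ?_, hseen', ?_, ?_, ?_, ?_, ?_⟩
          · exact h3.append (List.nodup_singleton _) (by simpa using hxnew)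
          · intro y hy
            rcases List.mem_append.1 hy with hy | hy
            · have := h4 y hy
              have hyx : y ≠ x := fun h => hxnew (h ▸ hy)
              rwa [Function.update_of_ne hyx] at this
            · rwa [List.mem_singleton.1 hy]
          · intro y hy
            rcases List.mem_cons.1 hy with rfl | hy
            · exact (hseen' _).2 (Or.inr (by simp))
            · exact h6 y (List.mem_append_right _ hy)
          · intro y hy w hw
            rcases List.mem_append.1 hy with hy | hy
            · exact h7 y hy w hw
            · rw [List.mem_singleton.1 hy] at hw
              obtain ⟨j, rfl⟩ := ((hA x).2 w).1 hw.1
              exact h6 _ (hjs j (by fin_cases j <;> simp) hw.2)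
          · intro y hy
            rcases List.mem_append.1 hy with hy | hy
            · obtain ⟨z, hz, h⟩ := h8 y hy
              rcases List.mem_append.1 hz with hz | hz
              · exact ⟨x, List.mem_cons_self, Relation.ReflTransGen.head (hl z hz) h⟩
              · exact ⟨z, List.mem_cons_of_mem _ hz, h⟩
            · rw [List.mem_singleton.1 hy]
              exact ⟨x, List.mem_cons_self, .refl⟩
          · simp only [List.length_append, List.length_singleton]
            omega
          · simp only [List.length_append, List.length_cons, List.length_nil] at h10 ⊢
            omega

theorem unseen_le (seen : Fin N → Bool) : unseen seen ≤ N :=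
  (Finset.card_le_univ _).trans (by simp)

/-- `c` lists vertices that can be reached from one of them, with their number. If adjacency is
symmetric, then no edge leaves the list, so that it is a component. -/
structure IsComponent (G : SimpleGraph (Fin N)) (mate : Fin N → Option (Fin N))
    (c : List (Fin N) × ℕ) : Prop where
  nodup : c.1.Nodup
  size : c.2 = c.1.length
  reach : ∃ x, ∀ y ∈ c.1, Relation.ReflTransGen (RestAdj G mate) x y
  closed : (∀ x w, RestAdj G mate x w → RestAdj G mate w x) →
    ∀ x ∈ c.1, ∀ w, RestAdj G mate x w → w ∈ c.1

theorem sat_components (hA : IsAdjacencyList G A) (mate : Fin N → Option (Fin N)) :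
    (components A mate).Sat fun cs t => ((∀ c ∈ cs, IsComponent G mate c) ∧
      (∀ x, ∃ c ∈ cs, x ∈ c.1) ∧ cs.length ≤ N) ∧ t ≤ 30 * N + 3 := by
  rw [components, sat_bind]
  refine (sat_alloc N false).mono ?_
  rintro _ t₀ ⟨rfl, ht₀⟩
  have h0 : unseen (fun _ : Fin N => false) = N := by simp [unseen]
  rw [sat_bind]
  -- The unseen vertices pay for the searches.
  refine (sat_forEach_time (fun pre (s : (Fin N → Bool) × List (List (Fin N) × ℕ)) t =>
    (∀ c ∈ s.2, IsComponent G mate c) ∧ (∀ x, s.1 x = true ↔ ∃ c ∈ s.2, x ∈ c.1) ∧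
    (∀ x ∈ pre, s.1 x = true) ∧ (∀ x, s.1 x = true → ∀ w, RestAdj G mate x w → s.1 w = true) ∧
    s.2.length ≤ pre.length ∧ t + 21 * unseen s.1 ≤ 5 * pre.length + 21 * N + 1)
    (c := 1) ⟨by simp, by simp, by simp, by simp, by simp, by rw [h0]; simp; omega⟩ ?_).mono ?_
  · rintro pre x post - ⟨seen, cs⟩ t ⟨hcs, hseen, hpre, hclosed, hlen, ht⟩
    simp only at hcs hseen hpre hclosed hlen ht
    simp only [sat_bind, sat_op, sat_ite, sat_pure, List.length_append, List.length_singleton]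
    refine ⟨fun hx => ⟨hcs, hseen, ?_, hclosed, by omega, by omega⟩, fun hx => ?_⟩
    · intro y hy
      rcases List.mem_append.1 hy with hy | hy
      · exact hpre y hy
      · rwa [List.mem_singleton.1 hy]
    · refine (sat_search hA mate (3 * N + 1) [x] seen [] 0 ?_).mono ?_
      · have := unseen_le seen
        simp only [List.length_singleton]
        omega
      · rintro ⟨seen', comp', size'⟩ t' ⟨new, h1, h2, h3, h4, h5, h6, h7, h8, h9, h10⟩
        simp only [List.append_nil, zero_add, List.length_singleton] at h1 h2 h5 h6 h7 h9 h10
        subst h1 h2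
        refine ⟨?_, ?_, ?_, ?_, by simpa using hlen, ?_⟩
        · intro c hc
          rcases List.mem_cons.1 hc with rfl | hc
          · refine ⟨h3, rfl, ⟨x, fun y hy => ?_⟩, fun hsymm y hy w hw => ?_⟩
            · obtain ⟨z, hz, h⟩ := h8 y hy
              rwa [List.mem_singleton.1 hz] at h
            · refine ((h5 w).1 (h7 y hy w hw)).resolve_left fun h => ?_
              exact h4 y hy (hclosed w h y (hsymm _ _ hw))
          · exact hcs c hc
        · intro y
          rw [h5, hseen]
          simp [or_comm]
        · intro y hy
          rcases List.mem_append.1 hy with hy | hy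
          · exact (h5 y).2 (Or.inl (hpre y hy))
          · rw [List.mem_singleton.1 hy]
            exact h6 x (by simp)
        · intro y hy w hw
          rcases (h5 y).1 hy with hy | hy
          · exact (h5 w).2 (Or.inl (hclosed y hy w hw))
          · exact h7 y hy w hw
        · dsimp only
          omega
  · rintro ⟨seen, cs⟩ t ⟨hcs, hseen, hall, -, hlen, ht⟩
    simp only [List.mem_finRange, true_imp_iff, List.length_finRange] at hcs hseen hall hlen ht
    rw [sat_pure]
    exact ⟨⟨hcs, fun x => (hseen x).1 (hall x), hlen⟩, by omega⟩

end Search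

/-! ### The two cases of `Main` -/

section Cases

variable {N : ℕ} {G : SimpleGraph (Fin N)} {A : Fin N → Fin 3 → Fin N}

/-- The time and the soundness of `Main` in the first case. -/
theorem sat_mainMatching (hA : IsAdjacencyList G A) (hN0 : 0 < N) {n : ℕ} (hN : 2 * n = N)
    {U : List (Edge N)} (hlt : ∀ e ∈ U, e.1 < e.2) (hU : U.length ≤ N) :
    (mainMatching A n U).Sat fun b t =>
      (b = true → IsGeneralizedPetersen G) ∧ t ≤ 400 * N + 400 := by
  rw [mainMatching, sat_bind]
  refine (sat_partners hlt).mono ?_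
  rintro mate t₁ ⟨-, ht₁⟩
  rw [sat_bind]
  refine (sat_components hA mate).mono ?_
  rintro cs t₂ ⟨⟨hcs, -, hlen⟩, ht₂⟩
  rw [sat_bind]
  refine (sat_maximalMembers _ _).mono ?_
  rintro ms t₃ ⟨⟨hms, -, hml⟩, ht₃⟩
  match ms, hms, hml with
  | [], _, _ =>
    simp only [sat_op]
    exact ⟨by simp, by omega⟩
  | c :: ms, hms, hml =>
    simp only
    rw [List.length_cons] at hml
    rw [sat_bind]
    refine (sat_pick c ms).mono ?_
    rintro c' t₄ ⟨hc', ht₄⟩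
    have hnd := (hcs c' (hms c' hc').1).nodup
    have hcl : c'.1.length ≤ N := by simpa using hnd.length_le_card
    rw [sat_bind]
    refine (sat_toSet c'.1).mono ?_
    rintro S t₅ ⟨-, ht₅⟩
    rw [sat_bind]
    refine (sat_isTwoRegular hA S).mono ?_
    rintro b t₆ ⟨-, ht₆⟩
    rw [sat_ite, sat_op]
    refine ⟨fun _ => (sat_extend hA hN0 hN S).mono ?_, fun _ => ⟨by simp, by omega⟩⟩
    rintro b t ⟨h, ht⟩
    exact ⟨h, by omega⟩

/-- The rule for `mainRegular`, which finds the set `S` of the vertices of positive degree and tests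
whether all their degrees are `2`. -/
theorem sat_mainRegular_of_extend {n : ℕ} {deg : Fin N → ℕ} {Q : Bool → ℕ → Prop}
    (htrue : ∀ S : Fin N → Bool, (∀ x, S x = true ↔ deg x ≠ 0) →
      (∀ x, deg x = 0 ∨ deg x = 2) →
        (extend A n S).Sat fun b t => ∀ t' ≤ t + 7 * N + 2, Q b t')
    (hfalse : (¬ ∀ x, deg x = 0 ∨ deg x = 2) → ∀ t ≤ 7 * N + 3, Q false t) :
    (mainRegular A n deg).Sat Q := by
  rw [mainRegular, sat_bind]
  refine (sat_alloc N false).mono ?_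
  rintro _ t₀ ⟨rfl, ht₀⟩
  rw [sat_bind]
  refine (sat_forEach (fun pre (s : (Fin N → Bool) × Bool) =>
    (∀ x, s.1 x = true ↔ x ∈ pre ∧ deg x ≠ 0) ∧
    (s.2 = true ↔ ∀ x ∈ pre, deg x = 0 ∨ deg x = 2)) 5 (by simp) ?_).mono ?_
  · rintro pre x post - ⟨S, ok⟩ ⟨hS, hok⟩
    simp only at hS hok
    simp only [sat_bind, sat_op, sat_ite, sat_pure, decide_eq_true_eq, Bool.and_eq_true,
      List.mem_append, List.mem_singleton, hok]
    refine ⟨fun h => ⟨⟨fun y => ?_, ?_⟩, by omega⟩, fun h => ⟨⟨fun y => ?_, ?_⟩, by omega⟩⟩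
    · rw [hS]
      grind
    · grind
    · by_cases hy : y = x
      · subst hy
        simp [h]
      · simp [hy, hS]
    · grind
  · rintro ⟨S, ok⟩ t ⟨⟨hS, hok⟩, ht⟩
    simp only [List.mem_finRange, true_and, true_imp_iff, List.length_finRange] at hS hok ht
    simp only [sat_ite, sat_op, hok]
    exact ⟨fun h => (htrue S hS h).mono fun b s hb => hb _ (by omega),
      fun h => hfalse h _ (by omega)⟩

/-- The time and the soundness of `Main` in the second case. -/
theorem sat_mainRegular (hA : IsAdjacencyList G A) (hN0 : 0 < N) {n : ℕ} (hN : 2 * n = N)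
    (deg : Fin N → ℕ) : (mainRegular A n deg).Sat fun b t =>
      (b = true → IsGeneralizedPetersen G) ∧ t ≤ 400 * N + 400 :=
  sat_mainRegular_of_extend (fun S _ _ => (sat_extend hA hN0 hN S).mono
    fun _ t h t' ht' => ⟨h.1, by omega⟩) fun _ t ht => ⟨by simp, by omega⟩

theorem sat_maxDegree (deg : Fin N → ℕ) :
    (forEach (List.finRange N) 0 fun x m => do
      let d ← op (deg x)
      let b ← op (decide (m < d))
      if b then op d else pure m).Sat fun m t => ((∀ x, deg x ≤ m) ∧
        (m = 0 ∨ ∃ x, deg x = m)) ∧ t ≤ 4 * N + 1 := by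
  refine (sat_forEach (fun pre m => (∀ x ∈ pre, deg x ≤ m) ∧ (m = 0 ∨ ∃ x, deg x = m)) 3
    (by simp) ?_).mono ?_
  · rintro pre x post - m ⟨hle, hm⟩
    simp only [sat_bind, sat_op, sat_ite, sat_pure, decide_eq_true_eq, List.mem_append,
      List.mem_singleton]
    refine ⟨fun h => ⟨⟨?_, Or.inr ⟨x, rfl⟩⟩, by omega⟩, fun h => ⟨⟨?_, hm⟩, by omega⟩⟩
    · rintro y (hy | rfl)
      · exact (hle y hy).trans h.le
      · exact le_rfl
    · rintro y (hy | rfl)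
      · exact hle y hy
      · omega
  · rintro m t ⟨⟨h, h'⟩, ht⟩
    rw [List.length_finRange] at ht
    exact ⟨⟨fun x => h x (List.mem_finRange x), h'⟩, by omega⟩

end Cases

/-! ### The algorithm on generalized Petersen graphs -/

section Complete

variable {N : ℕ} {G : SimpleGraph (Fin N)} {A : Fin N → Fin 3 → Fin N} {n k : ℕ}

theorem edgeOf_eq_edgeOf_iff {x y z w : Fin N} :
    edgeOf x y = edgeOf z w ↔ (x = z ∧ y = w) ∨ (x = w ∧ y = z) := by
  unfold edgeOf
  grind

/-- The edges of `G(n, k)` come in three families: outer edges, spokes, and inner edges. -/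
def family (n k : ℕ) (s : Fin 3) (i : ZMod n) : (ZMod n ⊕ ZMod n) × (ZMod n ⊕ ZMod n) :=
  match s with
  | 0 => (Sum.inl i, Sum.inl (i + 1))
  | 1 => (Sum.inl i, Sum.inr i)
  | 2 => (Sum.inr i, Sum.inr (i + k))

/-- The stored forms of the edges in the families, for a copy of `G(n, k)`. -/
def familyEdge (φ : generalizedPetersen n k ≃g G) (s : Fin 3) (i : ZMod n) : Edge N :=
  edgeOf (φ (family n k s i).1) (φ (family n k s i).2)

theorem adj_iff_family (hn : 3 ≤ n) (hk : 1 ≤ k) (hkn : 2 * k < n) {x y : ZMod n ⊕ ZMod n} :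
    (generalizedPetersen n k).Adj x y ↔
      ∃ s i, (x, y) = family n k s i ∨ (y, x) = family n k s i := by
  rcases x with x | x <;> rcases y with y | y <;>
    simp [Fin.exists_fin_succ, family, adj_inl_inl hn, adj_inr_inr hk hkn, adj_inl_inr, adj_inr_inl,
      exists_or, eq_sub_iff_add_eq, eq_comm]

theorem familyEdge_injective (hn : 3 ≤ n) (hk : 1 ≤ k) (hkn : 2 * k < n)
    (φ : generalizedPetersen n k ≃g G) :
    Function.Injective fun p : Fin 3 × ZMod n => familyEdge φ p.1 p.2 := by
  have h2 := two_ne_zero_zmod hn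
  have h3 := two_mul_natCast_ne_zero_zmod hk hkn
  rintro ⟨s, i⟩ ⟨s', j⟩ h
  simp only [familyEdge, edgeOf_eq_edgeOf_iff, φ.injective.eq_iff] at h
  fin_cases s <;> fin_cases s' <;> simp [family] at h ⊢
  · rcases h with h | ⟨rfl, h⟩
    · exact h
    · exact absurd (by linear_combination h) h2
  · exact h
  · rcases h with h | ⟨rfl, h⟩
    · exact h
    · exact absurd (by linear_combination h) h3

theorem isEdge_iff_familyEdge (hn : 3 ≤ n) (hk : 1 ≤ k) (hkn : 2 * k < n)
    (φ : generalizedPetersen n k ≃g G) (e : Edge N) :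
    IsEdge G e ↔ ∃ s i, familyEdge φ s i = e := by
  constructor
  · intro h
    obtain ⟨x, hx⟩ := φ.surjective e.1
    obtain ⟨y, hy⟩ := φ.surjective e.2
    have hxy := h.2
    rw [← hx, ← hy, φ.map_adj_iff, adj_iff_family hn hk hkn] at hxy
    obtain ⟨s, i, h' | h'⟩ := hxy
    · exact ⟨s, i, by rw [familyEdge, ← h', hx, hy, h.edgeOf_eq]⟩
    · exact ⟨s, i, by rw [familyEdge, ← h', hx, hy, edgeOf_comm, h.edgeOf_eq]⟩
  · rintro ⟨s, i, rfl⟩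
    exact isEdge_edgeOf (φ.map_adj_iff.2 ((adj_iff_family hn hk hkn).2 ⟨s, i, Or.inl rfl⟩))

/-- The value of `σ` on a family of edges. -/
noncomputable def familyCount (n k : ℕ) (s : Fin 3) : ℕ :=
  octagonCount (generalizedPetersen n k).Adj (family n k s 0).1 (family n k s 0).2

theorem octagonCount_familyEdge (hn : 3 ≤ n) (hk : 1 ≤ k) (hkn : 2 * k < n)
    (φ : generalizedPetersen n k ≃g G) (s : Fin 3) (i : ZMod n) :
    octagonCount G.Adj (familyEdge φ s i).1 (familyEdge φ s i).2 = familyCount n k s := by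
  have hn0 : NeZero n := ⟨by omega⟩
  have hadj : (generalizedPetersen n k).Adj (family n k s i).1 (family n k s i).2 :=
    (adj_iff_family hn hk hkn).2 ⟨s, i, Or.inl rfl⟩
  have h : octagonCount G.Adj (φ (family n k s i).1) (φ (family n k s i).2) =
      familyCount n k s := by
    rw [octagonCount_iso]
    fin_cases s
    · simpa [familyCount, family] using octagonCount_outer (k := k) i
    · simpa [familyCount, family] using octagonCount_spoke (k := k) i
    · simpa [familyCount, family] using octagonCount_inner (k := k) i
  rw [← h, familyEdge]
  rcases (edgeOf_eq_iff (isEdge_edgeOf (φ.map_adj_iff.2 hadj)).1).1 rfl with ⟨h1, h2⟩ | ⟨h1, h2⟩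
  · rw [h1, h2]
  · rw [h1, h2]
    exact octagonCount_comm (fun _ _ h => SimpleGraph.Adj.symm h) (φ.map_adj_iff.2 hadj.symm)

/-- Three numbers that are not all equal: one of them differs from the other two. -/
theorem exists_familyCount_unique (hn : 3 ≤ n) (hk : 1 ≤ k) (hkn : 2 * k < n)
    (hne : n ∉ [3, 4, 5, 8, 10, 12, 13, 24, 26]) :
    ∃ s, ∀ s', familyCount n k s' = familyCount n k s → s' = s := by
  have h : familyCount n k 0 ≠ familyCount n k 1 ∨ familyCount n k 1 ≠ familyCount n k 2 := by
    simpa [familyCount, family] using octagonCount_not_all_equal hn hk hkn hne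
  by_cases h01 : familyCount n k 0 = familyCount n k 1
  · exact ⟨2, fun s' => by fin_cases s' <;> simp <;> omega⟩
  · by_cases h02 : familyCount n k 0 = familyCount n k 2
    · exact ⟨1, fun s' => by fin_cases s' <;> simp <;> omega⟩
    · exact ⟨0, fun s' => by fin_cases s' <;> simp <;> omega⟩

/-- A part of minimal cardinality is one of the three families of edges. Parts are unions of
families, and each family has `n` members; some family is a part by itself, so that no union of two
families is minimal. -/
theorem IsPartition.exists_family (hn : 3 ≤ n) (hk : 1 ≤ k) (hkn : 2 * k < n)
    (hne : n ∉ [3, 4, 5, 8, 10, 12, 13, 24, 26]) (φ : generalizedPetersen n k ≃g G)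
    {E : List (Edge N)} (hE : ∀ e, e ∈ E ↔ IsEdge G e) {P : List (Part N)}
    (hP : IsPartition (fun e => octagonCount G.Adj e.1 e.2) E P) {p : Part N} (hp : p ∈ P)
    (hmin : ∀ q ∈ P, p.2.2 ≤ q.2.2) :
    p.2.2 = n ∧ ∃ s, ∀ e, e ∈ p.2.1 ↔ ∃ i, familyEdge φ s i = e := by
  have hn0 : NeZero n := ⟨by omega⟩
  have hmem : ∀ q ∈ P, ∀ e, e ∈ q.2.1 ↔ ∃ s i, familyCount n k s = q.1 ∧
      familyEdge φ s i = e := by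
    intro q hq e
    rw [hP.mem_iff q hq, hE, isEdge_iff_familyEdge hn hk hkn φ]
    constructor
    · rintro ⟨⟨s, i, rfl⟩, h⟩
      exact ⟨s, i, by rw [← h, octagonCount_familyEdge hn hk hkn], rfl⟩
    · rintro ⟨s, i, h, rfl⟩
      exact ⟨⟨s, i, rfl⟩, by rw [← h, octagonCount_familyEdge hn hk hkn]⟩
  have hsize : ∀ q ∈ P, q.2.2 = (Finset.univ.filter fun s => familyCount n k s = q.1).card * n := by
    intro q hq
    have : q.2.1.toFinset = ((Finset.univ.filter fun s => familyCount n k s = q.1) ×ˢ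
        (Finset.univ : Finset (ZMod n))).image fun p => familyEdge φ p.1 p.2 := by
      ext e
      rw [List.mem_toFinset, hmem q hq]
      simp
    rw [hP.size q hq, ← List.toFinset_card_of_nodup (hP.nodup q hq), this,
      Finset.card_image_of_injective _ (familyEdge_injective hn hk hkn φ), Finset.card_product,
      Finset.card_univ, ZMod.card]
  have hkey : ∀ s, ∃ q ∈ P, q.1 = familyCount n k s := by
    intro s
    have := (hP.mem_keys (familyCount n k s)).2 ⟨familyEdge φ s 0,
      (hE _).2 ((isEdge_iff_familyEdge hn hk hkn φ _).2 ⟨s, 0, rfl⟩),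
      octagonCount_familyEdge hn hk hkn φ s 0⟩
    simpa using this
  obtain ⟨s₀, hs₀⟩ := exists_familyCount_unique hn hk hkn hne
  obtain ⟨q, hq, hqs⟩ := hkey s₀
  have hqn : q.2.2 = n := by
    have : (Finset.univ.filter fun s => familyCount n k s = q.1) = {s₀} := by
      ext s
      simp only [Finset.mem_filter, Finset.mem_univ, true_and, Finset.mem_singleton, hqs]
      exact ⟨hs₀ s, fun h => by rw [h]⟩
    rw [hsize q hq, this, Finset.card_singleton, one_mul]
  obtain ⟨e, he, hes⟩ := (hP.mem_keys p.1).1 (List.mem_map_of_mem hp)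
  obtain ⟨s, i, rfl⟩ := (isEdge_iff_familyEdge hn hk hkn φ e).1 ((hE e).1 he)
  rw [octagonCount_familyEdge hn hk hkn] at hes
  have hle := hmin q hq
  rw [hqn, hsize p hp] at hle
  have hs : s ∈ Finset.univ.filter fun s => familyCount n k s = p.1 := by simpa using hes
  have hcard : (Finset.univ.filter fun s => familyCount n k s = p.1).card = 1 := by
    have h1 := Finset.card_pos.2 ⟨s, hs⟩
    have h2 : (Finset.univ.filter fun s => familyCount n k s = p.1).card ≤ 1 :=
      Nat.le_of_mul_le_mul_right (by simpa using hle) (by omega : 0 < n)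
    omega
  refine ⟨by rw [hsize p hp, hcard, one_mul], s, fun e => ?_⟩
  rw [hmem p hp]
  constructor
  · rintro ⟨s', j, h, rfl⟩
    have : s' = s := Finset.card_le_one.1 hcard.le s' (by simpa using h) s hs
    exact ⟨j, by rw [this]⟩
  · rintro ⟨j, rfl⟩
    exact ⟨s, j, hes, rfl⟩

/-- The spokes form a perfect matching, which interchanges the two rims. -/
theorem edgeOf_mem_spokes {φ : generalizedPetersen n k ≃g G} {U : List (Edge N)}
    (hU : ∀ e, e ∈ U ↔ ∃ i, familyEdge φ 1 i = e) (x y : ZMod n ⊕ ZMod n) :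
    edgeOf (φ x) (φ y) ∈ U ↔ y = x.swap := by
  rw [hU]
  simp only [familyEdge, edgeOf_eq_edgeOf_iff, φ.injective.eq_iff]
  rcases x with x | x <;> rcases y with y | y <;> simp [family, eq_comm]

/-- If the chosen part consists of the spokes, then its deletion leaves the two rims. The outer rim
is a cycle of length `n`, so that a largest component is a whole rim. -/
theorem sat_mainMatching_of_spokes (hA : IsAdjacencyList G A) (hn : 3 ≤ n) (hk : 1 ≤ k)
    (hkn : 2 * k < n) (φ : generalizedPetersen n k ≃g G) (hN : 2 * n = N) {U : List (Edge N)}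
    (hlt : ∀ e ∈ U, e.1 < e.2) (hU : ∀ e, e ∈ U ↔ ∃ i, familyEdge φ 1 i = e) :
    (mainMatching A n U).Sat fun b _ => b = true := by
  have hn0 : NeZero n := ⟨by omega⟩
  rw [mainMatching, sat_bind]
  refine (sat_partners hlt).mono ?_
  rintro mate t₁ ⟨hmate, -⟩
  have hmem := edgeOf_mem_spokes hU
  have hmate : ∀ x, mate (φ x) = some (φ x.swap) := by
    intro x
    cases h : mate (φ x) with
    | none => exact absurd ((hmem x x.swap).2 rfl) ((hmate _).2 h _)
    | some w =>
      obtain ⟨y, rfl⟩ := φ.surjective w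
      rw [(hmem x y).1 ((hmate _).1 _ h)]
  have hrest : ∀ x y, RestAdj G mate (φ x) (φ y) ↔
      (generalizedPetersen n k).Adj x y ∧ x.isLeft = y.isLeft := by
    intro x y
    rw [RestAdj, hmate, φ.map_adj_iff, ne_eq, Option.some.injEq, φ.injective.eq_iff]
    rcases x with x | x <;> rcases y with y | y <;>
      simp [adj_inl_inr, adj_inr_inl, eq_comm]
  have hsymm : ∀ x w, RestAdj G mate x w → RestAdj G mate w x := by
    intro x w h
    obtain ⟨x, rfl⟩ := φ.surjective x
    obtain ⟨w, rfl⟩ := φ.surjective w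
    rw [hrest] at h ⊢
    exact ⟨h.1.symm, h.2.symm⟩
  have hside : ∀ x w, Relation.ReflTransGen (RestAdj G mate) x w →
      (φ.symm x).isLeft = (φ.symm w).isLeft := by
    intro x w h
    induction h with
    | refl => rfl
    | tail _ h ih =>
      rw [ih]
      refine ((hrest _ _).1 ?_).2
      simpa using h
  rw [sat_bind]
  refine (sat_components hA mate).mono ?_
  rintro cs t₂ ⟨⟨hcs, hcov, -⟩, -⟩
  rw [sat_bind]
  refine (sat_maximalMembers _ _).mono ?_
  rintro ms t₃ ⟨⟨hms, hne, -⟩, -⟩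
  obtain ⟨c₀, hc₀, h0⟩ := hcov (φ (Sum.inl 0))
  -- The outer rim is connected, so that some component has at least `n` vertices.
  have houter : n ≤ c₀.2 := by
    have hall : ∀ i : ℕ, φ (Sum.inl (i : ZMod n)) ∈ c₀.1 := by
      intro i
      induction i with
      | zero => simpa using h0
      | succ i ih =>
        refine (hcs c₀ hc₀).closed hsymm _ ih _ ((hrest _ _).2 ⟨?_, rfl⟩)
        rw [adj_inl_inl hn]
        simp
    have hsub : Finset.univ.image (fun i : ZMod n => φ (Sum.inl i)) ⊆ c₀.1.toFinset := by
      intro x hx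
      obtain ⟨i, -, rfl⟩ := Finset.mem_image.1 hx
      rw [List.mem_toFinset]
      simpa using hall i.val
    have hcard := Finset.card_le_card hsub
    rw [Finset.card_image_of_injective _ (fun i j h => Sum.inl_injective (φ.injective h)),
      Finset.card_univ, ZMod.card] at hcard
    rw [(hcs c₀ hc₀).size]
    exact hcard.trans (List.toFinset_card_le _)
  match ms, hms, hne with
  | [], _, hne => exact absurd rfl (hne (List.ne_nil_of_mem hc₀))
  | c :: ms, hms, _ =>
    simp only
    rw [sat_bind]
    refine (sat_pick c ms).mono ?_
    rintro c' t₄ ⟨hc', -⟩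
    obtain ⟨hcP, hmax⟩ := hms c' hc'
    have hc := hcs c' hcP
    have hlen : n ≤ c'.1.toFinset.card := by
      rw [List.toFinset_card_of_nodup hc.nodup, ← hc.size]
      exact houter.trans (hmax c₀ hc₀)
    have hrim : ∀ f : ZMod n → ZMod n ⊕ ZMod n, Function.Injective f →
        (∀ x ∈ c'.1, ∃ i, φ (f i) = x) → ∀ x, x ∈ c'.1 ↔ ∃ i, φ (f i) = x := by
      intro f hf hsub
      have heq : c'.1.toFinset = Finset.univ.image fun i => φ (f i) := by
        refine Finset.eq_of_subset_of_card_le (fun x hx => ?_) ?_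
        · obtain ⟨i, hi⟩ := hsub x (List.mem_toFinset.1 hx)
          exact Finset.mem_image.2 ⟨i, Finset.mem_univ i, hi⟩
        · rwa [Finset.card_image_of_injective _ (fun i j h => hf (φ.injective h)),
            Finset.card_univ, ZMod.card]
      intro x
      rw [← List.mem_toFinset, heq]
      simp
    rw [sat_bind]
    refine (sat_toSet c'.1).mono ?_
    rintro S t₅ ⟨hS, -⟩
    have hor : (∀ x, S x = true ↔ ∃ i, φ (Sum.inl i) = x) ∨
        (∀ x, S x = true ↔ ∃ i, φ (Sum.inr i) = x) := by
      simp only [hS]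
      obtain ⟨x₀, hx₀⟩ := hc.reach
      cases h : (φ.symm x₀).isLeft with
      | true =>
        refine Or.inl (hrim _ Sum.inl_injective fun x hx => ?_)
        have := hside _ _ (hx₀ x hx)
        rw [h] at this
        obtain ⟨i, hi⟩ := Sum.isLeft_iff.1 this.symm
        exact ⟨i, by rw [← hi, RelIso.apply_symm_apply]⟩
      | false =>
        refine Or.inr (hrim _ Sum.inr_injective fun x hx => ?_)
        have := hside _ _ (hx₀ x hx)
        rw [h] at this
        obtain ⟨i, hi⟩ := Sum.isRight_iff.1 (by simpa using this.symm)
        exact ⟨i, by rw [← hi, RelIso.apply_symm_apply]⟩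
    have hreg : TwoRegular G S := by
      rcases hor with h | h
      · exact (isCirculant_outer hn φ h).twoRegular
      · exact (isCirculant_inner hk hkn φ h).twoRegular
    rw [sat_bind]
    refine (sat_isTwoRegular hA S).mono ?_
    rintro b t₆ ⟨hb, -⟩
    rw [sat_ite]
    exact ⟨fun _ => (sat_extend_of_rim hA hn hk hkn φ hN S hor).mono fun b t h => h,
      fun h => absurd (hb.2 hreg) h⟩

/-- In the subgraph formed by the edges of a rim, the vertices of the rim have degree `2` and the
others have degree `0`. -/
theorem length_of_rim {U : List (Edge N)} {ψ : ZMod n → Fin N} (hψ : Function.Injective ψ)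
    {d : ZMod n} (hd : d + d ≠ 0) (hU : ∀ e, e ∈ U ↔ ∃ i, edgeOf (ψ i) (ψ (i + d)) = e)
    {x : Fin N} {l : List (Fin N)} (hl : l.Nodup) (hmem : ∀ w, w ∈ l ↔ edgeOf x w ∈ U) :
    (l.length = 0 ∨ l.length = 2) ∧ (l.length ≠ 0 ↔ ∃ i, ψ i = x) := by
  simp only [hU, edgeOf_eq_edgeOf_iff] at hmem
  by_cases hx : ∃ i, ψ i = x
  · have : l.length = 2 := by
      rw [length_eq_two_iff hl hmem]
      obtain ⟨i, rfl⟩ := hx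
      refine ⟨ψ (i + d), ψ (i - d), fun h => hd ?_, fun w => ⟨?_, ?_⟩⟩
      · have := hψ h
        linear_combination this
      · rintro ⟨j, ⟨h1, h2⟩ | ⟨h1, h2⟩⟩
        · rw [← hψ h1]
          exact Or.inl h2.symm
        · rw [← hψ h2, add_sub_cancel_right]
          exact Or.inr h1.symm
      · rintro (rfl | rfl)
        · exact ⟨i, Or.inl ⟨rfl, rfl⟩⟩
        · exact ⟨i - d, Or.inr ⟨rfl, by rw [sub_add_cancel]⟩⟩
    simp [this, hx]
  · have : l = [] := by
      refine List.eq_nil_iff_forall_not_mem.2 fun w hw => ?_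
      obtain ⟨i, ⟨h, -⟩ | ⟨-, h⟩⟩ := (hmem w).1 hw
      · exact hx ⟨i, h⟩
      · exact hx ⟨i + d, h⟩
    simp [this, hx]

theorem sat_mainRegular_of_rim (hA : IsAdjacencyList G A) (hn : 3 ≤ n) (hk : 1 ≤ k)
    (hkn : 2 * k < n) (φ : generalizedPetersen n k ≃g G) (hN : 2 * n = N) {deg : Fin N → ℕ}
    (h02 : ∀ x, deg x = 0 ∨ deg x = 2) (hrim : (∀ x, deg x ≠ 0 ↔ ∃ i, φ (Sum.inl i) = x) ∨
      (∀ x, deg x ≠ 0 ↔ ∃ i, φ (Sum.inr i) = x)) :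
    (mainRegular A n deg).Sat fun b _ => b = true := by
  refine sat_mainRegular_of_extend (fun S hS _ => ?_) fun h => absurd h02 h
  simp only [← hS] at hrim
  exact (sat_extend_of_rim hA hn hk hkn φ hN S hrim).mono fun b _ h _ _ => h

end Complete

/-- The soundness and the running time of `Main`. -/
theorem sat_mainProcedure : ∃ C : ℕ, ∀ {N : ℕ} {G : SimpleGraph (Fin N)}
    {A : Fin N → Fin 3 → Fin N} (_ : IsAdjacencyList G A), 0 < N →
    (mainProcedure A).Sat fun b t => (b = true → IsGeneralizedPetersen G) ∧ t ≤ C * N := by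
  obtain ⟨c, h⟩ := sat_sigmaPartition
  refine ⟨20 * c + 2000, fun {N G A} hA hN0 => ?_⟩
  have hN := two_mul_div_two hA
  -- The constant terms in the bounds are absorbed by means of `1 ≤ N`.
  have hc : c * (N + 1) = c * N + c := by ring
  have hc' : c ≤ c * N := Nat.le_mul_of_pos_right c hN0
  have hC : (20 * c + 2000) * N = 20 * (c * N) + 2000 * N := by ring
  rw [mainProcedure, sat_bind, sat_op, sat_bind]
  refine (h hA).mono ?_
  rintro P t₁ ⟨⟨E, hE, hP, hPc⟩, ht₁⟩
  rw [sat_bind]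
  refine (sat_minimalMembers _ _).mono ?_
  rintro ms t₂ ⟨⟨hms, -, hml⟩, ht₂⟩
  match ms, hms, hml with
  | [], _, _ =>
    simp only [sat_op]
    exact ⟨by simp, by omega⟩
  | p :: ps, hms, hml =>
    simp only
    rw [List.length_cons] at hml
    rw [sat_bind]
    refine (sat_pick p ps).mono ?_
    rintro p' t₃ ⟨hp', ht₃⟩
    have hp := (hms p' hp').1
    have hlt : ∀ e ∈ p'.2.1, e.1 < e.2 := fun e he =>
      ((hE e).1 ((hP.mem_iff p' hp e).1 he).1).1
    have hsize := hP.size p' hp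
    rw [sat_bind, sat_op, sat_ite, sat_op]
    refine ⟨fun hn => ?_, fun _ => ⟨by simp, by omega⟩⟩
    rw [decide_eq_true_eq] at hn
    have hU : p'.2.1.length ≤ N := by omega
    rw [sat_bind]
    refine (sat_degrees (hP.nodup p' hp) hlt).mono ?_
    rintro deg t₄ ⟨-, ht₄⟩
    rw [sat_bind]
    refine (sat_maxDegree deg).mono ?_
    rintro Δ t₅ ⟨-, ht₅⟩
    rw [sat_bind, sat_op, sat_ite]
    refine ⟨fun _ => (sat_mainMatching hA hN0 hN hlt hU).mono ?_,
      fun _ => (sat_mainRegular hA hN0 hN deg).mono ?_⟩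
    · rintro b t ⟨hb, ht⟩
      exact ⟨hb, by omega⟩
    · rintro b t ⟨hb, ht⟩
      exact ⟨hb, by omega⟩

/-- The completeness of `Main`. -/
theorem sat_mainProcedure_of_iso {N : ℕ} {G : SimpleGraph (Fin N)} {A : Fin N → Fin 3 → Fin N}
    (hA : IsAdjacencyList G A) {n k : ℕ} (hn : 3 ≤ n) (hk : 1 ≤ k) (hkn : 2 * k < n)
    (hne : n ∉ [3, 4, 5, 8, 10, 12, 13, 24, 26]) (φ : generalizedPetersen n k ≃g G)
    (hN : 2 * n = N) : (mainProcedure A).Sat fun b _ => b = true := by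
  have hN2 : N / 2 = n := by omega
  obtain ⟨c, h⟩ := sat_sigmaPartition
  rw [mainProcedure, sat_bind, sat_op, hN2, sat_bind]
  refine (h hA).mono ?_
  rintro P t₁ ⟨⟨E, hE, hP, -⟩, -⟩
  rw [sat_bind]
  refine (sat_minimalMembers _ _).mono ?_
  rintro ms t₂ ⟨⟨hms, hms0, -⟩, -⟩
  have hP0 : P ≠ [] := by
    have := (hP.mem_keys _).2 ⟨familyEdge φ 0 0,
      (hE _).2 ((isEdge_iff_familyEdge hn hk hkn φ _).2 ⟨0, 0, rfl⟩), rfl⟩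
    rintro rfl
    simp at this
  match ms, hms, hms0 with
  | [], _, hms0 => exact absurd rfl (hms0 hP0)
  | p :: ps, hms, _ =>
    simp only
    rw [sat_bind]
    refine (sat_pick p ps).mono ?_
    rintro p' t₃ ⟨hp', -⟩
    obtain ⟨hp, hmin⟩ := hms p' hp'
    have hlt : ∀ e ∈ p'.2.1, e.1 < e.2 := fun e he =>
      ((hE e).1 ((hP.mem_iff p' hp e).1 he).1).1
    obtain ⟨hpn, s, hU⟩ := hP.exists_family hn hk hkn hne φ hE hp hmin
    rw [sat_bind, sat_op, sat_ite]
    refine ⟨fun _ => ?_, fun h => absurd (decide_eq_true hpn) h⟩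
    rw [sat_bind]
    refine (sat_degrees (hP.nodup p' hp) hlt).mono ?_
    rintro deg t₄ ⟨hdeg, -⟩
    rw [sat_bind]
    refine (sat_maxDegree deg).mono ?_
    rintro Δ t₅ ⟨⟨hle, hmax⟩, -⟩
    rw [sat_bind, sat_op, sat_ite, decide_eq_true_eq]
    by_cases hs : s = 1
    · subst hs
      refine ⟨fun _ => sat_mainMatching_of_spokes hA hn hk hkn φ hN hlt hU, fun hΔ => ?_⟩
      -- Every vertex is an end of exactly one spoke.
      have h1 : ∀ x, deg x = 1 := by
        intro x
        obtain ⟨x, rfl⟩ := φ.surjective x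
        obtain ⟨l, hnd, hl, hlen⟩ := hdeg (φ x)
        rw [hlen, ← List.toFinset_card_of_nodup hnd, Finset.card_eq_one]
        refine ⟨φ x.swap, ?_⟩
        ext w
        obtain ⟨y, rfl⟩ := φ.surjective w
        rw [List.mem_toFinset, hl, edgeOf_mem_spokes hU, Finset.mem_singleton,
          φ.injective.eq_iff]
      have hx := hle (φ (Sum.inl 0))
      rw [h1] at hx
      rcases hmax with h | ⟨y, h⟩
      · omega
      · rw [h1] at h
        exact absurd h.symm hΔ
    · have hrim : (∀ x, deg x = 0 ∨ deg x = 2) ∧ ((∀ x, deg x ≠ 0 ↔ ∃ i, φ (Sum.inl i) = x) ∨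
          (∀ x, deg x ≠ 0 ↔ ∃ i, φ (Sum.inr i) = x)) := by
        have key : ∀ {ψ : ZMod n → Fin N} (_ : Function.Injective ψ) {d : ZMod n} (_ : d + d ≠ 0)
            (_ : ∀ e, e ∈ p'.2.1 ↔ ∃ i, edgeOf (ψ i) (ψ (i + d)) = e), ∀ x,
            (deg x = 0 ∨ deg x = 2) ∧ (deg x ≠ 0 ↔ ∃ i, ψ i = x) := by
          intro ψ hψ d hd hU x
          obtain ⟨l, hnd, hl, hlen⟩ := hdeg x
          rw [hlen]
          exact length_of_rim hψ hd hU hnd hl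
        have hs : s = 0 ∨ s = 2 := by omega
        rcases hs with rfl | rfl
        · have := key (ψ := fun i => φ (Sum.inl i))
            (fun i j h => Sum.inl_injective (φ.injective h)) (d := 1)
            (by rw [one_add_one_eq_two]; exact two_ne_zero_zmod hn) hU
          exact ⟨fun x => (this x).1, Or.inl fun x => (this x).2⟩
        · have := key (ψ := fun i => φ (Sum.inr i))
            (fun i j h => Sum.inr_injective (φ.injective h))
            (two_mul_natCast_ne_zero_zmod hk hkn) hU
          exact ⟨fun x => (this x).1, Or.inr fun x => (this x).2⟩
      refine ⟨fun hΔ => ?_, fun _ => sat_mainRegular_of_rim hA hn hk hkn φ hN hrim.1 hrim.2⟩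
      rcases hmax with h | ⟨y, h⟩
      · omega
      · have := hrim.1 y
        omega

end Recognition

theorem mainTheorem3 :
    ∃ C : ℕ, ∀ (N : ℕ) (G : SimpleGraph (Fin N)) (A : Fin N → Fin 3 → Fin N),
      0 < N → N ∉ ({6, 8, 10, 16, 20, 24, 26, 48, 52} : Set ℕ) →
      Recognition.IsAdjacencyList G A →
      ∀ (answer : Bool) (t : ℕ), (Recognition.mainProcedure A).Runs answer t →
        (answer = true ↔ IsGeneralizedPetersen G) ∧ t ≤ C * N := by
  obtain ⟨C, h⟩ := Recognition.sat_mainProcedure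
  refine ⟨C, fun N G A hN0 hNne hA answer t hrun => ?_⟩
  obtain ⟨hsound, ht⟩ := h hA hN0 answer t hrun
  refine ⟨⟨hsound, ?_⟩, ht⟩
  rintro ⟨n, k, hn, hk, hkn, ⟨φ⟩⟩
  have hn0 : NeZero n := ⟨by omega⟩
  have hN : 2 * n = N := by
    have := Fintype.card_congr φ.toEquiv
    rw [Fintype.card_fin, Fintype.card_sum, ZMod.card] at this
    omega
  refine Recognition.sat_mainProcedure_of_iso hA hn hk hkn ?_ φ.symm hN answer t hrun
  -- The values of `N = 2 n` that are excluded correspond to the exceptional values of `n`.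
  simp only [Set.mem_insert_iff, Set.mem_singleton_iff] at hNne
  simp only [List.mem_cons, List.not_mem_nil, or_false]
  omega
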